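/- **Setting.** A (real) quasi-Banach space $X$ is a complete quasi-normed space: $\|\cdot\|$ satisfies the axioms of a norm, except that the triangle inequality is replaced by $\|x+y\|\le C(\|x\|+\|y\|)$ with a constant $C$ independent of $x,y$. The quasi-norm is assumed continuous for the topology it defines (as holds for every norm and every $r$-norm). An $X$-valued random variable is a Borel measurable map with separable range, and $\|\xi\|_p=(\mathbb E\|\xi\|^p)^{1/p}$. Let $(\Omega,\mathcal A,\mathbb P)$ be a complete probability space with a filtration $(\mathcal F_n)_{n\ge1}$, let $\mathcal F_0=\{\Omega,\varnothing\}$ and $\mathcal F_\infty=\sigma(\mathcal F_n:n\ge 1)$. For sequences $f=(f_n)_{n\ge1}$, $g=(g_n)_{n\ge1}$ of $X$-valued functions put $f_0=g_0=0$, $d_n=f_n-f_{n-1}$, $e_n=g_n-g_{n-1}$. If $f$ is adapted, $g$ is called a *decoupled sum sequence* of $f$ if the $e_n$ are random variables such that $\mathbb P(d_n\in B\mid\mathcal F_{n-1})=\mathbb P(e_n\in B\mid\mathcal F_\infty)$ a.s. for all $n\ge1$ and all Borel sets $B\subseteq X$, and $\mathbb P(e_1\in B_1,\dots,e_n\in B_n\mid\mathcal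 F_\infty)=\prod_{k=1}^n\mathbb P(e_k\in B_k\mid\mathcal F_\infty)$ a.s. for all $n\geq 1$ and all Borel sets $B_1,\dots,B_n\subseteq X$. For $p\in(0,\infty)$ the *decoupling inequality holds in $X$ for $p$* if there is a constant $D\ge 0$ such that $\|f_n\|_p\le D\|g_n\|_p$ for all $n\ge1$, for all complete probability spaces with a filtration, all adapted sequences $f$ of $X$-valued random variables with $\|f_n\|_p<\infty$ for all $n$, and all decoupled sum sequences $g$ of $f$. The least such constant is denoted by $D_p(X)$ ($\infty$ if there is none). The *decoupling inequality holds in $X$* if it holds for some $p\in(0,\infty)$. **Corollary 4.5.** Let $Y$ be a quasi-Banach space in which the decoupling inequality holds, let $(S,\Sigma,\mu)$ be a measure space. Then for every $q\in(0,\infty)$ the decoupling inequality holds in $L^q(S;Y)$ for every $p\in(0,\infty)$. Moreover, if there is a set $A\in\Sigma$ with $0<\mu(A)<\infty$, then $$D_p(L^p(S;Y))=D_p(Y)\qquad\text{for every } p\in(0,\infty).$$ -/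

import Mathlib

open MeasureTheory ProbabilityTheory Filter
open scoped ENNReal NNReal Topology

universe u v w

/-- The datum of a quasi-norm; its laws are in `QuasiBanachSpace`. -/
class QuasiNorm (X : Type u) where
  /-- the quasi-norm -/
  qnorm : X → ℝ

open QuasiNorm

/-- The topology of a quasi-norm: a set is open if it contains a ball around each of its points. -/
instance quasiNormTopology (X : Type u) [AddCommGroup X] [QuasiNorm X] : TopologicalSpace X where
  IsOpen U := ∀ x ∈ U, ∃ ε : ℝ, 0 < ε ∧ ∀ y, qnorm (y - x) < ε → y ∈ U
  isOpen_univ := fun _ _ => ⟨1, one_pos, fun _ _ => trivial⟩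
  isOpen_inter := by
    intro U V hU hV x hx
    obtain ⟨a, ha, hU'⟩ := hU x hx.1
    obtain ⟨b, hb, hV'⟩ := hV x hx.2
    exact ⟨min a b, lt_min ha hb, fun y hy =>
      ⟨hU' y (hy.trans_le (min_le_left _ _)), hV' y (hy.trans_le (min_le_right _ _))⟩⟩
  isOpen_sUnion := by
    intro 𝒰 h x hx
    obtain ⟨U, hU, hxU⟩ := hx
    obtain ⟨a, ha, h'⟩ := h U hU x hxU
    exact ⟨a, ha, fun y hy => ⟨U, hU, h' y hy⟩⟩

/-- (Real) quasi-Banach spaces. The quasi-norm is taken to be continuous for the topology that it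
defines, which holds for every norm and every `r`-norm; it makes the norm of a random variable
measurable. -/
class QuasiBanachSpace (X : Type u) [AddCommGroup X] [Module ℝ X] [QuasiNorm X] : Prop where
  qnorm_nonneg : ∀ x : X, 0 ≤ qnorm x
  qnorm_eq_zero_iff : ∀ x : X, qnorm x = 0 ↔ x = 0
  qnorm_smul : ∀ (a : ℝ) (x : X), qnorm (a • x) = |a| * qnorm x
  exists_qnorm_add_le : ∃ C : ℝ, ∀ x y : X, qnorm (x + y) ≤ C * (qnorm x + qnorm y)
  complete : ∀ x : ℕ → X,
    (∀ ε : ℝ, 0 < ε → ∃ N, ∀ m ≥ N, ∀ n ≥ N, qnorm (x m - x n) < ε) →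
    ∃ a : X, Tendsto (fun n => qnorm (x n - a)) atTop (𝓝 0)
  continuous_qnorm : Continuous (qnorm : X → ℝ)

namespace QuasiBanachSpace

section Basic

variable {X : Type u} [AddCommGroup X] [Module ℝ X] [QuasiNorm X] [QuasiBanachSpace X]

theorem qnorm_zero : qnorm (0 : X) = 0 := (qnorm_eq_zero_iff 0).2 rfl

theorem qnorm_neg (x : X) : qnorm (-x) = qnorm x := by
  have h := qnorm_smul (-1 : ℝ) x
  simpa using h

theorem exists_modulus (X : Type u) [AddCommGroup X] [Module ℝ X] [QuasiNorm X]
    [QuasiBanachSpace X] :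
    ∃ C : ℝ, 1 ≤ C ∧ ∀ x y : X, qnorm (x + y) ≤ C * (qnorm x + qnorm y) := by
  obtain ⟨C, hC⟩ := exists_qnorm_add_le (X := X)
  refine ⟨max C 1, le_max_right _ _, fun x y => (hC x y).trans ?_⟩
  exact mul_le_mul_of_nonneg_right (le_max_left _ _)
    (add_nonneg (qnorm_nonneg x) (qnorm_nonneg y))

theorem nhds_hasBasis (x : X) :
    (𝓝 x).HasBasis (fun ε : ℝ => 0 < ε) (fun ε => {y | qnorm (y - x) < ε}) := by
  obtain ⟨C, hC1, hC⟩ := exists_modulus X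
  have hC0 : 0 < C := one_pos.trans_le hC1
  refine ⟨fun s => ⟨fun hs => ?_, fun hs => ?_⟩⟩
  · obtain ⟨U, hUs, hU, hxU⟩ := mem_nhds_iff.1 hs
    obtain ⟨ε, hε, h⟩ := hU x hxU
    exact ⟨ε, hε, fun y hy => hUs (h y hy)⟩
  · obtain ⟨ε, hε, h⟩ := hs
    refine mem_nhds_iff.2 ⟨{y | ∃ δ : ℝ, 0 < δ ∧ ∀ z, qnorm (z - y) < δ → z ∈ s}, ?_, ?_, ?_⟩
    · rintro y ⟨δ, hδ, hy⟩
      exact hy y (by simpa [qnorm_zero] using hδ)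
    · rintro y ⟨δ, hδ, hy⟩
      refine ⟨δ / (2 * C), by positivity, fun z hz => ⟨δ / (2 * C), by positivity, ?_⟩⟩
      intro t ht
      refine hy t ?_
      have h1 := hC (t - z) (z - y)
      rw [sub_add_sub_cancel] at h1
      have h2 : C * (qnorm (t - z) + qnorm (z - y)) < C * (δ / (2 * C) + δ / (2 * C)) :=
        mul_lt_mul_of_pos_left (add_lt_add ht hz) hC0
      have h3 : C * (δ / (2 * C) + δ / (2 * C)) = δ := by field_simp; ring
      linarith
    · exact ⟨ε, hε, fun z hz => h hz⟩

instance : IsTopologicalAddGroup X where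
  continuous_add := by
    obtain ⟨C, hC1, hC⟩ := exists_modulus X
    have hC0 : 0 < C := one_pos.trans_le hC1
    refine continuous_iff_continuousAt.2 fun ⟨a, b⟩ => ?_
    rw [ContinuousAt, nhds_prod_eq,
      ((nhds_hasBasis a).prod (nhds_hasBasis b)).tendsto_iff (nhds_hasBasis (a + b))]
    intro ε hε
    refine ⟨(ε / (2 * C), ε / (2 * C)), ⟨by positivity, by positivity⟩, ?_⟩
    rintro ⟨x, y⟩ ⟨hx, hy⟩
    have hx' : qnorm (x - a) < ε / (2 * C) := hx
    have hy' : qnorm (y - b) < ε / (2 * C) := hy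
    have h1 := hC (x - a) (y - b)
    have h2 : C * (qnorm (x - a) + qnorm (y - b)) < C * (ε / (2 * C) + ε / (2 * C)) :=
      mul_lt_mul_of_pos_left (add_lt_add hx' hy') hC0
    have h3 : C * (ε / (2 * C) + ε / (2 * C)) = ε := by field_simp; ring
    have h4 : x - a + (y - b) = x + y - (a + b) := by abel
    rw [h4] at h1
    show qnorm (x + y - (a + b)) < ε
    linarith
  continuous_neg := by
    refine continuous_iff_continuousAt.2 fun a => ?_
    rw [ContinuousAt, (nhds_hasBasis a).tendsto_iff (nhds_hasBasis (-a))]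
    intro ε hε
    refine ⟨ε, hε, fun x hx => ?_⟩
    have h4 : -x - -a = -(x - a) := by abel
    show qnorm (-x - -a) < ε
    rw [h4, qnorm_neg]
    exact hx

instance : ContinuousConstSMul ℝ X where
  continuous_const_smul c := by
    refine continuous_iff_continuousAt.2 fun a => ?_
    rw [ContinuousAt, (nhds_hasBasis a).tendsto_iff (nhds_hasBasis (c • a))]
    intro ε hε
    refine ⟨ε / (|c| + 1), by positivity, fun x hx => ?_⟩
    show qnorm (c • x - c • a) < ε
    have hx' : qnorm (x - a) < ε / (|c| + 1) := hx
    rw [← smul_sub, qnorm_smul]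
    rw [lt_div_iff₀ (by positivity)] at hx'
    nlinarith [qnorm_nonneg (x - a), abs_nonneg c]

end Basic

end QuasiBanachSpace

noncomputable section

/-- The `L^p`-quasi-norm `(∫ ‖f‖^p dμ)^{1/p}` of a vector-valued function, in `[0, ∞]`. -/
def lpQNorm {S : Type v} [MeasurableSpace S] {X : Type u} [QuasiNorm X]
    (p : ℝ) (μ : Measure S) (f : S → X) : ℝ≥0∞ :=
  (∫⁻ s, ENNReal.ofReal (qnorm (f s)) ^ p ∂μ) ^ (1 / p)

section Lq

variable (Y : Type u) [AddCommGroup Y] [Module ℝ Y] [QuasiNorm Y] [QuasiBanachSpace Y]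
variable {S : Type v} [MeasurableSpace S]

/-- The subspace of (classes of) strongly measurable functions with finite `L^q`-quasi-norm. -/
def lqSubmodule (q : ℝ) (hq : 0 < q) (μ : Measure S) : Submodule ℝ (S →ₘ[μ] Y) where
  carrier := {f | lpQNorm q μ f < ∞}
  zero_mem' := by
    have h : lpQNorm q μ ((0 : S →ₘ[μ] Y) : S → Y) = 0 := by
      have h0 : ∫⁻ s, ENNReal.ofReal (qnorm ((0 : S →ₘ[μ] Y) s)) ^ q ∂μ = 0 := by
        rw [← lintegral_zero (μ := μ)]
        refine lintegral_congr_ae ?_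
        filter_upwards [AEEqFun.coeFn_zero (α := S) (β := Y) (μ := μ)] with s hs
        rw [hs]
        simp [QuasiBanachSpace.qnorm_zero, hq]
      rw [lpQNorm, h0, ENNReal.zero_rpow_of_pos (by positivity)]
    rw [Set.mem_ofPred_eq, h]
    exact ENNReal.zero_lt_top
  add_mem' := by
    intro f g hf hg
    rw [Set.mem_ofPred_eq, lpQNorm, ENNReal.rpow_lt_top_iff_of_pos (by positivity)] at *
    obtain ⟨C, hC1, hC⟩ := QuasiBanachSpace.exists_modulus Y
    have hC0 : 0 ≤ C := zero_le_one.trans hC1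
    set F : S → ℝ≥0∞ := fun s => ENNReal.ofReal (qnorm (f s)) with hF
    set G : S → ℝ≥0∞ := fun s => ENNReal.ofReal (qnorm (g s)) with hG
    have hFm : AEMeasurable (fun s => F s ^ q) μ := by
      have h := QuasiBanachSpace.continuous_qnorm.comp_aestronglyMeasurable f.aestronglyMeasurable
      exact (ENNReal.measurable_ofReal.comp_aemeasurable h.aemeasurable).pow_const q
    have hle : ∀ᵐ s ∂μ, ENNReal.ofReal (qnorm ((f + g : S →ₘ[μ] Y) s)) ^ q
        ≤ (ENNReal.ofReal C * 2) ^ q * (F s ^ q + G s ^ q) := by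
      filter_upwards [AEEqFun.coeFn_add f g] with s hs
      have h1 : ENNReal.ofReal (qnorm ((f + g : S →ₘ[μ] Y) s))
          ≤ ENNReal.ofReal C * 2 * max (F s) (G s) := by
        rw [hs]
        calc ENNReal.ofReal (qnorm (f s + g s))
            ≤ ENNReal.ofReal (C * (qnorm (f s) + qnorm (g s))) :=
              ENNReal.ofReal_le_ofReal (hC _ _)
          _ = ENNReal.ofReal C * (F s + G s) := by
              rw [ENNReal.ofReal_mul hC0, ENNReal.ofReal_add
                (QuasiBanachSpace.qnorm_nonneg _) (QuasiBanachSpace.qnorm_nonneg _)]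
          _ ≤ ENNReal.ofReal C * (max (F s) (G s) + max (F s) (G s)) := by
              gcongr
              · exact le_max_left _ _
              · exact le_max_right _ _
          _ = ENNReal.ofReal C * 2 * max (F s) (G s) := by rw [mul_assoc, two_mul]
      calc ENNReal.ofReal (qnorm ((f + g : S →ₘ[μ] Y) s)) ^ q
          ≤ (ENNReal.ofReal C * 2 * max (F s) (G s)) ^ q := ENNReal.rpow_le_rpow h1 hq.le
        _ = (ENNReal.ofReal C * 2) ^ q * max (F s) (G s) ^ q :=
            ENNReal.mul_rpow_of_nonneg _ _ hq.le
        _ ≤ (ENNReal.ofReal C * 2) ^ q * (F s ^ q + G s ^ q) := by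
            gcongr
            rcases le_total (F s) (G s) with h | h
            · rw [max_eq_right h]; exact le_add_self
            · rw [max_eq_left h]; exact le_self_add
    have hK : (ENNReal.ofReal C * 2) ^ q ≠ ∞ :=
      ENNReal.rpow_ne_top_of_nonneg hq.le (ENNReal.mul_ne_top ENNReal.ofReal_ne_top (by simp))
    calc ∫⁻ s, ENNReal.ofReal (qnorm ((f + g : S →ₘ[μ] Y) s)) ^ q ∂μ
        ≤ ∫⁻ s, (ENNReal.ofReal C * 2) ^ q * (F s ^ q + G s ^ q) ∂μ := lintegral_mono_ae hle
      _ = (ENNReal.ofReal C * 2) ^ q * (∫⁻ s, F s ^ q ∂μ + ∫⁻ s, G s ^ q ∂μ) := by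
          rw [lintegral_const_mul' _ _ hK, lintegral_add_left' hFm]
      _ < ∞ := ENNReal.mul_lt_top hK.lt_top (ENNReal.add_lt_top.2 ⟨hf, hg⟩)
  smul_mem' := by
    intro c f hf
    rw [Set.mem_ofPred_eq, lpQNorm, ENNReal.rpow_lt_top_iff_of_pos (by positivity)] at *
    have hK : ENNReal.ofReal |c| ^ q ≠ ∞ :=
      ENNReal.rpow_ne_top_of_nonneg hq.le ENNReal.ofReal_ne_top
    have h : ∫⁻ s, ENNReal.ofReal (qnorm ((c • f : S →ₘ[μ] Y) s)) ^ q ∂μ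
        = ENNReal.ofReal |c| ^ q * ∫⁻ s, ENNReal.ofReal (qnorm (f s)) ^ q ∂μ := by
      rw [← lintegral_const_mul' _ _ hK]
      refine lintegral_congr_ae ?_
      filter_upwards [AEEqFun.coeFn_smul c f] with s hs
      rw [hs, Pi.smul_apply, QuasiBanachSpace.qnorm_smul, ENNReal.ofReal_mul (abs_nonneg c),
        ENNReal.mul_rpow_of_nonneg _ _ hq.le]
    rw [h]
    exact ENNReal.mul_lt_top hK.lt_top hf

/-- The space `L^q(S; Y)`, `0 < q < ∞`. -/
def LqSpace (q : ℝ) (hq : 0 < q) (μ : Measure S) : Type (max u v) := ↥(lqSubmodule Y q hq μ)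

variable (q : ℝ) (hq : 0 < q) (μ : Measure S)

instance : AddCommGroup (LqSpace Y q hq μ) := inferInstanceAs (AddCommGroup (lqSubmodule Y q hq μ))

instance : Module ℝ (LqSpace Y q hq μ) := inferInstanceAs (Module ℝ (lqSubmodule Y q hq μ))

/-- The quasi-norm of `L^q(S; Y)`; `lpQNorm` is finite on this space. -/
instance : QuasiNorm (LqSpace Y q hq μ) where
  qnorm f := (lpQNorm q μ (f.1 : S → Y)).toReal

end Lq

section Decoupling

variable {X : Type u} [AddCommGroup X] [QuasiNorm X]
variable {Ω : Type w}

/-- `X`-valued random variables on `(Ω, m)`: Borel measurable maps with separable range. -/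
def IsRandomVariable (m : MeasurableSpace Ω) (ξ : Ω → X) : Prop :=
  Measurable[m, borel X] ξ ∧ TopologicalSpace.IsSeparable (Set.range ξ)

/-- The conditional probability `P(A | 𝓖) = E(1_A | 𝓖)`. -/
def condProb {mΩ : MeasurableSpace Ω} (P : Measure Ω) (𝓖 : MeasurableSpace Ω) (A : Set Ω) : Ω → ℝ :=
  P[A.indicator (fun _ => (1 : ℝ)) | 𝓖]

/-- `e` is an `F_∞`-decoupled tangent sequence of `d`, where `F_∞ = ⨆ n, F n`. The sequences are
indexed so that `d k` and `e k`, `k = 0, 1, …`, are the terms with number `k + 1`; thus `d k` is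
`F (k + 1)`-measurable and the preceding `σ`-algebra is `F k`. -/
structure IsDecoupledTangent {mΩ : MeasurableSpace Ω} (P : Measure Ω) (F : Filtration ℕ mΩ)
    (d e : ℕ → Ω → X) : Prop where
  randomVariable : ∀ k, IsRandomVariable mΩ (e k)
  tangent : ∀ k, ∀ B : Set X, MeasurableSet[borel X] B →
    condProb P (F k) (d k ⁻¹' B) =ᵐ[P] condProb P (⨆ n, F n) (e k ⁻¹' B)
  condIndep : ∀ n, ∀ B : ℕ → Set X, (∀ k, MeasurableSet[borel X] (B k)) →
    condProb P (⨆ n, F n) (⋂ k ∈ Finset.range n, e k ⁻¹' B k)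
      =ᵐ[P] fun ω => ∏ k ∈ Finset.range n, condProb P (⨆ n, F n) (e k ⁻¹' B k) ω

/-- `g` is an `F_∞`-decoupled sum sequence of `f`: the difference sequence of `g` is an
`F_∞`-decoupled tangent sequence of that of `f`. Here `f 0 = g 0 = 0` by convention. -/
def IsDecoupledSum {mΩ : MeasurableSpace Ω} (P : Measure Ω) (F : Filtration ℕ mΩ)
    (f g : ℕ → Ω → X) : Prop :=
  IsDecoupledTangent P F (fun k ω => f (k + 1) ω - f k ω) (fun k ω => g (k + 1) ω - g k ω)

variable (X)

/-- The decoupling inequality holds in `X` for `p` with constant `D`. The filtration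
`(F n)_{n ≥ 1}` is extended by the trivial `σ`-algebra `F 0`, and `f`, `g` by `f 0 = g 0 = 0`. -/
def DecouplingWith (p : ℝ) (D : ℝ≥0) : Prop :=
  ∀ (Ω : Type w) (mΩ : MeasurableSpace Ω) (P : Measure Ω), IsProbabilityMeasure P → P.IsComplete →
    ∀ F : Filtration ℕ mΩ, F 0 = ⊥ →
    ∀ f g : ℕ → Ω → X, f 0 = 0 → g 0 = 0 →
      (∀ n, IsRandomVariable (F n) (f n)) → (∀ n, lpQNorm p P (f n) < ∞) →
      IsDecoupledSum P F f g →
      ∀ n, lpQNorm p P (f n) ≤ D * lpQNorm p P (g n)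

/-- The decoupling inequality holds in `X` for `p`. -/
def DecouplingFor (p : ℝ) : Prop := ∃ D : ℝ≥0, DecouplingWith.{u, w} X p D

/-- The decoupling inequality holds in `X`, i.e. it holds for some `p ∈ (0, ∞)`. -/
def Decoupling : Prop := ∃ p : ℝ, 0 < p ∧ DecouplingFor.{u, w} X p

/-- The best constant `D_p(X)` in the decoupling inequality (`∞` if there is no constant). -/
def decouplingConst (p : ℝ) : ℝ≥0∞ :=
  ⨅ (D : ℝ≥0) (_ : DecouplingWith.{u, w} X p D), (D : ℝ≥0∞)

end Decoupling

end

/-! The proof treats a change of the space and a change of the exponent separately.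

Space. For equal exponents, Fubini writes the p-th moment of an L^p(S;Y)-valued sum as the integral
over s of the p-th moments of its values at s. For almost every s these values come from an adapted
sequence in Y and a decoupled sum sequence of it, so the inequality passes from Y to L^p(S;Y) with
the same constant (`DecouplingWith.of_evaluation`, `DecouplingWith.lqSpace`). Conversely, if 0 <
μ(A) < ∞, then y ↦ μ(A)^(-1/p) 1_A y embeds Y isometrically (`LqSpace.exists_isometry`), and the
best constants agree.

Exponent. In every quasi-Banach space the inequality for one p₀ implies it for all p
(`DecouplingFor.extrapolate`). Hence one passes from p₀ to q in Y, then to L^q(S;Y) for the exponent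
q, then from q to p inside L^q(S;Y).

For the extrapolation, all values lie in a closed separable subspace, which is Polish. So the
conditional law of d k given F k is the law of H k ω e with e uniform on [0,1]
(`exists_isTangentRep`), the terms H k ω (v k) on Ω × [0,1]^ℕ are a decoupled sequence, and every
other decoupled sum has the same moments (`IsTangentRep.lpQNorm_decoupled_eq`). For fixed ω the
decoupled sum is a sum of independent variables. Subtracting such a copy from d makes these
variables symmetric (`IsTangentRep.symmetrize`), which gives access to Lévy's inequality,
contraction by masks and a Hoffmann-Jørgensen inequality.

In the symmetric case, Davis' decomposition splits off the terms much larger than all predecessors;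
their sum is bounded by the largest term, whose tail is comparable with that of the largest
decoupled term (`IsTangentRep.measure_exists_mem_le`). The maximal function of the remaining sum
satisfies a good-λ inequality (`IsTangentRep.measure_smallMax_le`): the increments between the
levels λ and βλ form a bounded predictable transform of d, to which decoupling for p₀ applies, and
the conditional p₀-th moment of its decoupled version is controlled by conditional p-th moments
through Hoffmann-Jørgensen. Integrating the tails gives the p-th moment. -/

set_option linter.unusedSectionVars false

namespace QuasiBanachSpace

/-! ### Topology of quasi-Banach spaces -/

section Topology

variable {X : Type u} [AddCommGroup X] [Module ℝ X] [QuasiNorm X] [QuasiBanachSpace X]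

theorem tendsto_iff_qnorm_sub {ι : Type*} {l : Filter ι} {u : ι → X} {a : X} :
    Tendsto u l (𝓝 a) ↔ Tendsto (fun i => qnorm (u i - a)) l (𝓝 0) := by
  rw [(nhds_hasBasis a).tendsto_right_iff,
    (nhds_basis_abs_sub_lt (0 : ℝ)).tendsto_right_iff]
  simp [abs_of_nonneg (qnorm_nonneg _)]

theorem qnorm_sub_comm (x y : X) : qnorm (x - y) = qnorm (y - x) := by
  rw [← qnorm_neg, neg_sub]

instance : ContinuousSMul ℝ X where
  continuous_smul := by
    obtain ⟨C, hC1, hC⟩ := exists_modulus X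
    refine continuous_iff_continuousAt.2 fun ⟨a, x⟩ => ?_
    rw [ContinuousAt, tendsto_iff_qnorm_sub]
    have hlim : Tendsto (fun z : ℝ × X => C * (|z.1| * qnorm (z.2 - x) + |z.1 - a| * qnorm x))
        (𝓝 (a, x)) (𝓝 (C * (|a| * qnorm (x - x) + |a - a| * qnorm x))) := by
      have h1 : Continuous fun z : ℝ × X => qnorm (z.2 - x) :=
        continuous_qnorm.comp (continuous_snd.sub continuous_const)
      exact (by fun_prop : Continuous fun z : ℝ × X =>
        C * (|z.1| * qnorm (z.2 - x) + |z.1 - a| * qnorm x)).continuousAt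
    have h0 : C * (|a| * qnorm (x - x) + |a - a| * qnorm x) = 0 := by simp [qnorm_zero]
    rw [h0] at hlim
    refine squeeze_zero (fun z => qnorm_nonneg _) (fun z => ?_) hlim
    have h := hC (z.1 • (z.2 - x)) ((z.1 - a) • x)
    rw [qnorm_smul, qnorm_smul] at h
    convert h using 2
    rw [smul_sub, sub_smul]; abel

instance : T2Space X := by
  have : T1Space X := by
    refine ⟨fun x => ?_⟩
    have h : ({x} : Set X) = (fun y => qnorm (y - x)) ⁻¹' {0} := by
      ext y; simp [qnorm_eq_zero_iff, sub_eq_zero]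
    rw [h]
    exact isClosed_singleton.preimage (continuous_qnorm.comp (continuous_id.sub continuous_const))
  infer_instance

instance : FirstCountableTopology X where
  nhds_generated_countable x := by
    have hb : (𝓝 x).HasBasis (fun _ : ℕ => True)
        (fun n => {y | qnorm (y - x) < 1 / ((n : ℝ) + 1)}) := by
      refine ⟨fun s => ⟨fun hs => ?_, ?_⟩⟩
      · obtain ⟨ε, hε, h⟩ := (nhds_hasBasis x).mem_iff.1 hs
        obtain ⟨n, hn⟩ := exists_nat_one_div_lt hε
        exact ⟨n, trivial, fun y hy => h (lt_trans hy hn)⟩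
      · rintro ⟨n, -, h⟩
        exact (nhds_hasBasis x).mem_iff.2 ⟨1 / ((n : ℝ) + 1), by positivity, h⟩
    exact hb.isCountablyGenerated

/-- The group uniformity is countably generated, so completeness along sequences suffices. Together
with separability this makes the space Polish, as needed for regular conditional distributions. -/
instance : TopologicalSpace.IsCompletelyMetrizableSpace X := by
  let : UniformSpace X := IsTopologicalAddGroup.rightUniformSpace X
  have : IsUniformAddGroup X := isUniformAddGroup_of_addCommGroup
  have : (uniformity X).IsCountablyGenerated := IsUniformAddGroup.uniformity_countably_generated
  have : CompleteSpace X := by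
    refine UniformSpace.complete_of_cauchySeq_tendsto fun x hx => ?_
    obtain ⟨a, ha⟩ := complete x (fun ε hε => by
      have hU : {y : X | qnorm y < ε} ∈ 𝓝 (0 : X) := by
        have := (nhds_hasBasis (0 : X)).mem_of_mem hε
        simpa using this
      have hV : {z : X × X | qnorm (z.2 - z.1) < ε} ∈ uniformity X := by
        rw [uniformity_eq_comap_nhds_zero]
        exact ⟨_, hU, fun z hz => hz⟩
      obtain ⟨N, hN⟩ := (cauchySeq_iff.1 hx) _ hV
      exact ⟨N, fun m hm n hn => hN n hn m hm⟩)
    exact ⟨a, tendsto_iff_qnorm_sub.2 ha⟩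
  infer_instance

theorem secondCountableTopology_of_separable [TopologicalSpace.SeparableSpace X] :
    SecondCountableTopology X := by
  let := TopologicalSpace.metrizableSpaceMetric X
  exact UniformSpace.secondCountable_of_separable X

theorem measurable_qnorm [MeasurableSpace X] [BorelSpace X] : Measurable (qnorm : X → ℝ) :=
  continuous_qnorm.measurable

end Topology

section Isometry

variable {X : Type u} [AddCommGroup X] [Module ℝ X] [QuasiNorm X] [QuasiBanachSpace X]
variable {Z : Type v} [AddCommGroup Z] [Module ℝ Z] [QuasiNorm Z] [QuasiBanachSpace Z]

theorem isInducing_of_qnorm_eq (J : X →+ Z) (hJ : ∀ x, qnorm (J x) = qnorm x) :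
    Topology.IsInducing J := by
  refine Topology.isInducing_iff_nhds.2 fun x => ?_
  refine (nhds_hasBasis x).eq_of_same_basis ?_
  convert (nhds_hasBasis (J x)).comap J using 3 with ε
  ext y
  simp [← map_sub, hJ]

end Isometry

end QuasiBanachSpace

/-! ### Random variables and transfer along isometries -/

section RandomVariable

variable {X : Type u} [AddCommGroup X] [Module ℝ X] [QuasiNorm X] [QuasiBanachSpace X]
variable {Ω : Type w}

theorem isRandomVariable_iff_stronglyMeasurable {m : MeasurableSpace Ω} {ξ : Ω → X} :
    IsRandomVariable m ξ ↔ StronglyMeasurable[m] ξ := by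
  borelize X
  exact stronglyMeasurable_iff_measurable_separable.symm

theorem IsDecoupledSum.isRandomVariable {mΩ : MeasurableSpace Ω} {P : Measure Ω}
    {F : Filtration ℕ mΩ} {f g : ℕ → Ω → X} (h : IsDecoupledSum P F f g) (h0 : g 0 = 0) (n : ℕ) :
    IsRandomVariable mΩ (g n) := by
  rw [isRandomVariable_iff_stronglyMeasurable]
  induction n with
  | zero => rw [h0]; exact stronglyMeasurable_const
  | succ n ih =>
    have h1 := isRandomVariable_iff_stronglyMeasurable.1 (h.randomVariable n)
    have h2 := ih.add h1
    convert h2 using 1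
    ext ω
    simp

variable {Z : Type v} [AddCommGroup Z] [Module ℝ Z] [QuasiNorm Z] [QuasiBanachSpace Z]

/-- The conditions on f and g concern only quasi-norms, sums, separability and preimages of Borel
sets, all of which are compatible with composition with `J`. -/
theorem DecouplingWith.of_isometry {p : ℝ} {D : ℝ≥0} (J : X →+ Z)
    (hJ : ∀ x, qnorm (J x) = qnorm x) (h : DecouplingWith.{v, w} Z p D) :
    DecouplingWith.{u, w} X p D := by
  intro Ω mΩ P hP hc F hF f g hf0 hg0 hf hfp hfg n
  have hJc : Continuous J := (QuasiBanachSpace.isInducing_of_qnorm_eq J hJ).continuous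
  have hJm : Measurable[borel X, borel Z] J := by borelize X; borelize Z; exact hJc.measurable
  have hrv : ∀ {m : MeasurableSpace Ω} {ξ : Ω → X}, IsRandomVariable m ξ →
      IsRandomVariable m (fun ω => J (ξ ω)) := by
    intro m ξ hξ
    rw [isRandomVariable_iff_stronglyMeasurable] at hξ ⊢
    exact hJc.comp_stronglyMeasurable hξ
  have hnorm : ∀ ξ : Ω → X, lpQNorm p P (fun ω => J (ξ ω)) = lpQNorm p P ξ := by
    intro ξ; simp [lpQNorm, hJ]
  have key := h Ω mΩ P hP hc F hF (fun n ω => J (f n ω)) (fun n ω => J (g n ω))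
    (by ext; simp [hf0]) (by ext; simp [hg0]) (fun n => hrv (hf n))
    (fun n => by rw [hnorm]; exact hfp n) ?_ n
  · simpa only [hnorm] using key
  · refine ⟨fun k => ?_, fun k B hB => ?_, fun m B hB => ?_⟩
    · simpa using hrv (hfg.randomVariable k)
    · have := hfg.tangent k (J ⁻¹' B) (hJm hB)
      simp only [← map_sub]
      exact this
    · have := hfg.condIndep m (fun k => J ⁻¹' B k) (fun k => hJm (hB k))
      simp only [← map_sub]
      exact this

end RandomVariable

/-! ### Reduction to closed separable subspaces -/

section Subspace

variable {X : Type u} [AddCommGroup X] [Module ℝ X] [QuasiNorm X]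

/-- A subspace of a quasi-Banach space, as a space with the restricted quasi-norm. -/
def QuasiSubspace (K : Submodule ℝ X) : Type u := ↥K

namespace QuasiSubspace

variable (K : Submodule ℝ X)

instance : AddCommGroup (QuasiSubspace K) := inferInstanceAs (AddCommGroup K)

instance : Module ℝ (QuasiSubspace K) := inferInstanceAs (Module ℝ K)

instance : QuasiNorm (QuasiSubspace K) where
  qnorm x := qnorm (x.1 : X)

/-- The inclusion of a subspace. -/
def incl : QuasiSubspace K →+ X := K.subtype.toAddMonoidHom

theorem qnorm_incl (x : QuasiSubspace K) : qnorm (incl K x) = qnorm x := rfl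

variable {K} [QuasiBanachSpace X]

theorem quasiBanachSpace (hK : IsClosed (K : Set X)) : QuasiBanachSpace (QuasiSubspace K) where
  qnorm_nonneg x := QuasiBanachSpace.qnorm_nonneg (incl K x)
  qnorm_eq_zero_iff x := by
    rw [← qnorm_incl, QuasiBanachSpace.qnorm_eq_zero_iff]
    exact Submodule.coe_eq_zero (p := K)
  qnorm_smul a x := QuasiBanachSpace.qnorm_smul a (incl K x)
  exists_qnorm_add_le := by
    obtain ⟨C, hC⟩ := QuasiBanachSpace.exists_qnorm_add_le (X := X)
    exact ⟨C, fun x y => hC (incl K x) (incl K y)⟩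
  complete x hx := by
    obtain ⟨a, ha⟩ := QuasiBanachSpace.complete (fun n => incl K (x n)) hx
    have haK : a ∈ K := hK.mem_of_tendsto (QuasiBanachSpace.tendsto_iff_qnorm_sub.2 ha)
      (Eventually.of_forall fun n => (x n).2)
    exact ⟨⟨a, haK⟩, ha⟩
  continuous_qnorm := by
    have h : Continuous (incl K) := by
      refine ⟨fun U hU x hx => ?_⟩
      obtain ⟨ε, hε, h⟩ := hU (incl K x) hx
      exact ⟨ε, hε, fun y hy => h _ (by rw [← map_sub]; exact hy)⟩
    exact (QuasiBanachSpace.continuous_qnorm (X := X)).comp h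

theorem separableSpace (hK : IsClosed (K : Set X))
    (hs : TopologicalSpace.IsSeparable (K : Set X)) :
    TopologicalSpace.SeparableSpace (QuasiSubspace K) := by
  have := quasiBanachSpace hK
  have hi := QuasiBanachSpace.isInducing_of_qnorm_eq (incl K) (qnorm_incl K)
  have h : TopologicalSpace.IsSeparable (Set.univ : Set (QuasiSubspace K)) := by
    refine hi.isSeparable_preimage (s := (K : Set X)) hs |>.mono ?_
    intro x _
    exact x.2
  exact TopologicalSpace.isSeparable_univ_iff.1 h

end QuasiSubspace

variable [QuasiBanachSpace X]

theorem QuasiBanachSpace.isSeparable_span {s : Set X} (hs : TopologicalSpace.IsSeparable s) :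
    TopologicalSpace.IsSeparable (Submodule.span ℝ s : Set X) := hs.span

/-- The countably many variables f n, g n have separable ranges, so all values lie in the closed
span of a separable set. The Borel sets of that span are the traces of Borel sets of the whole
space. The constant must not depend on the subspace. -/
theorem decouplingWith_of_separable_subspace {p : ℝ} {D : ℝ≥0}
    (h : ∀ K : Submodule ℝ X, IsClosed (K : Set X) → TopologicalSpace.IsSeparable (K : Set X) →
      DecouplingWith.{u, w} (QuasiSubspace K) p D) :
    DecouplingWith.{u, w} X p D := by
  intro Ω mΩ P hP hc F hF f g hf0 hg0 hf hfp hfg n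
  have hgrv := hfg.isRandomVariable hg0
  set R : Set X := (⋃ n, Set.range (f n)) ∪ ⋃ n, Set.range (g n) with hR
  have hRs : TopologicalSpace.IsSeparable R :=
    (TopologicalSpace.IsSeparable.iUnion fun n => (hf n).2).union
      (TopologicalSpace.IsSeparable.iUnion fun n => (hgrv n).2)
  set K : Submodule ℝ X := (Submodule.span ℝ R).topologicalClosure with hKdef
  have hKc : IsClosed (K : Set X) := Submodule.isClosed_topologicalClosure _
  have hKs : TopologicalSpace.IsSeparable (K : Set X) := by
    rw [hKdef, Submodule.topologicalClosure_coe]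
    exact (QuasiBanachSpace.isSeparable_span hRs).closure
  have hRK : R ⊆ K := Submodule.subset_span.trans (Submodule.le_topologicalClosure _)
  have hfK : ∀ n ω, f n ω ∈ K := fun n ω => hRK (Or.inl (Set.mem_iUnion.2 ⟨n, ω, rfl⟩))
  have hgK : ∀ n ω, g n ω ∈ K := fun n ω => hRK (Or.inr (Set.mem_iUnion.2 ⟨n, ω, rfl⟩))
  have := QuasiSubspace.quasiBanachSpace hKc
  have hi := QuasiBanachSpace.isInducing_of_qnorm_eq (QuasiSubspace.incl K)
    (QuasiSubspace.qnorm_incl K)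
  have hb : borel (QuasiSubspace K) = (borel X).comap (QuasiSubspace.incl K) := by
    rw [← borel_comap, ← hi.eq_induced]
  have hrv : ∀ {m : MeasurableSpace Ω} {ξ : Ω → QuasiSubspace K},
      IsRandomVariable m (fun ω => QuasiSubspace.incl K (ξ ω)) → IsRandomVariable m ξ := by
    rintro m ξ ⟨h1, h2⟩
    refine ⟨?_, ?_⟩
    · rw [hb]
      exact (@measurable_comap_iff _ _ _ m (borel X) _ _).2 h1
    · refine (hi.isSeparable_preimage h2).mono ?_
      rintro _ ⟨ω, rfl⟩
      exact ⟨ω, rfl⟩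
  have key := h K hKc hKs Ω mΩ P hP hc F hF (fun n ω => ⟨f n ω, hfK n ω⟩)
    (fun n ω => ⟨g n ω, hgK n ω⟩) (funext fun ω => by
      refine Subtype.val_injective (p := (· ∈ K)) ?_
      exact congrFun hf0 ω)
    (funext fun ω => by
      refine Subtype.val_injective (p := (· ∈ K)) ?_
      exact congrFun hg0 ω) (fun n => hrv (hf n)) hfp ?_ n
  · exact key
  · refine ⟨fun k => hrv (hfg.randomVariable k), fun k B hB => ?_, fun m B hB => ?_⟩
    · rw [hb] at hB
      obtain ⟨B', hB', rfl⟩ := hB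
      exact hfg.tangent k B' hB'
    · rw [hb] at hB
      choose B' hB' hBB' using hB
      obtain rfl : (fun k => QuasiSubspace.incl K ⁻¹' B' k) = B := funext hBB'
      exact hfg.condIndep m B' hB'

end Subspace

/-! ### From tail inequalities to moments -/

section Tail

/-- The good-`λ` principle: a tail inequality between `Z` and `W` integrates to an inequality
between the `p`-th moments. -/
theorem lintegral_rpow_le_of_tail {α β : Type*} [MeasurableSpace α] [MeasurableSpace β]
    {μ : Measure α} [IsFiniteMeasure μ] {ν : Measure β} {Z : α → ℝ} {W : β → ℝ≥0∞}
    (hZ0 : ∀ a, 0 ≤ Z a) (hZ : Measurable Z) (hW : Measurable W) {p b : ℝ} (hp : 0 < p)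
    (hb : 1 ≤ b) {ε K : ℝ≥0∞} (hε : ENNReal.ofReal (b ^ p) * ε ≤ 1 / 2) (hK : K ≠ 0)
    (h : ∀ t : ℝ, 0 < t → μ {a | b * t < Z a} ≤
      ε * μ {a | t < Z a} + K * ν {x | ENNReal.ofReal t < W x}) :
    ∫⁻ a, ENNReal.ofReal (Z a) ^ p ∂μ ≤
      2 * ENNReal.ofReal (b ^ p) * K * ∫⁻ x, W x ^ p ∂ν := by
  have hb0 : 0 < b := one_pos.trans_le hb
  have hbp : 0 < b ^ p := Real.rpow_pos_of_pos hb0 p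
  by_cases hWi : ∫⁻ x, W x ^ p ∂ν = ∞
  · rw [hWi, ENNReal.mul_top]
    · exact le_top
    · simp [hK, hbp]
  have hWfin : ∀ᵐ x ∂ν, W x < ∞ := by
    filter_upwards [ae_lt_top (hW.pow_const p) hWi] with x hx
    by_contra hcon
    rw [not_lt, top_le_iff] at hcon
    simp [hcon, ENNReal.top_rpow_of_pos hp] at hx
  set J := ∫⁻ x, W x ^ p ∂ν with hJ
  have hJ' : J = ENNReal.ofReal p *
      ∫⁻ t in Set.Ioi 0, ν {x | ENNReal.ofReal t < W x} * ENNReal.ofReal (t ^ (p - 1)) := by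
    have h1 := lintegral_rpow_eq_lintegral_meas_lt_mul ν (f := fun x => (W x).toReal)
      (Eventually.of_forall fun x => ENNReal.toReal_nonneg) hW.ennreal_toReal.aemeasurable hp
    have h2 : J = ∫⁻ x, ENNReal.ofReal ((W x).toReal ^ p) ∂ν := by
      refine lintegral_congr_ae ?_
      filter_upwards [hWfin] with x hx
      rw [← ENNReal.ofReal_rpow_of_nonneg ENNReal.toReal_nonneg hp.le, ENNReal.ofReal_toReal hx.ne]
    rw [h2, h1]
    congr 1
    refine setLIntegral_congr_fun measurableSet_Ioi fun t ht => ?_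
    congr 1
    refine measure_congr ?_
    filter_upwards [hWfin] with x hx
    exact propext (ENNReal.ofReal_lt_iff_lt_toReal (le_of_lt ht) hx.ne).symm
  -- Truncating `Z` at `M` makes its moment finite, so that it can be absorbed into the left side.
  have key : ∀ M : ℕ, ∫⁻ a, ENNReal.ofReal (min (Z a) M) ^ p ∂μ ≤
      2 * ENNReal.ofReal (b ^ p) * K * J := by
    intro M
    set ZM : α → ℝ := fun a => min (Z a) M with hZM
    have hZM0 : ∀ a, 0 ≤ ZM a := fun a => le_min (hZ0 a) (Nat.cast_nonneg M)
    have hZMm : Measurable ZM := hZ.min measurable_const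
    have hLC : ∀ c : ℝ, 0 < c → ENNReal.ofReal (c ^ p) * ∫⁻ a, ENNReal.ofReal (ZM a) ^ p ∂μ
        = ENNReal.ofReal p *
          ∫⁻ t in Set.Ioi 0, μ {a | t < c * ZM a} * ENNReal.ofReal (t ^ (p - 1)) := by
      intro c hc
      rw [← lintegral_rpow_eq_lintegral_meas_lt_mul μ
        (Eventually.of_forall fun a => mul_nonneg hc.le (hZM0 a))
        (hZMm.const_mul c).aemeasurable hp, ← lintegral_const_mul' _ _ ENNReal.ofReal_ne_top]
      refine lintegral_congr fun a => ?_
      rw [Real.mul_rpow hc.le (hZM0 a), ENNReal.ofReal_mul (by positivity),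
        ENNReal.ofReal_rpow_of_nonneg (hZM0 a) hp.le]
    set I := ∫⁻ a, ENNReal.ofReal (ZM a) ^ p ∂μ with hI
    have hIfin : I ≠ ∞ := by
      refine ne_of_lt (lt_of_le_of_lt (lintegral_mono (g := fun _ => ENNReal.ofReal M ^ p)
        fun a => ?_) ?_)
      · exact ENNReal.rpow_le_rpow (ENNReal.ofReal_le_ofReal (min_le_right _ _)) hp.le
      · rw [lintegral_const]
        exact ENNReal.mul_lt_top (ENNReal.rpow_lt_top_of_nonneg hp.le ENNReal.ofReal_ne_top)
          (measure_lt_top _ _)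
    have h1 := hLC b⁻¹ (inv_pos.2 hb0)
    have h2 := hLC 1 one_pos
    simp only [Real.one_rpow, ENNReal.ofReal_one, one_mul] at h2
    have hm1 : Measurable fun t : ℝ => μ {a | t < ZM a} * ENNReal.ofReal (t ^ (p - 1)) := by
      refine Measurable.mul (Antitone.measurable fun s t hst => ?_) (by fun_prop)
      exact measure_mono fun a ha => lt_of_le_of_lt hst ha
    have hle : ∀ t ∈ Set.Ioi (0 : ℝ), μ {a | t < b⁻¹ * ZM a} * ENNReal.ofReal (t ^ (p - 1)) ≤
        ε * (μ {a | t < ZM a} * ENNReal.ofReal (t ^ (p - 1))) +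
        K * (ν {x | ENNReal.ofReal t < W x} * ENNReal.ofReal (t ^ (p - 1))) := by
      intro t ht
      rw [← mul_assoc, ← mul_assoc, ← add_mul]
      gcongr
      have hset : {a | t < b⁻¹ * ZM a} = {a | b * t < ZM a} := by
        ext a
        simp only [Set.mem_ofPred_eq]
        rw [lt_inv_mul_iff₀ hb0]
      rw [hset]
      -- The tail inequality survives truncation: below `M` the truncation is invisible to both
      -- tails of `Z`, above it the left tail is empty.
      by_cases hM : b * t < M
      · have e1 : {a | b * t < ZM a} = {a | b * t < Z a} := by
          ext a; simp [hZM, hM]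
        have e2 : {a | t < ZM a} = {a | t < Z a} := by
          have : t < M := lt_of_le_of_lt (le_mul_of_one_le_left (le_of_lt ht) hb) hM
          ext a; simp [hZM, this]
        rw [e1, e2]
        exact h t ht
      · have e1 : {a | b * t < ZM a} = ∅ := by
          ext a; simp [hZM, hM]
        simp [e1]
    have hint : ENNReal.ofReal (b⁻¹ ^ p) * I ≤ ε * I + K * J := by
      rw [h1, h2, hJ']
      calc ENNReal.ofReal p *
            ∫⁻ t in Set.Ioi 0, μ {a | t < b⁻¹ * ZM a} * ENNReal.ofReal (t ^ (p - 1))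
          ≤ ENNReal.ofReal p * ∫⁻ t in Set.Ioi 0,
              (ε * (μ {a | t < ZM a} * ENNReal.ofReal (t ^ (p - 1))) +
              K * (ν {x | ENNReal.ofReal t < W x} * ENNReal.ofReal (t ^ (p - 1)))) := by
            exact mul_le_mul' le_rfl
              (setLIntegral_mono_ae' measurableSet_Ioi (Eventually.of_forall hle))
        _ = _ := by
            have hm2 : Measurable fun t : ℝ =>
                ν {x | ENNReal.ofReal t < W x} * ENNReal.ofReal (t ^ (p - 1)) := by
              refine Measurable.mul (Antitone.measurable fun s t hst => ?_) (by fun_prop)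
              exact measure_mono fun a ha => lt_of_le_of_lt (ENNReal.ofReal_le_ofReal hst) ha
            rw [lintegral_add_left (hm1.const_mul ε), lintegral_const_mul _ hm1,
              lintegral_const_mul _ hm2]
            ring
    have hbinv : ENNReal.ofReal (b ^ p) * ENNReal.ofReal (b⁻¹ ^ p) = 1 := by
      rw [← ENNReal.ofReal_mul hbp.le, Real.inv_rpow hb0.le, mul_inv_cancel₀ hbp.ne',
        ENNReal.ofReal_one]
    -- Scaling by `b ^ p` turns the coefficient of `I` into `b ^ p * ε`, at most one half by
    -- assumption.
    have h3 : I ≤ 1 / 2 * I + ENNReal.ofReal (b ^ p) * K * J := by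
      calc I = ENNReal.ofReal (b ^ p) * (ENNReal.ofReal (b⁻¹ ^ p) * I) := by
            rw [← mul_assoc, hbinv, one_mul]
        _ ≤ ENNReal.ofReal (b ^ p) * (ε * I + K * J) := by gcongr
        _ = (ENNReal.ofReal (b ^ p) * ε) * I + ENNReal.ofReal (b ^ p) * K * J := by ring
        _ ≤ _ := by gcongr
    have h4 : 1 / 2 * I ≤ ENNReal.ofReal (b ^ p) * K * J := by
      have hI2 : I = 1 / 2 * I + 1 / 2 * I := by
        rw [← add_mul, ENNReal.add_halves, one_mul]
      have hfin : 1 / 2 * I ≠ ∞ := ENNReal.mul_ne_top (by simp) hIfin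
      rw [hI2] at h3
      have h5 : 1 / 2 * I + 1 / 2 * I ≤ 1 / 2 * I + ENNReal.ofReal (b ^ p) * K * J := by
        rwa [← hI2] at h3 ⊢
      exact (ENNReal.add_le_add_iff_left hfin).1 h5
    calc I = 2 * (1 / 2 * I) := by
          rw [← mul_assoc, one_div, ENNReal.mul_inv_cancel (by simp) (by simp), one_mul]
      _ ≤ 2 * (ENNReal.ofReal (b ^ p) * K * J) := by gcongr
      _ = _ := by ring
  have hlim : ∫⁻ a, ENNReal.ofReal (Z a) ^ p ∂μ =
      ⨆ M : ℕ, ∫⁻ a, ENNReal.ofReal (min (Z a) M) ^ p ∂μ := by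
    rw [← lintegral_iSup]
    · refine lintegral_congr fun a => le_antisymm ?_ (iSup_le fun M => ?_)
      · obtain ⟨M, hM⟩ := exists_nat_ge (Z a)
        refine le_iSup_of_le M ?_
        rw [min_eq_left hM]
      · exact ENNReal.rpow_le_rpow (ENNReal.ofReal_le_ofReal (min_le_left _ _)) hp.le
    · intro M
      exact (ENNReal.measurable_ofReal.comp (hZ.min measurable_const)).pow_const p
    · intro M N hMN a
      refine ENNReal.rpow_le_rpow (ENNReal.ofReal_le_ofReal (min_le_min_left _ ?_)) hp.le
      exact_mod_cast hMN
  rw [hlim]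
  exact iSup_le key

theorem lintegral_rpow_le_of_tail_le {α β : Type*} [MeasurableSpace α] [MeasurableSpace β]
    {μ : Measure α} [IsFiniteMeasure μ] {ν : Measure β} {Z : α → ℝ} {W : β → ℝ}
    (hZ0 : ∀ a, 0 ≤ Z a) (hZ : Measurable Z) (hW : Measurable W) {p b : ℝ} (hp : 0 < p)
    (hb : 1 ≤ b) {K : ℝ≥0∞} (hK : K ≠ 0)
    (h : ∀ t : ℝ, 0 < t → μ {a | b * t < Z a} ≤ K * ν {x | t < W x}) :
    ∫⁻ a, ENNReal.ofReal (Z a) ^ p ∂μ ≤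
      2 * ENNReal.ofReal (b ^ p) * K * ∫⁻ x, ENNReal.ofReal (W x) ^ p ∂ν := by
  refine lintegral_rpow_le_of_tail hZ0 hZ hW.ennreal_ofReal hp hb (ε := 0) (by simp) hK
    fun t ht => ?_
  simpa [ENNReal.ofReal_lt_ofReal_iff_of_nonneg ht.le] using h t ht

end Tail

/-! ### Independent noise and transformations preserving its law -/

section Noise

variable {E : Type*} [MeasurableSpace E] (ν : Measure E)

/-- The law of a sequence of independent random elements with law `ν`. -/
noncomputable abbrev noiseMeasure : Measure (ℕ → E) := Measure.infinitePi fun _ => ν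

variable [IsProbabilityMeasure ν]

/-- Finite boxes factor into the conditions on the coordinates in `A` and those outside. This is how
independence of past and future coordinates is used. -/
theorem measurePreserving_splice (A : Set ℕ) [DecidablePred (· ∈ A)] :
    MeasurePreserving (fun z : (ℕ → E) × (ℕ → E) => fun i => if i ∈ A then z.1 i else z.2 i)
      ((noiseMeasure ν).prod (noiseMeasure ν)) (noiseMeasure ν) := by
  have hm : Measurable (fun z : (ℕ → E) × (ℕ → E) => fun i => if i ∈ A then z.1 i else z.2 i) := by
    refine measurable_pi_lambda _ fun i => ?_
    split_ifs <;> fun_prop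
  refine ⟨hm, Measure.eq_infinitePi _ fun s t ht => ?_⟩
  rw [Measure.map_apply hm (.pi s.countable_toSet fun _ _ => ht _)]
  have hset : (fun z : (ℕ → E) × (ℕ → E) => fun i => if i ∈ A then z.1 i else z.2 i) ⁻¹'
      ((s : Set ℕ).pi t) = ((↑(s.filter (· ∈ A)) : Set ℕ).pi t) ×ˢ
        ((↑(s.filter (· ∉ A)) : Set ℕ).pi t) := by
    ext z
    simp only [Set.mem_preimage, Set.mem_pi, Set.mem_prod, Finset.coe_filter, SetLike.mem_coe]
    constructor
    · intro h
      exact ⟨fun i hi => by simpa [hi.2] using h i hi.1, fun i hi => by simpa [hi.2] using h i hi.1⟩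
    · rintro ⟨h1, h2⟩ i hi
      by_cases hA : i ∈ A
      · simpa [hA] using h1 i ⟨hi, hA⟩
      · simpa [hA] using h2 i ⟨hi, hA⟩
  rw [hset, Measure.prod_prod, Measure.infinitePi_pi _ (fun i _ => ht i),
    Measure.infinitePi_pi _ (fun i _ => ht i), Finset.prod_filter_mul_prod_filter_not]

theorem measurePreserving_update (k : ℕ) :
    MeasurePreserving (fun z : (ℕ → E) × E => Function.update z.1 k z.2)
      ((noiseMeasure ν).prod ν) (noiseMeasure ν) := by
  have h1 : MeasurePreserving (Prod.map id (Function.eval k) : (ℕ → E) × (ℕ → E) → _)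
      ((noiseMeasure ν).prod (noiseMeasure ν)) ((noiseMeasure ν).prod ν) :=
    (MeasurePreserving.id _).prod (measurePreserving_eval_infinitePi _ k)
  have hm : Measurable (fun z : (ℕ → E) × E => Function.update z.1 k z.2) := by
    refine measurable_pi_lambda _ fun i => ?_
    by_cases h : i = k
    · subst h; simpa using measurable_snd
    · simp only [Function.update_of_ne h]; fun_prop
  refine ⟨hm, ?_⟩
  rw [← h1.map_eq, Measure.map_map hm h1.measurable]
  convert (measurePreserving_splice ν {i | i ≠ k}).map_eq using 2
  ext z i
  by_cases h : i = k
  · subst h; simp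
  · simp [h]

theorem measurePreserving_map_coord {σ : ℕ → E → E} (hσ : ∀ k, MeasurePreserving (σ k) ν ν) :
    MeasurePreserving (fun (v : ℕ → E) k => σ k (v k)) (noiseMeasure ν) (noiseMeasure ν) := by
  refine ⟨measurable_pi_lambda _ fun k => (hσ k).measurable.comp (measurable_pi_apply k), ?_⟩
  rw [Measure.infinitePi_map_pi _ fun k => (hσ k).measurable]
  simp only [(hσ _).map_eq]

variable {ν} in
-- An invariant set and its complement are mapped into themselves, so the law may be checked on each
-- separately. It allows a reflection to act only on the terms outside a mask.
theorem measurePreserving_ite_of_invariant {ι : E → E} (hι : MeasurePreserving ι ν ν) {m : Set E}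
    [DecidablePred (· ∈ m)] (hm : MeasurableSet m) (hinv : ∀ e, ι e ∈ m ↔ e ∈ m) :
    MeasurePreserving (fun e => if e ∈ m then e else ι e) ν ν := by
  have hmeas : Measurable (fun e => if e ∈ m then e else ι e) :=
    Measurable.ite hm measurable_id hι.measurable
  refine ⟨hmeas, ?_⟩
  ext B hB
  rw [Measure.map_apply hmeas hB, ← measure_inter_add_sdiff _ hm, ← measure_inter_add_sdiff B hm]
  congr 1
  · congr 1
    ext e
    simp only [Set.mem_inter_iff, Set.mem_preimage]
    constructor <;> rintro ⟨h1, h2⟩ <;> simp_all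
  · rw [← hι.measure_preimage (hB.diff hm).nullMeasurableSet]
    congr 1
    ext e
    simp only [Set.mem_sdiff, Set.mem_preimage, hinv]
    constructor <;> rintro ⟨h1, h2⟩ <;> simp_all

end Noise

/-! ### Lévy and Hoffmann-Jørgensen inequalities for sums of symmetric terms -/

section Levy

variable {X : Type u} [AddCommGroup X] [Module ℝ X] [QuasiNorm X] [QuasiBanachSpace X]
variable {C : ℝ}

/-- The reflection principle: `R` is the average of `S` and its reflection, so if both have
quasi-norm at most t, then `R` has quasi-norm at most C t. The two events for `S` and `S ∘ Φ` inside
`B` have equal measure. -/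
theorem measure_lt_qnorm_le_of_reflection {α : Type*} [MeasurableSpace α] {μ : Measure α}
    {Φ : α → α} (hC : ∀ x y : X, qnorm (x + y) ≤ C * (qnorm x + qnorm y)) (hC1 : 1 ≤ C)
    (hΦ : MeasurePreserving Φ μ μ) {S R : α → X}
    (hS : Measurable fun a => qnorm (S a)) {B : Set α} (hB : MeasurableSet B)
    (hBΦ : ∀ a, Φ a ∈ B ↔ a ∈ B) (hR : ∀ a, (2 : ℝ) • R a = S a + S (Φ a)) (t : ℝ) :
    μ {a | a ∈ B ∧ C * t < qnorm (R a)} ≤ 2 * μ {a | a ∈ B ∧ t < qnorm (S a)} := by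
  have hm : MeasurableSet {a | a ∈ B ∧ t < qnorm (S a)} :=
    hB.inter (measurableSet_lt measurable_const hS)
  have hsub : {a | a ∈ B ∧ C * t < qnorm (R a)} ⊆
      {a | a ∈ B ∧ t < qnorm (S a)} ∪ Φ ⁻¹' {a | a ∈ B ∧ t < qnorm (S a)} := by
    rintro a ⟨ha, hlt⟩
    by_contra hcon
    simp only [Set.mem_union, Set.mem_preimage, Set.mem_ofPred_eq, not_or, not_and, not_lt,
      hBΦ] at hcon
    have h1 := hC (S a) (S (Φ a))
    rw [← hR, QuasiBanachSpace.qnorm_smul] at h1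
    norm_num at h1
    nlinarith [hcon.1 ha, hcon.2 ha]
  calc _ ≤ _ := measure_mono hsub
    _ ≤ _ := measure_union_le _ _
    _ = _ := by rw [hΦ.measure_preimage hm.nullMeasurableSet, two_mul]

variable [MeasurableSpace X] [BorelSpace X] [SecondCountableTopology X]
variable {E : Type*} [MeasurableSpace E] {ν : Measure E} [IsProbabilityMeasure ν]

/-- The partial sums of the independent random variables `x k (v k)`. -/
def noiseSum (x : ℕ → E → X) (n : ℕ) (v : ℕ → E) : X := ∑ k ∈ Finset.range n, x k (v k)

theorem measurable_noiseSum {x : ℕ → E → X} (hx : ∀ k, Measurable (x k)) (n : ℕ) :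
    Measurable (noiseSum x n) := by
  unfold noiseSum
  exact Finset.measurable_fun_sum _ fun k _ => (hx k).comp (measurable_pi_apply k)

theorem measurable_qnorm_noiseSum {x : ℕ → E → X} (hx : ∀ k, Measurable (x k)) (n : ℕ) :
    Measurable fun v => qnorm (noiseSum x n v) :=
  QuasiBanachSpace.measurable_qnorm.comp (measurable_noiseSum hx n)

/-- A family of functions is odd with respect to a measure preserving transformation. -/
structure IsOddFamily (ν : Measure E) (ι : E → E) (x : ℕ → E → X) : Prop where
  preserving : MeasurePreserving ι ν ν
  measurable : ∀ k, Measurable (x k)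
  odd : ∀ k e, x k (ι e) = -x k e

variable {ι : E → E} {x : ℕ → E → X}

/-- A contraction principle: reflecting exactly the terms outside the mask preserves the law, and
the average of the original and the reflected sum is the masked sum. -/
theorem measure_lt_qnorm_mask_le (hC : ∀ x y : X, qnorm (x + y) ≤ C * (qnorm x + qnorm y))
    (hC1 : 1 ≤ C) (hx : IsOddFamily ν ι x) {m : ℕ → Set E} (hm : ∀ k, MeasurableSet (m k))
    (hinv : ∀ k e, ι e ∈ m k ↔ e ∈ m k) (n : ℕ) (t : ℝ) :
    noiseMeasure ν {v | C * t < qnorm (noiseSum (fun k => (m k).indicator (x k)) n v)} ≤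
      2 * noiseMeasure ν {v | t < qnorm (noiseSum x n v)} := by
  classical
  have hΦ := measurePreserving_map_coord ν (σ := fun k e => if e ∈ m k then e else ι e)
    fun k => measurePreserving_ite_of_invariant hx.preserving (hm k) (hinv k)
  have := measure_lt_qnorm_le_of_reflection hC hC1 hΦ (S := noiseSum x n)
    (R := noiseSum (fun k => (m k).indicator (x k)) n)
    (measurable_qnorm_noiseSum hx.measurable n) MeasurableSet.univ (by simp) ?_ t
  · simpa using this
  · intro v
    simp only [noiseSum, Finset.smul_sum, ← Finset.sum_add_distrib]
    refine Finset.sum_congr rfl fun k _ => ?_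
    by_cases h : v k ∈ m k
    · simp [h, two_smul]
    · simp [h, hx.odd]

/-- The partial sums exceed the level `t` for the first time at `j + 1`. -/
def firstPassage (x : ℕ → E → X) (t : ℝ) (j : ℕ) : Set (ℕ → E) :=
  {v | (∀ i ≤ j, qnorm (noiseSum x i v) ≤ t) ∧ t < qnorm (noiseSum x (j + 1) v)}

theorem measurableSet_firstPassage (hx : ∀ k, Measurable (x k)) (t : ℝ) (j : ℕ) :
    MeasurableSet (firstPassage x t j) := by
  have h : firstPassage x t j = (⋂ i ∈ Set.Iic j, {v | qnorm (noiseSum x i v) ≤ t}) ∩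
      {v | t < qnorm (noiseSum x (j + 1) v)} := by
    ext v; simp [firstPassage]
  rw [h]
  exact (MeasurableSet.biInter (Set.to_countable _) fun i _ =>
    measurableSet_le (measurable_qnorm_noiseSum hx i) measurable_const).inter
    (measurableSet_lt measurable_const (measurable_qnorm_noiseSum hx _))

theorem noiseSum_congr {n : ℕ} {v v' : ℕ → E} (h : ∀ k < n, v k = v' k) :
    noiseSum x n v = noiseSum x n v' :=
  Finset.sum_congr rfl fun k hk => by rw [h k (Finset.mem_range.1 hk)]

theorem mem_firstPassage_congr {t : ℝ} {j : ℕ} {v v' : ℕ → E} (h : ∀ k ≤ j, v k = v' k) :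
    v ∈ firstPassage x t j ↔ v' ∈ firstPassage x t j := by
  have h1 : ∀ i ≤ j + 1, noiseSum x i v = noiseSum x i v' :=
    fun i hi => noiseSum_congr fun k hk => h k (by omega)
  simp only [firstPassage, Set.mem_ofPred_eq, h1 (j + 1) le_rfl]
  refine and_congr_left fun _ => forall₂_congr fun i hi => ?_
  rw [h1 i (by omega)]

theorem exists_mem_firstPassage {t : ℝ} (ht : 0 ≤ t) {n i : ℕ} (hi : i ≤ n) {v : ℕ → E}
    (h : t < qnorm (noiseSum x i v)) : ∃ j < n, v ∈ firstPassage x t j := by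
  classical
  have hex : ∃ i, t < qnorm (noiseSum x i v) := ⟨i, h⟩
  obtain ⟨j, hj⟩ : ∃ j, Nat.find hex = j + 1 := by
    refine Nat.exists_eq_succ_of_ne_zero fun h0 => ?_
    have := Nat.find_spec hex
    rw [h0] at this
    simp only [noiseSum, Finset.range_zero, Finset.sum_empty, QuasiBanachSpace.qnorm_zero] at this
    linarith
  refine ⟨j, ?_, fun i hi => ?_, ?_⟩
  · have := Nat.find_min' hex h
    omega
  · exact not_lt.1 (Nat.find_min hex (by omega))
  · rw [← hj]; exact Nat.find_spec hex

theorem pairwise_disjoint_firstPassage (t : ℝ) :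
    Pairwise (Function.onFun Disjoint (firstPassage x t)) := by
  refine (pairwise_disjoint_on _).2 fun i j hij => Set.disjoint_left.2 fun v hi hj => ?_
  exact absurd (hj.1 (i + 1) hij) (not_le.2 hi.2)

/-- Reflecting the terms after j fixes the event of first passage at j + 1, and the average of the
full sum and its reflection is the partial sum at passage. So the passage event costs at most twice
its part where the full sum exceeds t, and these parts are disjoint for different j. -/
theorem sum_measure_firstPassage_le (hC : ∀ x y : X, qnorm (x + y) ≤ C * (qnorm x + qnorm y))
    (hC1 : 1 ≤ C) (hx : IsOddFamily ν ι x) (n : ℕ) (t : ℝ) :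
    ∑ j ∈ Finset.range n, noiseMeasure ν (firstPassage x (C * t) j) ≤
      2 * noiseMeasure ν {v | t < qnorm (noiseSum x n v)} := by
  classical
  have hstep : ∀ j ∈ Finset.range n, noiseMeasure ν (firstPassage x (C * t) j) ≤
      2 * noiseMeasure ν (firstPassage x (C * t) j ∩ {v | t < qnorm (noiseSum x n v)}) := by
    intro j hj
    have hj' : j < n := Finset.mem_range.1 hj
    have hΦ := measurePreserving_map_coord ν (σ := fun k e => if k ≤ j then e else ι e) fun k => by
      by_cases hk : k ≤ j
      · simp only [hk, if_true]; exact MeasurePreserving.id ν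
      · simp only [hk, if_false]; exact hx.preserving
    have key := measure_lt_qnorm_le_of_reflection hC hC1 hΦ (S := noiseSum x n)
      (R := noiseSum x (j + 1)) (measurable_qnorm_noiseSum hx.measurable n)
      (measurableSet_firstPassage hx.measurable (C * t) j) (fun v => ?_) ?_ t
    · refine le_trans (measure_mono ?_) key
      exact fun v hv => ⟨hv, hv.2⟩
    · exact mem_firstPassage_congr fun k hk => by simp [hk]
    · intro v
      simp only [noiseSum, Finset.smul_sum, ← Finset.sum_add_distrib]
      rw [← Finset.sum_subset (Finset.range_subset_range.2 hj')]
      · refine Finset.sum_congr rfl fun k hk => ?_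
        have : k ≤ j := by have := Finset.mem_range.1 hk; omega
        simp [this, two_smul]
      · intro k _ hk
        have : ¬ k ≤ j := by rw [Finset.mem_range] at hk; omega
        simp [this, hx.odd]
  calc _ ≤ ∑ j ∈ Finset.range n, 2 * noiseMeasure ν
          (firstPassage x (C * t) j ∩ {v | t < qnorm (noiseSum x n v)}) :=
        Finset.sum_le_sum hstep
    _ = 2 * noiseMeasure ν (⋃ j ∈ Finset.range n,
          (firstPassage x (C * t) j ∩ {v | t < qnorm (noiseSum x n v)})) := by
        rw [← Finset.mul_sum, measure_biUnion_finset]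
        · intro i _ j _ hij
          exact (pairwise_disjoint_firstPassage _ hij).mono Set.inter_subset_left
            Set.inter_subset_left
        · intro j _
          exact (measurableSet_firstPassage hx.measurable _ j).inter
            (measurableSet_lt measurable_const (measurable_qnorm_noiseSum hx.measurable n))
    _ ≤ _ := by
        gcongr
        exact Set.iUnion₂_subset fun j _ => Set.inter_subset_right

/-- Lévy's maximal inequality. -/
theorem measure_exists_lt_qnorm_noiseSum_le
    (hC : ∀ x y : X, qnorm (x + y) ≤ C * (qnorm x + qnorm y))
    (hC1 : 1 ≤ C) (hx : IsOddFamily ν ι x) (n : ℕ) {t : ℝ} (ht : 0 ≤ t) :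
    noiseMeasure ν {v | ∃ i ≤ n, C * t < qnorm (noiseSum x i v)} ≤
      2 * noiseMeasure ν {v | t < qnorm (noiseSum x n v)} := by
  refine le_trans ?_ (sum_measure_firstPassage_le hC hC1 hx n t)
  refine le_trans (measure_mono ?_) (measure_biUnion_finset_le _ _)
  rintro v ⟨i, hi, h⟩
  obtain ⟨j, hj, hv⟩ := exists_mem_firstPassage (by positivity) hi h
  exact Set.mem_iUnion₂.2 ⟨j, Finset.mem_range.2 hj, hv⟩

/-- Independence: the passage event depends only on the coordinates up to j, and the sum of the `y
k` only on later ones. -/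
theorem measure_firstPassage_inter (hx : ∀ k, Measurable (x k)) (t : ℝ) {j : ℕ}
    {y : ℕ → E → X} (hy : ∀ k, Measurable (y k)) (hy0 : ∀ k ≤ j, y k = 0) (n : ℕ) (s : ℝ) :
    noiseMeasure ν (firstPassage x t j ∩ {v | s < qnorm (noiseSum y n v)}) =
      noiseMeasure ν (firstPassage x t j) * noiseMeasure ν {v | s < qnorm (noiseSum y n v)} := by
  classical
  have hm1 := measurableSet_firstPassage hx t j
  have hm2 : MeasurableSet {v | s < qnorm (noiseSum y n v)} :=
    measurableSet_lt measurable_const (measurable_qnorm_noiseSum hy n)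
  rw [← (measurePreserving_splice ν (Set.Iic j)).measure_preimage
    (hm1.inter hm2).nullMeasurableSet, ← Measure.prod_prod]
  congr 1
  ext ⟨v, v'⟩
  simp only [Set.mem_preimage, Set.mem_inter_iff, Set.mem_prod]
  refine and_congr (mem_firstPassage_congr fun k hk => by simp [hk]) ?_
  have : noiseSum y n (fun i => if i ∈ Set.Iic j then v i else v' i) = noiseSum y n v' := by
    refine Finset.sum_congr rfl fun k _ => ?_
    by_cases hk : k ≤ j
    · simp [hy0 k hk]
    · simp [hk]
  simp only [Set.mem_ofPred_eq]
  rw [this]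

/-- At the first passage above C s the path has size at most C (C s + C s), since its terms are
bounded. If the remainder were at most C s, the total would be at most C (2 C² s + C s), the level
on the left. Hence the remainder exceeds C s; it is independent of the passage, and each of the two
factors costs 2. -/
theorem measure_lt_qnorm_noiseSum_le_sq
    (hC : ∀ x y : X, qnorm (x + y) ≤ C * (qnorm x + qnorm y)) (hC1 : 1 ≤ C)
    (hx : IsOddFamily ν ι x) {s : ℝ} (hs : 0 ≤ s) (hb : ∀ k e, qnorm (x k e) ≤ C * s) (n : ℕ) :
    noiseMeasure ν {v | C * (2 * C + 1) * C * s < qnorm (noiseSum x n v)} ≤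
      4 * noiseMeasure ν {v | s < qnorm (noiseSum x n v)} *
        noiseMeasure ν {v | s < qnorm (noiseSum x n v)} := by
  classical
  have hC0 : 0 ≤ C := zero_le_one.trans hC1
  set m : ℕ → ℕ → Set E := fun j k => if k ≤ j then ∅ else Set.univ with hm
  set y : ℕ → ℕ → E → X := fun j k => (m j k).indicator (x k) with hy
  have hmm : ∀ j k, MeasurableSet (m j k) := by
    intro j k; by_cases h : k ≤ j <;> simp [hm, h]
  have hsplit : ∀ j < n, ∀ v, noiseSum x n v = noiseSum x (j + 1) v + noiseSum (y j) n v := by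
    intro j hj v
    have h1 : noiseSum x (j + 1) v =
        ∑ k ∈ Finset.range n, if k ≤ j then x k (v k) else 0 := by
      rw [noiseSum, ← Finset.sum_subset (Finset.range_subset_range.2 hj)]
      · refine Finset.sum_congr rfl fun k hk => ?_
        rw [if_pos]; have := Finset.mem_range.1 hk; omega
      · intro k _ hk
        rw [if_neg]; rw [Finset.mem_range] at hk; omega
    rw [h1, noiseSum, noiseSum, ← Finset.sum_add_distrib]
    refine Finset.sum_congr rfl fun k _ => ?_
    by_cases hk : k ≤ j <;> simp [hy, hm, hk]
  have hsub : {v | C * (2 * C + 1) * C * s < qnorm (noiseSum x n v)} ⊆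
      ⋃ j ∈ Finset.range n, (firstPassage x (C * s) j ∩
        {v | C * s < qnorm (noiseSum (y j) n v)}) := by
    intro v hv
    have hv' : C * (2 * C + 1) * C * s < qnorm (noiseSum x n v) := hv
    have hCs : 0 ≤ C * s := by positivity
    have h1 : C * s < qnorm (noiseSum x n v) := by
      refine lt_of_le_of_lt ?_ hv'
      have h2 : 1 ≤ C * (2 * C + 1) := by nlinarith
      nlinarith
    obtain ⟨j, hj, hjv⟩ := exists_mem_firstPassage hCs le_rfl h1
    refine Set.mem_iUnion₂.2 ⟨j, Finset.mem_range.2 hj, hjv, ?_⟩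
    by_contra hcon
    rw [Set.mem_ofPred_eq, not_lt] at hcon
    have h3 : qnorm (noiseSum x (j + 1) v) ≤ C * (C * s + C * s) := by
      have : noiseSum x (j + 1) v = noiseSum x j v + x j (v j) := Finset.sum_range_succ _ _
      rw [this]
      exact (hC _ _).trans (mul_le_mul_of_nonneg_left (add_le_add (hjv.1 j le_rfl) (hb _ _)) hC0)
    have h4 := hC (noiseSum x (j + 1) v) (noiseSum (y j) n v)
    rw [← hsplit j hj] at h4
    have h5 : C * (qnorm (noiseSum x (j + 1) v) + qnorm (noiseSum (y j) n v)) ≤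
        C * (C * (C * s + C * s) + C * s) := by gcongr
    nlinarith
  set φ := noiseMeasure ν {v | s < qnorm (noiseSum x n v)} with hφ
  calc _ ≤ _ := measure_mono hsub
    _ ≤ _ := measure_biUnion_finset_le _ _
    _ ≤ ∑ j ∈ Finset.range n, noiseMeasure ν (firstPassage x (C * s) j) * (2 * φ) := by
        refine Finset.sum_le_sum fun j _ => ?_
        rw [measure_firstPassage_inter hx.measurable (C * s)
          (fun k => (hx.measurable k).indicator (hmm j k)) (fun k hk => by ext e; simp [hm, hk])]
        gcongr
        exact measure_lt_qnorm_mask_le hC hC1 hx (hmm j) (fun k e => by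
          by_cases h : k ≤ j <;> simp [hm, h]) n s
    _ ≤ 2 * φ * (2 * φ) := by
        rw [← Finset.sum_mul]
        gcongr
        exact sum_measure_firstPassage_le hC hC1 hx n s
    _ = _ := by ring

/-- A Hoffmann-Jørgensen inequality: moments of sums of bounded independent symmetric random
variables are controlled by a quantile. -/
theorem lintegral_qnorm_noiseSum_rpow_le
    (hC : ∀ x y : X, qnorm (x + y) ≤ C * (qnorm x + qnorm y)) (hC1 : 1 ≤ C)
    (hx : IsOddFamily ν ι x) {t : ℝ} (hb : ∀ k e, qnorm (x k e) ≤ C * t) {n : ℕ}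
    {p : ℝ} (hp : 0 < p) {θ : ℝ≥0∞}
    (hθ : ENNReal.ofReal ((C * (2 * C + 1) * C) ^ p) * (4 * θ) ≤ 1 / 2)
    (hq : noiseMeasure ν {v | t < qnorm (noiseSum x n v)} ≤ θ) :
    ∫⁻ v, ENNReal.ofReal (qnorm (noiseSum x n v)) ^ p ∂noiseMeasure ν ≤
      2 * ENNReal.ofReal ((C * (2 * C + 1) * C) ^ p) * ENNReal.ofReal t ^ p := by
  have hA : 1 ≤ C * (2 * C + 1) * C := by
    have h2 : 1 ≤ C * (2 * C + 1) := by nlinarith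
    nlinarith
  -- The comparison variable is the constant t: it makes the tail inequality trivial below t, while
  -- above t the quantile hypothesis bounds one factor of the squared tail by θ.
  have key := lintegral_rpow_le_of_tail (μ := noiseMeasure ν) (ν := noiseMeasure ν)
    (Z := fun v => qnorm (noiseSum x n v)) (W := fun _ => ENNReal.ofReal t) (p := p)
    (fun v => QuasiBanachSpace.qnorm_nonneg _) (measurable_qnorm_noiseSum hx.measurable n)
    measurable_const hp hA hθ one_ne_zero ?_
  · simpa using key
  · intro s hs
    by_cases hst : s < t
    · have : {v : ℕ → E | ENNReal.ofReal s < ENNReal.ofReal t} = Set.univ := by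
        ext v; simp [ENNReal.ofReal_lt_ofReal_iff_of_nonneg hs.le, hst]
      rw [this, measure_univ, one_mul]
      exact le_add_left prob_le_one
    · rw [not_lt] at hst
      refine le_trans (measure_lt_qnorm_noiseSum_le_sq hC hC1 hx hs.le (fun k e =>
        (hb k e).trans (mul_le_mul_of_nonneg_left hst (zero_le_one.trans hC1))) n) ?_
      refine le_trans ?_ le_self_add
      gcongr
      exact (measure_mono fun v hv => lt_of_le_of_lt hst hv).trans hq

end Levy

/-! ### Representation of tangent sequences by independent noise -/

theorem condProb_ae_eq {Ω : Type*} {𝓖 mΩ : MeasurableSpace Ω} {P : Measure Ω} [IsFiniteMeasure P]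
    (h𝓖 : 𝓖 ≤ mΩ) {A : Set Ω} (hA : MeasurableSet A) {q : Ω → ℝ≥0∞}
    (hq : Measurable[𝓖] q) (h : ∀ s, MeasurableSet[𝓖] s → P (A ∩ s) = ∫⁻ ω in s, q ω ∂P) :
    condProb P 𝓖 A =ᵐ[P] fun ω => (q ω).toReal := by
  have hqm : Measurable q := hq.mono h𝓖 le_rfl
  have hfin : ∫⁻ ω, q ω ∂P ≠ ∞ := by
    have := h Set.univ MeasurableSet.univ
    rw [Measure.restrict_univ] at this
    rw [← this]
    exact measure_ne_top _ _
  have hint : Integrable (fun ω => (q ω).toReal) P :=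
    integrable_toReal_of_lintegral_ne_top hqm.aemeasurable hfin
  refine (ae_eq_condExp_of_forall_setIntegral_eq h𝓖 ((integrable_const _).indicator hA)
    (fun s _ _ => hint.integrableOn) (fun s hs _ => ?_)
    (Measurable.stronglyMeasurable hq.ennreal_toReal).aestronglyMeasurable).symm
  rw [integral_toReal hqm.aemeasurable.restrict, ← h s hs, integral_indicator hA,
    setIntegral_const, smul_eq_mul, mul_one, Measure.real, Measure.restrict_apply hA]
  exact ae_restrict_of_ae (ae_lt_top hqm hfin)

theorem MeasurableSpace.prod_mono_left {α β : Type*} {m m' : MeasurableSpace α}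
    {n : MeasurableSpace β} (h : m ≤ m') : m.prod n ≤ m'.prod n :=
  sup_le_sup (MeasurableSpace.comap_mono h) le_rfl

section TangentRep

variable {X : Type u} [AddCommGroup X] [Module ℝ X] [QuasiNorm X] [QuasiBanachSpace X]
variable [mX : MeasurableSpace X] [BorelSpace X] [SecondCountableTopology X]
variable {E : Type} [mE : MeasurableSpace E]
variable {Ω : Type w} {mΩ : MeasurableSpace Ω}

/-- The conditional law of `d k` given `F k` is represented as the law of `H k ω e`, where the
noise `e` has law `ν`. -/
structure IsTangentRep (P : Measure Ω) (F : Filtration ℕ mΩ) (ν : Measure E) (d : ℕ → Ω → X)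
    (H : ℕ → Ω → E → X) : Prop where
  adapted : ∀ k, Measurable[F (k + 1)] (d k)
  measurable_uncurry : ∀ k, Measurable[(F k).prod mE] (Function.uncurry (H k))
  lintegral_eq : ∀ k (φ : Ω × X → ℝ≥0∞), Measurable[(F k).prod mX] φ →
    ∫⁻ ω, φ (ω, d k ω) ∂P = ∫⁻ ω, ∫⁻ e, φ (ω, H k ω e) ∂ν ∂P

namespace IsTangentRep

variable {P : Measure Ω} [IsProbabilityMeasure P] {F : Filtration ℕ mΩ} {ν : Measure E}
  [IsProbabilityMeasure ν] {d : ℕ → Ω → X} {H : ℕ → Ω → E → X}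

theorem measurable_d (h : IsTangentRep P F ν d H) (k : ℕ) : Measurable (d k) :=
  (h.adapted k).mono (F.le _) le_rfl

theorem measurable_H (h : IsTangentRep P F ν d H) (k : ℕ) : Measurable (Function.uncurry (H k)) :=
  (h.measurable_uncurry k).mono (MeasurableSpace.prod_mono_left (F.le k)) le_rfl

theorem measurable_comp_filtration (h : IsTangentRep P F ν d H) (k : ℕ) {α : Type*}
    {m : MeasurableSpace α} {a : α → Ω} {b : α → E} (ha : Measurable[m, F k] a)
    (hb : Measurable b) : Measurable fun x => H k (a x) (b x) :=
  (h.measurable_uncurry k).comp (@Measurable.prodMk _ m _ _ (F k) mE _ _ ha hb)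

theorem measurable_comp (h : IsTangentRep P F ν d H) (k : ℕ) {α : Type*}
    [MeasurableSpace α] {a : α → Ω} {b : α → E} (ha : Measurable a) (hb : Measurable b) :
    Measurable fun x => H k (a x) (b x) :=
  (h.measurable_H k).comp (ha.prodMk hb)

theorem measurable_H_left (h : IsTangentRep P F ν d H) (k : ℕ) (ω : Ω) : Measurable (H k ω) :=
  (h.measurable_H k).comp measurable_prodMk_left

theorem measurable_H_right (h : IsTangentRep P F ν d H) (k : ℕ) (e : E) :
    Measurable[F k] fun ω => H k ω e :=
  (h.measurable_uncurry k).comp (@measurable_prodMk_right _ _ (F k) _ e)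

theorem measurable_prob (h : IsTangentRep P F ν d H) (k : ℕ) {B : Set X} (hB : MeasurableSet B) :
    Measurable[F k] fun ω => ν (H k ω ⁻¹' B) :=
  @measurable_measure_prodMk_left Ω E (F k) mE ν _ _ (h.measurable_uncurry k hB)

theorem measure_inter (h : IsTangentRep P F ν d H) (k : ℕ) {s : Set Ω} (hs : MeasurableSet[F k] s)
    {B : Set X} (hB : MeasurableSet B) :
    P (d k ⁻¹' B ∩ s) = ∫⁻ ω in s, ν (H k ω ⁻¹' B) ∂P := by
  have hsm : MeasurableSet s := F.le k _ hs
  have hm : Measurable[(F k).prod mX] ((s ×ˢ B).indicator fun _ => (1 : ℝ≥0∞)) :=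
    (@measurable_const _ _ _ ((F k).prod mX) _).indicator
      (@MeasurableSet.prod _ _ (F k) _ _ _ hs hB)
  have h1 := h.lintegral_eq k _ hm
  have h2 : (fun ω => (s ×ˢ B).indicator (fun _ => (1 : ℝ≥0∞)) (ω, d k ω)) =
      (d k ⁻¹' B ∩ s).indicator 1 := by
    ext ω
    by_cases h1 : ω ∈ s <;> by_cases h2 : d k ω ∈ B <;> simp [h1, h2]
  rw [h2, lintegral_indicator_one (((h.measurable_d k) hB).inter hsm)] at h1
  rw [h1, ← lintegral_indicator hsm]
  refine lintegral_congr fun ω => ?_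
  by_cases hω : ω ∈ s
  · rw [Set.indicator_of_mem hω, ← lintegral_indicator_one (h.measurable_H_left k ω hB)]
    refine lintegral_congr fun e => ?_
    by_cases he : H k ω e ∈ B <;> simp [hω, he]
  · simp [hω]

theorem measurable_noiseSum (h : IsTangentRep P F ν d H) (n : ℕ) :
    Measurable fun z : Ω × (ℕ → E) => noiseSum (fun k => H k z.1) n z.2 := by
  unfold noiseSum
  refine Finset.measurable_fun_sum _ fun k _ => ?_
  exact (h.measurable_H k).comp
    (measurable_fst.prodMk ((measurable_pi_apply k).comp measurable_snd))

/-- The decoupling inequality, for a represented decoupled sequence. -/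
theorem lintegral_le_aux (h : IsTangentRep P F ν d H) {p : ℝ} {D : ℝ≥0}
    (hD : DecouplingWith.{u, w} X p D) (hF : F 0 = ⊥)
    (hfin : ∀ n, lpQNorm p P (fun ω => ∑ k ∈ Finset.range n, d k ω) < ∞)
    {Ω' : Type w} {mΩ' : MeasurableSpace Ω'} {Q : Measure Ω'} [IsProbabilityMeasure Q]
    [Q.IsComplete] {T : Ω' → Ω × (ℕ → E)} (hT : MeasurePreserving T Q (P.prod (noiseMeasure ν)))
    (n : ℕ) :
    lpQNorm p P (fun ω => ∑ k ∈ Finset.range n, d k ω) ≤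
      D * lpQNorm p (P.prod (noiseMeasure ν)) (fun z => noiseSum (fun k => H k z.1) n z.2) := by
  have hT1 : MeasurePreserving (fun z => (T z).1) Q P := measurePreserving_fst.comp hT
  have hbX : borel X = mX := (BorelSpace.measurable_eq (α := X)).symm
  -- The filtration sees only the component in Ω and none of the noise. Hence, given the limit
  -- σ-algebra, the terms `e k` remain independent, with the laws of `H k ω` under ν.
  let G : Filtration ℕ mΩ' :=
    { seq := fun k => (F k).comap fun z => (T z).1
      mono' := fun i j hij => MeasurableSpace.comap_mono (F.mono hij)
      le' := fun k => by
        rintro _ ⟨s, hs, rfl⟩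
        exact hT1.measurable (F.le k _ hs) }
  have hGsup : (⨆ n, G n) = (⨆ n, F n).comap fun z => (T z).1 := MeasurableSpace.comap_iSup.symm
  have hFle : (⨆ n, F n) ≤ mΩ := iSup_le fun n => F.le n
  have hGle : (⨆ n, G n) ≤ mΩ' := iSup_le fun n => G.le n
  have hcomp : ∀ {m : MeasurableSpace Ω} {q : Ω → ℝ≥0∞}, Measurable[m] q →
      Measurable[m.comap fun z => (T z).1] fun z => q (T z).1 := by
    intro m q hq s hs
    exact ⟨_, hq hs, rfl⟩
  set e : ℕ → Ω' → X := fun k z => H k (T z).1 ((T z).2 k) with he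
  have hem : ∀ k, Measurable (e k) := fun k => (h.measurable_H k).comp
    (hT1.measurable.prodMk ((measurable_pi_apply k).comp (measurable_snd.comp hT.measurable)))
  have hpp : ∀ k, ∀ B : Set X, MeasurableSet B → Measurable[⨆ n, F n] fun ω => ν (H k ω ⁻¹' B) :=
    fun k B hB => (h.measurable_prob k hB).mono (le_iSup (fun n => (F n : MeasurableSpace Ω)) k)
      le_rfl
  -- Singletons `J` give the conditional laws of the `e k`, initial segments their conditional
  -- independence.
  have hjoint : ∀ (J : Finset ℕ) (B : ℕ → Set X), (∀ k, MeasurableSet (B k)) →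
      condProb Q (⨆ n, G n) (⋂ k ∈ J, e k ⁻¹' B k) =ᵐ[Q]
        fun z => ∏ k ∈ J, (ν (H k (T z).1 ⁻¹' B k)).toReal := by
    intro J B hB
    have := condProb_ae_eq (P := Q) hGle (A := ⋂ k ∈ J, e k ⁻¹' B k)
      (q := fun z => ∏ k ∈ J, ν (H k (T z).1 ⁻¹' B k))
      (MeasurableSet.biInter (Set.to_countable _) fun k _ => hem k (hB k)) ?_ ?_
    · simpa only [ENNReal.toReal_prod] using this
    · rw [hGsup]
      exact hcomp (q := fun ω => ∏ k ∈ J, ν (H k ω ⁻¹' B k))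
        (Finset.measurable_fun_prod _ fun k _ => hpp k (B k) (hB k))
    · rw [hGsup]
      rintro _ ⟨s, hs, rfl⟩
      have hsm : MeasurableSet s := hFle _ hs
      have hqm : Measurable fun ω => ∏ k ∈ J, ν (H k ω ⁻¹' B k) :=
        (Finset.measurable_fun_prod _ fun k _ => hpp k (B k) (hB k)).mono hFle le_rfl
      rw [hT1.setLIntegral_comp_preimage hsm hqm]
      have hset : (⋂ k ∈ J, e k ⁻¹' B k) ∩ (fun z => (T z).1) ⁻¹' s =
          T ⁻¹' {z | z.1 ∈ s ∧ ∀ k ∈ J, H k z.1 (z.2 k) ∈ B k} := by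
        ext z; simp [he, and_comm]
      have hmeas : MeasurableSet {z : Ω × (ℕ → E) | z.1 ∈ s ∧ ∀ k ∈ J, H k z.1 (z.2 k) ∈ B k} := by
        refine (measurable_fst hsm).inter ?_
        have : {z : Ω × (ℕ → E) | ∀ k ∈ J, H k z.1 (z.2 k) ∈ B k} =
            ⋂ k ∈ J, (fun z : Ω × (ℕ → E) => H k z.1 (z.2 k)) ⁻¹' B k := by ext; simp
        change MeasurableSet {z : Ω × (ℕ → E) | ∀ k ∈ J, H k z.1 (z.2 k) ∈ B k}
        rw [this]
        refine MeasurableSet.biInter (Set.to_countable _) fun k _ => ?_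
        exact ((h.measurable_H k).comp
          (measurable_fst.prodMk ((measurable_pi_apply k).comp measurable_snd))) (hB k)
      rw [hset, hT.measure_preimage hmeas.nullMeasurableSet, Measure.prod_apply hmeas,
        ← lintegral_indicator hsm]
      refine lintegral_congr fun ω => ?_
      by_cases hω : ω ∈ s
      · rw [Set.indicator_of_mem hω, ← Measure.infinitePi_pi (fun _ => ν)
          (fun k _ => h.measurable_H_left k ω (hB k))]
        congr 1
        ext v; simp [hω]
      · rw [Set.indicator_of_notMem hω]
        simp [hω]
  have htan : ∀ k, ∀ B : Set X, MeasurableSet B →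
      condProb Q (G k) ((fun z => d k (T z).1) ⁻¹' B) =ᵐ[Q]
        fun z => (ν (H k (T z).1 ⁻¹' B)).toReal := by
    intro k B hB
    refine condProb_ae_eq (q := fun z => ν (H k (T z).1 ⁻¹' B)) (G.le k)
      (((h.measurable_d k).comp hT1.measurable) hB) (hcomp (h.measurable_prob k hB)) ?_
    rintro _ ⟨s, hs, rfl⟩
    have hsm : MeasurableSet s := F.le k _ hs
    rw [hT1.setLIntegral_comp_preimage hsm ((h.measurable_prob k hB).mono (F.le k) le_rfl),
      ← h.measure_inter k hs hB, ← hT1.measure_preimage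
        ((h.measurable_d k hB).inter hsm).nullMeasurableSet]
    rfl
  have key := hD Ω' mΩ' Q inferInstance inferInstance G (by
      change (F 0).comap _ = ⊥
      rw [hF, MeasurableSpace.comap_bot])
    (fun n z => ∑ k ∈ Finset.range n, d k (T z).1) (fun n z => ∑ k ∈ Finset.range n, e k z)
    (by ext; simp) (by ext; simp) ?_ ?_ ?_ n
  · have e1 : ∀ n, lpQNorm p Q (fun z => ∑ k ∈ Finset.range n, d k (T z).1) =
        lpQNorm p P (fun ω => ∑ k ∈ Finset.range n, d k ω) := fun n => by
      unfold lpQNorm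
      rw [hT1.lintegral_comp (f := fun ω =>
        ENNReal.ofReal (qnorm (∑ k ∈ Finset.range n, d k ω)) ^ p)]
      exact ((QuasiBanachSpace.measurable_qnorm.comp (Finset.measurable_fun_sum _
        fun k _ => h.measurable_d k)).ennreal_ofReal).pow_const p
    have e2 : lpQNorm p Q (fun z => ∑ k ∈ Finset.range n, e k z) =
        lpQNorm p (P.prod (noiseMeasure ν)) (fun z => noiseSum (fun k => H k z.1) n z.2) := by
      unfold lpQNorm
      rw [← hT.lintegral_comp (f := fun z =>
        ENNReal.ofReal (qnorm (noiseSum (fun k => H k z.1) n z.2)) ^ p)]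
      · rfl
      · exact ((QuasiBanachSpace.measurable_qnorm.comp
          (h.measurable_noiseSum n)).ennreal_ofReal).pow_const p
    rw [e1, e2] at key
    exact key
  · intro n
    rw [isRandomVariable_iff_stronglyMeasurable]
    refine Measurable.stronglyMeasurable ?_
    refine Finset.measurable_fun_sum _ fun k hk => ?_
    have hk' : Measurable[G (k + 1)] fun z => d k (T z).1 := fun s hs => ⟨_, h.adapted k hs, rfl⟩
    exact hk'.mono (G.mono (Finset.mem_range.1 hk)) le_rfl
  · intro n
    have := hfin n
    unfold lpQNorm at this ⊢
    rw [hT1.lintegral_comp (f := fun ω =>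
        ENNReal.ofReal (qnorm (∑ k ∈ Finset.range n, d k ω)) ^ p)]
    · exact this
    · exact ((QuasiBanachSpace.measurable_qnorm.comp (Finset.measurable_fun_sum _
        fun k _ => h.measurable_d k)).ennreal_ofReal).pow_const p
  · have hd : (fun k z => ∑ i ∈ Finset.range (k + 1), d i (T z).1 -
        ∑ i ∈ Finset.range k, d i (T z).1) = fun k z => d k (T z).1 := by
      ext k z; simp [Finset.sum_range_succ]
    have hee : (fun k z => ∑ i ∈ Finset.range (k + 1), e i z -
        ∑ i ∈ Finset.range k, e i z) = e := by
      ext k z; simp [Finset.sum_range_succ]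
    change IsDecoupledTangent Q G (fun k z => ∑ i ∈ Finset.range (k + 1), d i (T z).1 -
        ∑ i ∈ Finset.range k, d i (T z).1) (fun k z => ∑ i ∈ Finset.range (k + 1), e i z -
        ∑ i ∈ Finset.range k, e i z)
    rw [hd, hee]
    refine ⟨fun k => ?_, fun k B hB => ?_, fun m B hB => ?_⟩
    · rw [isRandomVariable_iff_stronglyMeasurable]
      exact (hem k).stronglyMeasurable
    · rw [hbX] at hB
      refine (htan k B hB).trans ?_
      simpa using (hjoint {k} (fun _ => B) (fun _ => hB)).symm
    · rw [hbX] at hB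
      refine (hjoint (Finset.range m) B hB).trans ?_
      have hall : ∀ᵐ z ∂Q, ∀ k, condProb Q (⨆ n, G n) (e k ⁻¹' B k) z =
          (ν (H k (T z).1 ⁻¹' B k)).toReal := by
        refine ae_all_iff.2 fun k => ?_
        have hk := hjoint {k} B hB
        simp only [Finset.mem_singleton, Set.iInter_iInter_eq_left, Finset.prod_singleton] at hk
        exact hk
      filter_upwards [hall] with z hz
      exact Finset.prod_congr rfl fun k _ => (hz k).symm

/-- The decoupling inequality is about complete probability spaces, so the product is replaced by
its completion, on which the identity is still measure preserving. Noise in `Type` keeps the product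
in the universe of Ω. -/
theorem lpQNorm_le (h : IsTangentRep P F ν d H) {p : ℝ} {D : ℝ≥0}
    (hD : DecouplingWith.{u, w} X p D) (hF : F 0 = ⊥)
    (hfin : ∀ n, lpQNorm p P (fun ω => ∑ k ∈ Finset.range n, d k ω) < ∞) (n : ℕ) :
    lpQNorm p P (fun ω => ∑ k ∈ Finset.range n, d k ω) ≤
      D * lpQNorm p (P.prod (noiseMeasure ν)) (fun z => noiseSum (fun k => H k z.1) n z.2) := by
  set Q := P.prod (noiseMeasure ν)
  have hQ : IsProbabilityMeasure Q.completion :=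
    ⟨(Measure.completion_apply Q _).trans measure_univ⟩
  refine h.lintegral_le_aux hD hF hfin (Q := Q.completion) (T := fun z => z) ⟨?_, ?_⟩ n
  · exact fun s hs => hs.nullMeasurableSet
  · ext s hs
    rw [Measure.map_apply (fun s hs => hs.nullMeasurableSet) hs]
    exact Measure.completion_apply Q _

end IsTangentRep

end TangentRep

/-- Disintegrate the joint law of `T` and `d`, then realize the conditional law as a jointly
measurable image of the uniform law on [0,1]. -/
theorem exists_noise_representation {Ω Ω' X : Type*} {mΩ : MeasurableSpace Ω}
    {mΩ' : MeasurableSpace Ω'} [MeasurableSpace X] [StandardBorelSpace X] [Nonempty X]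
    (P : Measure Ω) [IsFiniteMeasure P] {T : Ω → Ω'} (hT : Measurable T) {d : Ω → X}
    (hd : Measurable d) :
    ∃ H : Ω' → unitInterval → X, Measurable (Function.uncurry H) ∧
      ∀ φ : Ω' × X → ℝ≥0∞, Measurable φ →
        ∫⁻ ω, φ (T ω, d ω) ∂P = ∫⁻ ω, ∫⁻ e, φ (T ω, H (T ω) e) ∂volume ∂P := by
  obtain ⟨H, hH, hHk⟩ := (condDistrib d T P).exists_measurable_map_eq_unitInterval
  refine ⟨H, hH, fun φ hφ => ?_⟩
  rw [← lintegral_map hφ (hT.prodMk hd), ← compProd_map_condDistrib hd.aemeasurable,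
    Measure.lintegral_compProd hφ, lintegral_map (hφ.lintegral_kernel_prod_right') hT]
  refine lintegral_congr fun ω => ?_
  rw [← hHk]
  exact lintegral_map (hφ.comp measurable_prodMk_left) hH.of_uncurry_left

section TangentRep

variable {X : Type u} [AddCommGroup X] [Module ℝ X] [QuasiNorm X] [QuasiBanachSpace X]
variable [mX : MeasurableSpace X] [BorelSpace X] [SecondCountableTopology X]
variable {Ω : Type w} {mΩ : MeasurableSpace Ω}

theorem exists_isTangentRep (P : Measure Ω) [IsProbabilityMeasure P] (F : Filtration ℕ mΩ)
    {d : ℕ → Ω → X} (hd : ∀ k, Measurable[F (k + 1)] (d k)) :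
    ∃ H : ℕ → Ω → unitInterval → X, IsTangentRep P F volume d H := by
  have : PolishSpace X := {}
  have hdm : ∀ k, Measurable (d k) := fun k => (hd k).mono (F.le _) le_rfl
  -- Conditioning on the identity into Ω with the smaller σ-algebra `F k` makes `H k` measurable for
  -- `F k` in its first argument.
  choose H hH hφ using fun k => @exists_noise_representation Ω Ω X mΩ (F k) _ _ _ P _ id
    (measurable_id'' (F.le k)) (d k) (hdm k)
  exact ⟨H, hd, hH, hφ⟩

namespace IsTangentRep

variable {E : Type} [mE : MeasurableSpace E] {P : Measure Ω} [IsProbabilityMeasure P]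
  {F : Filtration ℕ mΩ} {ν : Measure E} [IsProbabilityMeasure ν] {d e : ℕ → Ω → X}
  {H : ℕ → Ω → E → X}

theorem condProb_ae_eq (h : IsTangentRep P F ν d H) (k : ℕ) {B : Set X} (hB : MeasurableSet B) :
    condProb P (F k) (d k ⁻¹' B) =ᵐ[P] fun ω => (ν (H k ω ⁻¹' B)).toReal :=
  _root_.condProb_ae_eq (F.le k) (h.measurable_d k hB) (h.measurable_prob k hB)
    fun _ hs => h.measure_inter k hs hB

/-- On a box both laws equal the expectation of the product of the conditional probabilities ν(H k ω
∈ B k), and boxes determine the law. So the represented sum may stand for any decoupled sum. -/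
theorem map_eq_of_isDecoupledTangent (h : IsTangentRep P F ν d H)
    (hde : IsDecoupledTangent P F d e) (n : ℕ) :
    P.map (fun ω (k : Fin n) => e k ω) =
      (P.prod (noiseMeasure ν)).map (fun z (k : Fin n) => H k z.1 (z.2 k)) := by
  have hbX : borel X = mX := (BorelSpace.measurable_eq (α := X)).symm
  have hem : ∀ k, Measurable (e k) := fun k => by
    have := (hde.randomVariable k).1
    rwa [hbX] at this
  have hFle : (⨆ n, F n) ≤ mΩ := iSup_le fun n => F.le n
  have hHm : ∀ k, Measurable fun z : Ω × (ℕ → E) => H k z.1 (z.2 k) := fun k =>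
    (h.measurable_H k).comp (measurable_fst.prodMk ((measurable_pi_apply k).comp measurable_snd))
  have hm1 : Measurable (fun ω (k : Fin n) => e k ω) := measurable_pi_lambda _ fun k => hem k
  have hm2 : Measurable (fun (z : Ω × (ℕ → E)) (k : Fin n) => H k z.1 (z.2 k)) :=
    measurable_pi_lambda _ fun k => hHm k
  have : IsProbabilityMeasure (P.map (fun ω (k : Fin n) => e k ω)) :=
    Measure.isProbabilityMeasure_map hm1.aemeasurable
  have : IsProbabilityMeasure
      ((P.prod (noiseMeasure ν)).map (fun z (k : Fin n) => H k z.1 (z.2 k))) :=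
    Measure.isProbabilityMeasure_map hm2.aemeasurable
  refine ext_of_generate_finite _ generateFrom_pi.symm isPiSystem_pi ?_ (by simp)
  rintro _ ⟨t, ht, rfl⟩
  have ht' : ∀ k, MeasurableSet (t k) := fun k => ht k (Set.mem_univ k)
  have hbox := MeasurableSet.univ_pi ht'
  rw [Measure.map_apply hm1 hbox, Measure.map_apply hm2 hbox]
  set B : ℕ → Set X := fun k => if hk : k < n then t ⟨k, hk⟩ else Set.univ with hBdef
  have hB : ∀ k, MeasurableSet (B k) := by
    intro k
    by_cases hk : k < n
    · simpa [hBdef, hk] using ht' _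
    · simp [hBdef, hk]
  have hBk : ∀ k : Fin n, B k = t k := fun k => by simp [hBdef]
  have hs1 : (fun ω (k : Fin n) => e k ω) ⁻¹' Set.univ.pi t =
      ⋂ k ∈ Finset.range n, e k ⁻¹' B k := by
    ext ω
    simp only [Set.mem_preimage, Set.mem_pi, Set.mem_univ, true_implies, Set.mem_iInter,
      Finset.mem_range]
    exact ⟨fun h k hk => by rw [hBk ⟨k, hk⟩]; exact h ⟨k, hk⟩,
      fun h k => by rw [← hBk]; exact h k k.2⟩
  have hs2 : (fun (z : Ω × (ℕ → E)) (k : Fin n) => H k z.1 (z.2 k)) ⁻¹' Set.univ.pi t =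
      {z | ∀ k ∈ Finset.range n, H k z.1 (z.2 k) ∈ B k} := by
    ext z
    simp only [Set.mem_preimage, Set.mem_pi, Set.mem_univ, true_implies, Set.mem_ofPred_eq,
      Finset.mem_range]
    exact ⟨fun h k hk => by rw [hBk ⟨k, hk⟩]; exact h ⟨k, hk⟩,
      fun h k => by rw [← hBk]; exact h k k.2⟩
  have hms1 : MeasurableSet (⋂ k ∈ Finset.range n, e k ⁻¹' B k) :=
    MeasurableSet.biInter (Set.to_countable _) fun k _ => hem k (hB k)
  have hms2 := hm2 hbox
  rw [hs1]
  have hR : (P.prod (noiseMeasure ν)) ((fun (z : Ω × (ℕ → E)) (k : Fin n) => H k z.1 (z.2 k)) ⁻¹'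
      Set.univ.pi t) = ∫⁻ ω, ∏ k ∈ Finset.range n, ν (H k ω ⁻¹' B k) ∂P := by
    rw [Measure.prod_apply hms2]
    refine lintegral_congr fun ω => ?_
    rw [← Measure.infinitePi_pi (fun _ => ν) (fun k _ => h.measurable_H_left k ω (hB k)), hs2]
    congr 1
  rw [hR]
  have hL : (P (⋂ k ∈ Finset.range n, e k ⁻¹' B k)).toReal =
      ∫ ω, ∏ k ∈ Finset.range n, (ν (H k ω ⁻¹' B k)).toReal ∂P := by
    have h1 : ∫ ω, condProb P (⨆ n, F n) (⋂ k ∈ Finset.range n, e k ⁻¹' B k) ω ∂P =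
        (P (⋂ k ∈ Finset.range n, e k ⁻¹' B k)).toReal := by
      unfold condProb
      rw [integral_condExp hFle, integral_indicator hms1, setIntegral_const, smul_eq_mul, mul_one]
      rfl
    rw [← h1]
    refine integral_congr_ae ?_
    have hall : ∀ᵐ ω ∂P, ∀ k, condProb P (⨆ n, F n) (e k ⁻¹' B k) ω =
        (ν (H k ω ⁻¹' B k)).toReal := ae_all_iff.2 fun k =>
      (hde.tangent k (B k) (by rw [hbX]; exact hB k)).symm.trans (h.condProb_ae_eq k (hB k))
    filter_upwards [hde.condIndep n B (fun k => by rw [hbX]; exact hB k), hall] with ω h1 h2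
    rw [h1]
    exact Finset.prod_congr rfl fun k _ => h2 k
  have hmk : Measurable fun ω => ∏ k ∈ Finset.range n, ν (H k ω ⁻¹' B k) :=
    Finset.measurable_fun_prod _ fun k _ => (h.measurable_prob k (hB k)).mono (F.le k) le_rfl
  have hle1 : ∀ ω, ∏ k ∈ Finset.range n, ν (H k ω ⁻¹' B k) ≤ 1 := fun ω =>
    Finset.prod_le_one' fun k _ => prob_le_one
  have hfin : ∫⁻ ω, ∏ k ∈ Finset.range n, ν (H k ω ⁻¹' B k) ∂P ≠ ∞ :=
    ne_of_lt (lt_of_le_of_lt (lintegral_mono hle1) (by simp))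
  rw [← ENNReal.toReal_eq_toReal_iff' (measure_ne_top _ _) hfin, hL, ← integral_toReal
    hmk.aemeasurable (Eventually.of_forall fun ω => lt_of_le_of_lt (hle1 ω) ENNReal.one_lt_top)]
  simp only [ENNReal.toReal_prod]

theorem lpQNorm_decoupled_eq (h : IsTangentRep P F ν d H) (hde : IsDecoupledTangent P F d e)
    (p : ℝ) (n : ℕ) :
    lpQNorm p P (fun ω => ∑ k ∈ Finset.range n, e k ω) =
      lpQNorm p (P.prod (noiseMeasure ν)) (fun z => noiseSum (fun k => H k z.1) n z.2) := by
  have hbX : borel X = mX := (BorelSpace.measurable_eq (α := X)).symm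
  have hem : ∀ k, Measurable (e k) := fun k => by
    have := (hde.randomVariable k).1
    rwa [hbX] at this
  have hψ : Measurable fun y : Fin n → X => ENNReal.ofReal (qnorm (∑ k, y k)) ^ p :=
    ((QuasiBanachSpace.measurable_qnorm.comp (Finset.measurable_fun_sum _
      fun k _ => measurable_pi_apply k)).ennreal_ofReal).pow_const p
  have h1 := lintegral_map (μ := P) hψ (measurable_pi_lambda (fun ω (k : Fin n) => e k ω)
    fun k => hem k)
  have h2 := lintegral_map (μ := P.prod (noiseMeasure ν)) hψ (measurable_pi_lambda
    (fun (z : Ω × (ℕ → E)) (k : Fin n) => H k z.1 (z.2 k)) fun k => (h.measurable_H k).comp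
      (measurable_fst.prodMk ((measurable_pi_apply (k : ℕ)).comp measurable_snd)))
  rw [h.map_eq_of_isDecoupledTangent hde, h2] at h1
  unfold lpQNorm noiseSum
  congr 1
  simp only [Finset.sum_range]
  exact h1.symm

end IsTangentRep

end TangentRep

/-! ### Symmetrization -/

section Symmetrize

variable {Ω : Type w} {mΩ : MeasurableSpace Ω}

/-- The `σ`-algebra of the first `k` coordinates of a sequence. -/
@[reducible] def coordSigma (E : Type) [MeasurableSpace E] (k : ℕ) : MeasurableSpace (ℕ → E) :=
  MeasurableSpace.pi.comap fun v (j : Fin k) => v j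

theorem coordSigma_mono (E : Type) [MeasurableSpace E] : Monotone (coordSigma E) := by
  intro i j hij
  have h : Measurable fun (y : Fin j → E) (a : Fin i) => y (Fin.castLE hij a) := by fun_prop
  rintro _ ⟨s, hs, rfl⟩
  exact ⟨_, h hs, rfl⟩

theorem coordSigma_le (E : Type) [MeasurableSpace E] (k : ℕ) :
    coordSigma E k ≤ MeasurableSpace.pi := by
  have h : Measurable fun (v : ℕ → E) (a : Fin k) => v a := by fun_prop
  rintro _ ⟨s, hs, rfl⟩
  exact h hs

theorem coordSigma_zero (E : Type) [MeasurableSpace E] : coordSigma E 0 = ⊥ := by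
  refine le_antisymm ?_ bot_le
  rintro _ ⟨s, -, rfl⟩
  rcases Set.eq_empty_or_nonempty s with rfl | ⟨a, ha⟩
  · simp
  · have : s = Set.univ := Set.eq_univ_of_forall fun b => by rwa [Subsingleton.elim b a]
    simp [this]

theorem measurable_coordSigma_eval (E : Type) [MeasurableSpace E] {j k : ℕ} (h : j < k) :
    Measurable[coordSigma E k] fun v : ℕ → E => v j := by
  intro s hs
  exact ⟨(fun y : Fin k → E => y ⟨j, h⟩) ⁻¹' s, measurable_pi_apply (⟨j, h⟩ : Fin k) hs, rfl⟩

/-- The filtration on `Ω × (ℕ → E)` that reveals the noise coordinates one by one. -/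
def noiseFiltration (F : Filtration ℕ mΩ) (E : Type) [MeasurableSpace E] :
    Filtration ℕ (mΩ.prod (MeasurableSpace.pi (X := fun _ : ℕ => E))) where
  seq k := (F k).prod (coordSigma E k)
  mono' _ _ hij := sup_le_sup (MeasurableSpace.comap_mono (F.mono hij))
    (MeasurableSpace.comap_mono (coordSigma_mono E hij))
  le' k := sup_le_sup (MeasurableSpace.comap_mono (F.le k))
    (MeasurableSpace.comap_mono (coordSigma_le E k))

theorem noiseFiltration_apply (F : Filtration ℕ mΩ) (E : Type) [MeasurableSpace E] (k : ℕ) :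
    noiseFiltration F E k = (F k).prod (coordSigma E k) := rfl

theorem noiseFiltration_zero {F : Filtration ℕ mΩ} (hF : F 0 = ⊥) (E : Type) [MeasurableSpace E] :
    noiseFiltration F E 0 = ⊥ := by
  rw [noiseFiltration_apply, hF, coordSigma_zero, MeasurableSpace.prod]
  simp

/-- Every set of the σ-algebra is a preimage under the map `q` that keeps ω, the first k coordinates
and x. No measurability of the image set is needed, hence the σ-algebra `⊤` on the target. -/
theorem apply_update_of_measurable {X : Type*} [mX : MeasurableSpace X] {E : Type}
    [MeasurableSpace E] {F : Filtration ℕ mΩ} {k : ℕ}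
    {ψ : (Ω × (ℕ → E)) × X → ℝ≥0∞} (hψ : Measurable[(noiseFiltration F E k).prod mX] ψ)
    (ω : Ω) (v : ℕ → E) (e : E) (x : X) :
    ψ ((ω, Function.update v k e), x) = ψ ((ω, v), x) := by
  let q : (Ω × (ℕ → E)) × X → Ω × (Fin k → E) × X := fun z => (z.1.1, fun j => z.1.2 j, z.2)
  have hle : (noiseFiltration F E k).prod mX ≤ (⊤ : MeasurableSpace _).comap q := by
    rw [noiseFiltration_apply]
    refine sup_le ?_ ?_
    · rw [MeasurableSpace.prod, MeasurableSpace.comap_sup, MeasurableSpace.comap_comp,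
        MeasurableSpace.comap_comp, coordSigma, MeasurableSpace.comap_comp]
      refine sup_le ?_ ?_
      · rintro _ ⟨s, -, rfl⟩
        exact ⟨(fun y => y.1) ⁻¹' s, trivial, rfl⟩
      · rintro _ ⟨s, -, rfl⟩
        exact ⟨(fun y => y.2.1) ⁻¹' s, trivial, rfl⟩
    · rintro _ ⟨s, -, rfl⟩
      exact ⟨(fun y => y.2.2) ⁻¹' s, trivial, rfl⟩
  obtain ⟨s, -, hs⟩ := hle _ (hψ (measurableSet_singleton (ψ ((ω, v), x))))
  have hq : q ((ω, Function.update v k e), x) = q ((ω, v), x) := by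
    have : ∀ j : Fin k, Function.update v k e j = v j := fun j =>
      Function.update_of_ne (by have := j.2; omega) _ _
    simp only [q, this]
  have h1 : ((ω, v), x) ∈ q ⁻¹' s := by rw [hs]; rfl
  have h2 : ((ω, Function.update v k e), x) ∈ q ⁻¹' s := by
    rw [Set.mem_preimage, hq]; exact h1
  rw [hs] at h2
  exact h2

variable {X : Type u} [AddCommGroup X] [Module ℝ X] [QuasiNorm X] [QuasiBanachSpace X]
variable [mX : MeasurableSpace X] [BorelSpace X] [SecondCountableTopology X]
variable {E : Type} [mE : MeasurableSpace E] {P : Measure Ω} [IsProbabilityMeasure P]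
  {F : Filtration ℕ mΩ} {ν : Measure E} [IsProbabilityMeasure ν] {d : ℕ → Ω → X}
  {H : ℕ → Ω → E → X}

/-- Subtracting a conditionally independent copy gives a conditionally symmetric sequence. -/
theorem IsTangentRep.symmetrize (h : IsTangentRep P F ν d H) :
    IsTangentRep (P.prod (noiseMeasure ν)) (noiseFiltration F E) (ν.prod ν)
      (fun k z => d k z.1 - H k z.1 (z.2 k)) (fun k z a => H k z.1 a.1 - H k z.1 a.2) where
  adapted k := by
    rw [noiseFiltration_apply]
    have hfst : Measurable[(F (k + 1)).prod (coordSigma E (k + 1)), F (k + 1)]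
        (Prod.fst : Ω × (ℕ → E) → Ω) := @measurable_fst _ _ (F (k + 1)) (coordSigma E (k + 1))
    have hsnd : Measurable[(F (k + 1)).prod (coordSigma E (k + 1)), coordSigma E (k + 1)]
        (Prod.snd : Ω × (ℕ → E) → _) := @measurable_snd _ _ (F (k + 1)) (coordSigma E (k + 1))
    have h1 := (h.adapted k).comp hfst
    exact Measurable.sub h1 (h.measurable_comp_filtration k
      (hfst.mono le_rfl (F.mono (Nat.le_succ k)))
      ((measurable_coordSigma_eval E (Nat.lt_succ_self k)).comp hsnd))
  measurable_uncurry k := by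
    rw [noiseFiltration_apply]
    have hfst : Measurable[((F k).prod (coordSigma E k)).prod (mE.prod mE), F k]
        (fun y : (Ω × (ℕ → E)) × (E × E) => y.1.1) :=
      (@measurable_fst _ _ (F k) (coordSigma E k)).comp
        (@measurable_fst _ _ ((F k).prod (coordSigma E k)) _)
    have hsnd : Measurable[((F k).prod (coordSigma E k)).prod (mE.prod mE), mE.prod mE]
        (fun y : (Ω × (ℕ → E)) × (E × E) => y.2) :=
      @measurable_snd _ _ ((F k).prod (coordSigma E k)) _
    exact Measurable.sub (h.measurable_comp_filtration k hfst (measurable_fst.comp hsnd))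
      (h.measurable_comp_filtration k hfst (measurable_snd.comp hsnd))
  lintegral_eq k ψ hψ := by
    have hψm : Measurable ψ := hψ.mono
      (MeasurableSpace.prod_mono_left ((noiseFiltration F E).le k)) le_rfl
    have hHm := h.measurable_H k
    have hdm := h.measurable_d k
    have hL : Measurable fun z : Ω × (ℕ → E) => ψ (z, d k z.1 - H k z.1 (z.2 k)) := by
      exact hψm.comp (measurable_id.prodMk ((hdm.comp measurable_fst).sub
        (h.measurable_comp k measurable_fst ((measurable_pi_apply k).comp measurable_snd))))
    have hR : Measurable fun y : (Ω × (ℕ → E)) × (E × E) =>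
        ψ (y.1, H k y.1.1 y.2.1 - H k y.1.1 y.2.2) := by
      exact hψm.comp (measurable_fst.prodMk (Measurable.sub
        (h.measurable_comp k (measurable_fst.comp measurable_fst)
          (measurable_fst.comp measurable_snd))
        (h.measurable_comp k (measurable_fst.comp measurable_fst)
          (measurable_snd.comp measurable_snd))))
    -- Coordinate k of the noise is redrawn as a separate variable e, which ψ does not see. For
    -- fixed v and e, the representation of `d k` then applies to ψ((ω, v), d k ω - H k ω e).
    rw [lintegral_prod_symm _ hL.aemeasurable, lintegral_prod_symm _
      hR.lintegral_prod_right'.aemeasurable,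
      ← (measurePreserving_update ν k).lintegral_comp hL.lintegral_prod_left']
    have hU : Measurable fun a : (ℕ → E) × E => ∫⁻ ω, ψ ((ω, Function.update a.1 k a.2),
        d k ω - H k ω (Function.update a.1 k a.2 k)) ∂P :=
      hL.lintegral_prod_left'.comp (measurePreserving_update ν k).measurable
    refine (lintegral_prod _ hU.aemeasurable).trans ?_
    refine lintegral_congr fun v => ?_
    have hφ : ∀ e : E, Measurable[(F k).prod mX]
        fun y : Ω × X => ψ ((y.1, v), y.2 - H k y.1 e) := by
      intro e
      have hfst : Measurable[(F k).prod mX, F k] (Prod.fst : Ω × X → Ω) :=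
        @measurable_fst _ _ (F k) mX
      have hsnd : Measurable[(F k).prod mX, mX] (Prod.snd : Ω × X → X) :=
        @measurable_snd _ _ (F k) mX
      have h1 : Measurable[(F k).prod mX, (F k).prod (coordSigma E k)]
          fun y : Ω × X => (y.1, v) :=
        @Measurable.prodMk _ ((F k).prod mX) _ _ (F k) (coordSigma E k) _ _ hfst
          (@measurable_const _ _ (coordSigma E k) _ _)
      have h2 : Measurable[(F k).prod mX] fun y : Ω × X => y.2 - H k y.1 e :=
        Measurable.sub hsnd ((h.measurable_H_right k e).comp hfst)
      exact hψ.comp (@Measurable.prodMk _ ((F k).prod mX) _ _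
        ((F k).prod (coordSigma E k)) mX _ _ h1 h2)
    have h1 : ∀ e : E, ∫⁻ ω, ψ ((ω, Function.update v k e),
        d k ω - H k ω (Function.update v k e k)) ∂P =
        ∫⁻ ω, ∫⁻ e', ψ ((ω, v), H k ω e' - H k ω e) ∂ν ∂P := by
      intro e
      rw [← h.lintegral_eq k _ (hφ e)]
      refine lintegral_congr fun ω => ?_
      rw [apply_update_of_measurable hψ, Function.update_self]
    have hR' : Measurable fun y : Ω × (E × E) => ψ ((y.1, v), H k y.1 y.2.1 - H k y.1 y.2.2) :=
      hR.comp ((measurable_fst.prodMk measurable_const).prodMk measurable_snd)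
    have hR'' : Measurable fun y : (Ω × E) × E => ψ ((y.1.1, v), H k y.1.1 y.2 - H k y.1.1 y.1.2) :=
      hR'.comp ((measurable_fst.comp measurable_fst).prodMk
        (measurable_snd.prodMk (measurable_snd.comp measurable_fst)))
    calc _ = ∫⁻ e, ∫⁻ ω, ∫⁻ e', ψ ((ω, v), H k ω e' - H k ω e) ∂ν ∂P ∂ν :=
          lintegral_congr fun e => h1 e
      _ = ∫⁻ ω, ∫⁻ e, ∫⁻ e', ψ ((ω, v), H k ω e' - H k ω e) ∂ν ∂ν ∂P :=
          (lintegral_lintegral_swap hR''.lintegral_prod_right'.aemeasurable).symm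
      _ = _ := by
          refine lintegral_congr fun ω => ?_
          exact (lintegral_prod_symm _ (hR'.comp measurable_prodMk_left).aemeasurable).symm

end Symmetrize

/-! ### Running maxima: pathwise estimates -/

section RunMax

/-- The running maximum `max (0, a 0, …, a (k - 1))`. -/
def runMax (a : ℕ → ℝ) : ℕ → ℝ
  | 0 => 0
  | k + 1 => max (runMax a k) (a k)

theorem runMax_nonneg (a : ℕ → ℝ) (k : ℕ) : 0 ≤ runMax a k := by
  induction k with
  | zero => exact le_rfl
  | succ k ih => exact ih.trans (le_max_left _ _)

theorem runMax_mono (a : ℕ → ℝ) : Monotone (runMax a) :=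
  monotone_nat_of_le_succ fun _ => le_max_left _ _

theorem le_runMax (a : ℕ → ℝ) {j k : ℕ} (h : j < k) : a j ≤ runMax a k :=
  (le_max_right (runMax a j) (a j)).trans (runMax_mono a h)

theorem lt_runMax_iff {a : ℕ → ℝ} {t : ℝ} (ht : 0 ≤ t) {k : ℕ} :
    t < runMax a k ↔ ∃ j < k, t < a j := by
  induction k with
  | zero => simp [runMax, ht]
  | succ k ih =>
    rw [runMax, lt_max_iff, ih]
    constructor
    · rintro (⟨j, hj, h⟩ | h)
      · exact ⟨j, by omega, h⟩
      · exact ⟨k, by omega, h⟩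
    · rintro ⟨j, hj, h⟩
      rcases Nat.lt_succ_iff_lt_or_eq.1 hj with hj' | rfl
      · exact Or.inl ⟨j, hj', h⟩
      · exact Or.inr h

theorem measurable_runMax {Ω : Type*} {m : MeasurableSpace Ω} {a : Ω → ℕ → ℝ} {k : ℕ}
    (h : ∀ j < k, Measurable fun ω => a ω j) : Measurable fun ω => runMax (a ω) k := by
  induction k with
  | zero => exact measurable_const
  | succ k ih => exact (ih fun j hj => h j (by omega)).max (h k (by omega))

variable {X : Type u} [AddCommGroup X] [Module ℝ X] [QuasiNorm X] [QuasiBanachSpace X] {C : ℝ}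

/-- The sum of the terms that are much larger than all their predecessors is controlled by the
largest term. -/
theorem qnorm_sum_large_le (hC : ∀ x y : X, qnorm (x + y) ≤ C * (qnorm x + qnorm y)) (hC1 : 1 ≤ C)
    (x : ℕ → X) (n : ℕ) :
    qnorm (∑ k ∈ Finset.range n,
      if qnorm (x k) ≤ 2 * C * runMax (fun j => qnorm (x j)) k then 0 else x k) ≤
      2 * C * runMax (fun j => qnorm (x j)) n := by
  induction n with
  | zero => simp [QuasiBanachSpace.qnorm_zero, runMax]
  | succ n ih =>
    have hmono := runMax_mono (fun j => qnorm (x j)) (Nat.le_succ n)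
    rw [Finset.sum_range_succ]
    split_ifs with h
    · rw [add_zero]
      refine ih.trans ?_
      gcongr
    -- The earlier large terms sum to at most 2C times the old maximum, which is below `qnorm (x
    -- n)`. The new sum is thus at most C (‖x n‖ + ‖x n‖), with no accumulation of constants.
    · rw [not_le] at h
      have h1 : qnorm (x n) ≤ runMax (fun j => qnorm (x j)) (n + 1) :=
        le_runMax (fun j => qnorm (x j)) (Nat.lt_succ_self n)
      refine (hC _ _).trans ?_
      have h2 : C * (qnorm (∑ k ∈ Finset.range n, if qnorm (x k) ≤
          2 * C * runMax (fun j => qnorm (x j)) k then 0 else x k) + qnorm (x n)) ≤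
          C * (qnorm (x n) + qnorm (x n)) := by gcongr; linarith
      nlinarith

/-- A path whose increments are at most `lam` and that exceeds the level `(2 * C ^ 2 + C) * lam`
moves by more than `lam` between the levels `lam` and `(2 * C ^ 2 + C) * lam`. -/
theorem lt_qnorm_sum_upcrossing (hC : ∀ x y : X, qnorm (x + y) ≤ C * (qnorm x + qnorm y))
    (hC1 : 1 ≤ C) {x : ℕ → X} {lam : ℝ} (hlam : 0 < lam) {n : ℕ}
    (hx : ∀ k < n, qnorm (x k) ≤ lam) (M : ℕ → ℝ)
    (hM : M = runMax fun j => qnorm (∑ i ∈ Finset.range (j + 1), x i))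
    (hn : (2 * C ^ 2 + C) * lam < M n) :
    lam < qnorm (∑ k ∈ Finset.range n,
      if lam < M k ∧ M k ≤ (2 * C ^ 2 + C) * lam then x k else 0) := by
  set β := 2 * C ^ 2 + C with hβ
  have hMle : ∀ k, qnorm (∑ i ∈ Finset.range k, x i) ≤ M k := by
    intro k
    rw [hM]
    cases k with
    | zero => simp [QuasiBanachSpace.qnorm_zero, runMax]
    | succ k => exact le_runMax (fun j => qnorm (∑ i ∈ Finset.range (j + 1), x i)) k.lt_succ_self
  have hMs : ∀ k, M (k + 1) = max (M k) (qnorm (∑ i ∈ Finset.range (k + 1), x i)) := by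
    intro k; rw [hM]; rfl
  set h : ℕ → X := fun m => ∑ k ∈ Finset.range m,
    if lam < M k ∧ M k ≤ β * lam then x k else 0 with hh
  have hβ1 : 2 * C ≤ β := by nlinarith
  -- Three phases. Up to the level `lam` nothing is selected. Between the levels the gap between the
  -- full and the selected sum is frozen at the value of the path on entry, at most 2C lam. At the
  -- exit the path exceeds β lam = C (lam + 2C lam), so the selected sum exceeds `lam`, and it stays
  -- constant afterwards.
  have key : ∀ k ≤ n, (M k ≤ lam → h k = 0) ∧
      (lam < M k → M k ≤ β * lam →
        qnorm ((∑ i ∈ Finset.range k, x i) - h k) ≤ 2 * C * lam) ∧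
      (β * lam < M k → lam < qnorm (h k)) := by
    intro k
    induction k with
    | zero =>
      intro _
      have h0 : M 0 = 0 := by rw [hM]; rfl
      have h1 : 0 ≤ β * lam := mul_nonneg (by linarith) hlam.le
      refine ⟨fun _ => by simp [hh], fun h2 => ?_, fun h2 => ?_⟩
      · rw [h0] at h2; linarith
      · rw [h0] at h2; linarith
    | succ k ih =>
      intro hk
      obtain ⟨ih1, ih2, ih3⟩ := ih (by omega)
      have hxk := hx k (by omega)
      have hstep : h (k + 1) = h k + if lam < M k ∧ M k ≤ β * lam then x k else 0 :=
        Finset.sum_range_succ _ _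
      have hmono : M k ≤ M (k + 1) := by rw [hMs]; exact le_max_left _ _
      rcases le_or_gt (M k) lam with hc | hc
      · have hh0 : h (k + 1) = 0 := by
          rw [hstep, ih1 hc, if_neg (fun hcon => absurd hcon.1 (not_lt.2 hc)), add_zero]
        have hnorm : qnorm (∑ i ∈ Finset.range (k + 1), x i) ≤ 2 * C * lam := by
          rw [Finset.sum_range_succ]
          have h1 := hC (∑ i ∈ Finset.range k, x i) (x k)
          have h2 := (hMle k).trans hc
          nlinarith
        have hMk : M (k + 1) ≤ 2 * C * lam := by
          rw [hMs]; exact max_le (hc.trans (by nlinarith)) hnorm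
        refine ⟨fun _ => hh0, fun _ _ => by rw [hh0, sub_zero]; exact hnorm, fun hcon => ?_⟩
        exact absurd hcon (not_lt.2 (hMk.trans (by nlinarith)))
      · refine ⟨fun hcon => absurd (hmono.trans hcon) (not_le.2 hc), ?_, ?_⟩
        · intro _ hle
          have hcle := hmono.trans hle
          rw [hstep, if_pos ⟨hc, hcle⟩, Finset.sum_range_succ, add_sub_add_right_eq_sub]
          exact ih2 hc hcle
        · intro hlt
          rcases le_or_gt (M k) (β * lam) with hcle | hclt
          · have hd := ih2 hc hcle
            have hnorm : β * lam < qnorm (∑ i ∈ Finset.range (k + 1), x i) := by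
              rw [hMs, lt_max_iff] at hlt
              exact hlt.resolve_left (not_lt.2 hcle)
            have heq : (∑ i ∈ Finset.range (k + 1), x i) =
                h (k + 1) + ((∑ i ∈ Finset.range k, x i) - h k) := by
              rw [hstep, if_pos ⟨hc, hcle⟩, Finset.sum_range_succ]; abel
            have h1 := hC (h (k + 1)) ((∑ i ∈ Finset.range k, x i) - h k)
            rw [← heq] at h1
            by_contra hcon
            rw [not_lt] at hcon
            have h2 : C * (qnorm (h (k + 1)) + qnorm ((∑ i ∈ Finset.range k, x i) - h k)) ≤
                C * (lam + 2 * C * lam) := by gcongr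
            nlinarith
          · rw [hstep, if_neg (fun hcon => absurd hcon.2 (not_le.2 hclt)), add_zero]
            exact ih3 hclt
  exact (key n le_rfl).2.2 hn

end RunMax

/-! ### Predictable transforms and maxima of tangent sequences -/

section Transform

variable {X : Type u} [AddCommGroup X] [Module ℝ X] [QuasiNorm X] [QuasiBanachSpace X]
variable [mX : MeasurableSpace X] [BorelSpace X] [SecondCountableTopology X]
variable {Ω : Type w} {mΩ : MeasurableSpace Ω}
variable {E : Type} [mE : MeasurableSpace E] {P : Measure Ω} [IsProbabilityMeasure P]
  {F : Filtration ℕ mΩ} {ν : Measure E} [IsProbabilityMeasure ν] {d : ℕ → Ω → X}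
  {H : ℕ → Ω → E → X}

namespace IsTangentRep

/-- Given `F k`, the map `Θ k ω` is deterministic. Truncations and selections that depend on the
past can therefore be applied to the sequence and to its decoupled version alike. -/
theorem transform (h : IsTangentRep P F ν d H) {Θ : ℕ → Ω → X → X}
    (hΘ : ∀ k, Measurable[(F k).prod mX] (Function.uncurry (Θ k))) :
    IsTangentRep P F ν (fun k ω => Θ k ω (d k ω)) (fun k ω e => Θ k ω (H k ω e)) where
  adapted k := (hΘ k).comp (@Measurable.prodMk _ (F (k + 1)) _ _ (F k) mX _ _
    (measurable_id'' (F.mono (Nat.le_succ k))) (h.adapted k))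
  measurable_uncurry k := (hΘ k).comp (@Measurable.prodMk _ ((F k).prod mE) _ _ (F k) mX _ _
    (@measurable_fst _ _ (F k) mE) (h.measurable_uncurry k))
  lintegral_eq k φ hφ := h.lintegral_eq k (fun y => φ (y.1, Θ k y.1 y.2))
    (hφ.comp (@Measurable.prodMk _ ((F k).prod mX) _ _ (F k) mX _ _
      (@measurable_fst _ _ (F k) mX) (hΘ k)))

/-- The tail of the maximum of a sequence is controlled by that of a decoupled tangent sequence. -/
theorem measure_exists_mem_le (h : IsTangentRep P F ν d H) {B : Set X} (hB : MeasurableSet B)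
    (n : ℕ) :
    P {ω | ∃ k < n, d k ω ∈ B} ≤
      4 * ∫⁻ ω, noiseMeasure ν {v | ∃ k < n, H k ω (v k) ∈ B} ∂P := by
  set r : ℕ → Ω → ℝ≥0∞ := fun k ω => ν (H k ω ⁻¹' B) with hr
  set s : ℕ → Ω → ℝ≥0∞ := fun k ω => ν (H k ω ⁻¹' Bᶜ) with hs
  set R : ℕ → Ω → ℝ≥0∞ := fun k ω => ∏ j ∈ Finset.range k, s j ω with hR
  set U : Ω → ℝ≥0∞ := fun ω => noiseMeasure ν {v | ∃ k < n, H k ω (v k) ∈ B} with hU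
  have hrs : ∀ k ω, r k ω + s k ω = 1 := fun k ω => by
    simp only [hr, hs, Set.preimage_compl]
    rw [measure_add_measure_compl (h.measurable_H_left k ω hB), measure_univ]
  have hs1 : ∀ k ω, s k ω ≤ 1 := fun k ω => prob_le_one
  have hRm : ∀ k, Measurable[F k] (R (k + 1)) := fun k =>
    Finset.measurable_fun_prod _ fun j hj => (h.measurable_prob j hB.compl).mono
      (F.mono (Nat.lt_succ_iff.1 (Finset.mem_range.1 hj))) le_rfl
  have hRanti : ∀ ω, Antitone fun k => R k ω := fun ω => antitone_nat_of_succ_le fun k => by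
    simp only [hR, Finset.prod_range_succ]
    exact mul_le_of_le_one_right' (hs1 k ω)
  have hR1 : ∀ k ω, R k ω ≤ 1 := fun k ω => by
    have := hRanti ω (Nat.zero_le k)
    simpa [hR] using this
  have hRU : ∀ ω, R n ω + U ω = 1 := by
    intro ω
    have h1 : R n ω = noiseMeasure ν
        ((↑(Finset.range n) : Set ℕ).pi fun k => H k ω ⁻¹' Bᶜ) :=
      (Measure.infinitePi_pi _ fun k _ => h.measurable_H_left k ω hB.compl).symm
    have h2 : {v | ∃ k < n, H k ω (v k) ∈ B} =
        ((↑(Finset.range n) : Set ℕ).pi fun k => H k ω ⁻¹' Bᶜ)ᶜ := by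
      ext v; simp
    simp only [hU]
    rw [h1, h2, measure_add_measure_compl, measure_univ]
    exact MeasurableSet.pi (Set.to_countable _) fun k _ => h.measurable_H_left k ω hB.compl
  -- `R k` is the conditional probability that the first k decoupled terms avoid `B`. As `R (k + 1)`
  -- uses only the laws of the terms up to k, the event `G k` is known at time k and tangency
  -- applies on it.
  set G : ℕ → Set Ω := fun k => {ω | 1 / 2 ≤ R (k + 1) ω} with hG
  have hGm : ∀ k, MeasurableSet[F k] (G k) := fun k => hRm k measurableSet_Ici
  -- Telescoping: `R` decreases by `R m * r m` at step m, which is at least half of `r m` on `G m`.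
  have hsum : ∀ m ω, (∑ k ∈ Finset.range m, (G k).indicator (r k) ω) + 2 * R m ω ≤ 2 := by
    intro m ω
    induction m with
    | zero => simp [hR]
    | succ m ih =>
      refine le_trans ?_ ih
      rw [Finset.sum_range_succ, add_assoc]
      gcongr
      have hsplit : 2 * R m ω = 2 * R m ω * r m ω + 2 * R (m + 1) ω := by
        simp only [hR, Finset.prod_range_succ]
        rw [← mul_assoc, ← mul_add, hrs, mul_one]
      rw [hsplit]
      gcongr
      by_cases hω : ω ∈ G m
      · rw [Set.indicator_of_mem hω]
        have h1 : 1 / 2 ≤ R m ω := le_trans hω (hRanti ω (Nat.le_succ m))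
        have h2 : 1 ≤ 2 * R m ω := by
          calc (1 : ℝ≥0∞) = 2 * (1 / 2) := by
                rw [one_div, ENNReal.mul_inv_cancel (by simp) (by simp)]
            _ ≤ _ := by gcongr
        exact le_mul_of_one_le_left' h2
      · rw [Set.indicator_of_notMem hω]; exact zero_le
  have hsumU : ∀ ω, ∑ k ∈ Finset.range n, (G k).indicator (r k) ω ≤ 2 * U ω := by
    intro ω
    have h1 : (∑ k ∈ Finset.range n, (G k).indicator (r k) ω) + 2 * R n ω ≤
        2 * U ω + 2 * R n ω := by
      have := hsum n ω
      rwa [← mul_add, add_comm (U ω), hRU, mul_one]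
    exact (ENNReal.add_le_add_iff_right (ENNReal.mul_ne_top (by simp)
      (ne_top_of_le_ne_top ENNReal.one_ne_top (hR1 n ω)))).1 h1
  have hUm : Measurable U := by
    have : U = fun ω => 1 - R n ω := by
      ext ω
      rw [← hRU ω]
      exact (ENNReal.add_sub_cancel_left
        (ne_top_of_le_ne_top ENNReal.one_ne_top (hR1 n ω))).symm
    rw [this]
    refine measurable_const.sub (Finset.measurable_fun_prod _ fun j _ => ?_)
    exact (h.measurable_prob j hB.compl).mono (F.le j) le_rfl
  -- If `R n` is at least one half, all `G k` with k < n hold; otherwise `2 * U ≥ 1` and Markov's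
  -- inequality applies. Each part costs 2.
  have hsub : {ω | ∃ k < n, d k ω ∈ B} ⊆ {ω | 1 ≤ 2 * U ω} ∪
      ⋃ k ∈ Finset.range n, (d k ⁻¹' B ∩ G k) := by
    rintro ω ⟨k, hk, hω⟩
    by_cases hc : 1 / 2 ≤ R n ω
    · refine Or.inr (Set.mem_iUnion₂.2 ⟨k, Finset.mem_range.2 hk, hω, ?_⟩)
      exact hc.trans (hRanti ω hk)
    · refine Or.inl ?_
      by_contra hcon
      rw [Set.mem_ofPred_eq, not_le] at hcon
      rw [not_le] at hc
      have h1 : U ω < 1 / 2 := by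
        rw [ENNReal.lt_div_iff_mul_lt (by simp) (by simp), mul_comm]; exact hcon
      have h2 := ENNReal.add_lt_add hc h1
      rw [hRU, ENNReal.add_halves] at h2
      exact lt_irrefl _ h2
  calc P {ω | ∃ k < n, d k ω ∈ B} ≤ _ := measure_mono hsub
    _ ≤ P {ω | 1 ≤ 2 * U ω} + P (⋃ k ∈ Finset.range n, (d k ⁻¹' B ∩ G k)) := measure_union_le _ _
    _ ≤ (∫⁻ ω, 2 * U ω ∂P) + ∑ k ∈ Finset.range n, P (d k ⁻¹' B ∩ G k) := by
        gcongr
        · have := mul_meas_ge_le_lintegral (μ := P) (hUm.const_mul 2) 1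
          simpa using this
        · exact measure_biUnion_finset_le _ _
    _ = (∫⁻ ω, 2 * U ω ∂P) + ∫⁻ ω, ∑ k ∈ Finset.range n, (G k).indicator (r k) ω ∂P := by
        congr 1
        rw [lintegral_finsetSum]
        · refine Finset.sum_congr rfl fun k _ => ?_
          rw [h.measure_inter k (hGm k) hB, lintegral_indicator (F.le k _ (hGm k))]
        · intro k _
          exact ((h.measurable_prob k hB).mono (F.le k) le_rfl).indicator (F.le k _ (hGm k))
    _ ≤ (∫⁻ ω, 2 * U ω ∂P) + ∫⁻ ω, 2 * U ω ∂P := by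
        gcongr with ω
        exact hsumU ω
    _ = 4 * ∫⁻ ω, U ω ∂P := by
        rw [lintegral_const_mul _ hUm, ← add_mul]
        norm_num

end IsTangentRep

end Transform

theorem exists_pos_rpow_mul_le {M : ℝ≥0∞} (hM : M ≠ ∞) {r c : ℝ} (hr : 0 < r) (hc : 0 < c) :
    ∃ κ : ℝ, 0 < κ ∧ κ ≤ c ∧ ENNReal.ofReal (κ ^ r) * M ≤ 1 / 2 := by
  set m : ℝ := (2 * (M.toReal + 1))⁻¹ with hm
  have hm0 : 0 < m := by positivity
  refine ⟨min c (m ^ (1 / r)), lt_min hc (by positivity), min_le_left _ _, ?_⟩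
  have h1 : (min c (m ^ (1 / r))) ^ r ≤ m := by
    calc (min c (m ^ (1 / r))) ^ r ≤ (m ^ (1 / r)) ^ r :=
          Real.rpow_le_rpow (le_min hc.le (by positivity)) (min_le_right _ _) hr.le
      _ = m := by rw [← Real.rpow_mul hm0.le, one_div, inv_mul_cancel₀ hr.ne', Real.rpow_one]
  calc _ ≤ ENNReal.ofReal m * ENNReal.ofReal M.toReal := by
        rw [ENNReal.ofReal_toReal hM]
        gcongr
    _ = ENNReal.ofReal (m * M.toReal) := (ENNReal.ofReal_mul hm0.le).symm
    _ ≤ ENNReal.ofReal (1 / 2) := by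
        refine ENNReal.ofReal_le_ofReal ?_
        rw [hm, inv_mul_le_iff₀ (by positivity)]
        linarith
    _ = 1 / 2 := by
        rw [ENNReal.ofReal_div_of_pos (by norm_num)]; simp

theorem ENNReal.add_rpow_le_two_rpow_mul {p : ℝ} (hp : 0 < p) (a b : ℝ≥0∞) :
    (a + b) ^ p ≤ 2 ^ p * (a ^ p + b ^ p) := by
  have h1 : a + b ≤ 2 * max a b := by
    rw [two_mul]; exact add_le_add (le_max_left _ _) (le_max_right _ _)
  calc (a + b) ^ p ≤ (2 * max a b) ^ p := ENNReal.rpow_le_rpow h1 hp.le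
    _ = 2 ^ p * max a b ^ p := ENNReal.mul_rpow_of_nonneg _ _ hp.le
    _ ≤ _ := by
        gcongr
        rcases le_total a b with h | h
        · rw [max_eq_right h]; exact le_add_self
        · rw [max_eq_left h]; exact le_self_add

/-! ### Conditional moments and maxima in the symmetric case -/

section Core

variable {X : Type u} [AddCommGroup X] [Module ℝ X] [QuasiNorm X] [QuasiBanachSpace X]
variable [mX : MeasurableSpace X] [BorelSpace X] [SecondCountableTopology X]
variable {Ω : Type w} {mΩ : MeasurableSpace Ω}
variable {E : Type} [mE : MeasurableSpace E] {P : Measure Ω} [IsProbabilityMeasure P]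
  {F : Filtration ℕ mΩ} {ν : Measure E} [IsProbabilityMeasure ν] {d : ℕ → Ω → X}
  {H : ℕ → Ω → E → X} {ι : E → E} {C : ℝ}

/-- The `p`-th moment of the decoupled sum, conditionally on `ω`. -/
noncomputable def condMoment (ν : Measure E) (H : ℕ → Ω → E → X) (p : ℝ) (n : ℕ) (ω : Ω) :
    ℝ≥0∞ :=
  ∫⁻ v, ENNReal.ofReal (qnorm (noiseSum (fun k => H k ω) n v)) ^ p ∂noiseMeasure ν

/-- Lévy's inequality integrated over levels. It lets the conditional moment of all n terms control
those of all shorter sums. -/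
theorem lintegral_qnorm_noiseSum_le_of_le {x : ℕ → E → X}
    (hC : ∀ x y : X, qnorm (x + y) ≤ C * (qnorm x + qnorm y)) (hC1 : 1 ≤ C)
    (hx : IsOddFamily ν ι x) {p : ℝ} (hp : 0 < p) {j n : ℕ} (hj : j ≤ n) :
    ∫⁻ v, ENNReal.ofReal (qnorm (noiseSum x j v)) ^ p ∂noiseMeasure ν ≤
      4 * ENNReal.ofReal (C ^ p) *
        ∫⁻ v, ENNReal.ofReal (qnorm (noiseSum x n v)) ^ p ∂noiseMeasure ν := by
  refine (lintegral_rpow_le_of_tail_le (ν := noiseMeasure ν)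
    (fun v => QuasiBanachSpace.qnorm_nonneg _) (measurable_qnorm_noiseSum hx.measurable j) (measurable_qnorm_noiseSum hx.measurable n) hp hC1
    (K := 2) (by simp) fun t ht => ?_).trans (le_of_eq ?_)
  · refine le_trans (measure_mono ?_) (measure_exists_lt_qnorm_noiseSum_le hC hC1 hx n ht.le)
    exact fun v hv => ⟨j, hj, hv⟩
  · congr 1
    rw [mul_right_comm]; norm_num

/-- A term is a difference of consecutive partial sums. If those are at most C t, the term is at
most C (C t + C t). -/
theorem measure_exists_lt_qnorm_term_le {x : ℕ → E → X}
    (hC : ∀ x y : X, qnorm (x + y) ≤ C * (qnorm x + qnorm y)) (hC1 : 1 ≤ C)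
    (hx : IsOddFamily ν ι x) (n : ℕ) {t : ℝ} (ht : 0 ≤ t) :
    noiseMeasure ν {v | ∃ k < n, 2 * C ^ 2 * t < qnorm (x k (v k))} ≤
      2 * noiseMeasure ν {v | t < qnorm (noiseSum x n v)} := by
  refine le_trans (measure_mono ?_) (measure_exists_lt_qnorm_noiseSum_le hC hC1 hx n ht)
  rintro v ⟨k, hk, h⟩
  by_contra hcon
  simp only [Set.mem_ofPred_eq, not_exists, not_and, not_lt] at hcon
  have h1 : x k (v k) = noiseSum x (k + 1) v + -noiseSum x k v := by
    simp [noiseSum, Finset.sum_range_succ]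
  have h2 := hC (noiseSum x (k + 1) v) (-noiseSum x k v)
  rw [← h1, QuasiBanachSpace.qnorm_neg] at h2
  nlinarith [hcon (k + 1) hk, hcon k hk.le]

namespace IsTangentRep

theorem isOddFamily (h : IsTangentRep P F ν d H) (hι : MeasurePreserving ι ν ν)
    (hodd : ∀ k ω e, H k ω (ι e) = -H k ω e) (ω : Ω) : IsOddFamily ν ι fun k => H k ω :=
  ⟨hι, fun k => h.measurable_H_left k ω, fun k e => hodd k ω e⟩

/-- The laws of the first k + 1 decoupled terms are known at time k, one step before `d k`.
Conditions on this moment are therefore predictable. -/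
theorem measurable_condMoment (h : IsTangentRep P F ν d H) (p : ℝ) (k : ℕ) :
    Measurable[F k] (condMoment ν H p (k + 1)) := by
  have hm : Measurable[(F k).prod MeasurableSpace.pi] fun z : Ω × (ℕ → E) =>
      ENNReal.ofReal (qnorm (noiseSum (fun j => H j z.1) (k + 1) z.2)) ^ p := by
    have hs : Measurable[(F k).prod MeasurableSpace.pi]
        fun z : Ω × (ℕ → E) => noiseSum (fun j => H j z.1) (k + 1) z.2 := by
      unfold noiseSum
      refine Finset.measurable_fun_sum _ fun j hj => ?_
      have hjk : j ≤ k := Nat.lt_succ_iff.1 (Finset.mem_range.1 hj)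
      exact h.measurable_comp_filtration j
        ((@measurable_fst _ _ (F k) MeasurableSpace.pi).mono le_rfl (F.mono hjk))
        ((measurable_pi_apply j).comp (@measurable_snd _ _ (F k) MeasurableSpace.pi))
    exact ((QuasiBanachSpace.measurable_qnorm.comp hs).ennreal_ofReal).pow_const p
  exact @Measurable.lintegral_prod_right' _ _ (F k) _ _ _ _ hm

theorem lintegral_condMoment (h : IsTangentRep P F ν d H) (p : ℝ) (n : ℕ) :
    ∫⁻ ω, condMoment ν H p n ω ∂P = ∫⁻ z, ENNReal.ofReal
      (qnorm (noiseSum (fun k => H k z.1) n z.2)) ^ p ∂P.prod (noiseMeasure ν) :=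
  (lintegral_prod _ (((QuasiBanachSpace.measurable_qnorm.comp
    (h.measurable_noiseSum n)).ennreal_ofReal).pow_const p).aemeasurable).symm

/-- Passing to the largest decoupled term costs 4, passing from it to the decoupled sum by Lévy
costs 2, and integrating the tails costs another 2. -/
theorem lintegral_runMax_rpow_le (h : IsTangentRep P F ν d H) (hι : MeasurePreserving ι ν ν)
    (hodd : ∀ k ω e, H k ω (ι e) = -H k ω e)
    (hC : ∀ x y : X, qnorm (x + y) ≤ C * (qnorm x + qnorm y)) (hC1 : 1 ≤ C) {p : ℝ} (hp : 0 < p)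
    (n : ℕ) :
    ∫⁻ ω, ENNReal.ofReal (runMax (fun j => qnorm (d j ω)) n) ^ p ∂P ≤
      16 * ENNReal.ofReal ((2 * C ^ 2) ^ p) * ∫⁻ ω, condMoment ν H p n ω ∂P := by
  have hb : 1 ≤ 2 * C ^ 2 := by nlinarith
  have hSm := QuasiBanachSpace.measurable_qnorm.comp (h.measurable_noiseSum n)
  rw [h.lintegral_condMoment]
  refine (lintegral_rpow_le_of_tail_le (ν := P.prod (noiseMeasure ν)) (K := 8)
    (Z := fun ω => runMax (fun j => qnorm (d j ω)) n)
    (W := fun z => qnorm (noiseSum (fun k => H k z.1) n z.2))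
    (fun ω => runMax_nonneg _ _) (measurable_runMax fun j _ =>
      QuasiBanachSpace.measurable_qnorm.comp (h.measurable_d j)) hSm hp hb (by simp)
    fun t ht => ?_).trans (le_of_eq ?_)
  · have hB : MeasurableSet {x : X | 2 * C ^ 2 * t < qnorm x} :=
      measurableSet_lt measurable_const QuasiBanachSpace.measurable_qnorm
    have h1 := h.measure_exists_mem_le hB n
    have h2 : {ω | 2 * C ^ 2 * t < runMax (fun j => qnorm (d j ω)) n} =
        {ω | ∃ k < n, d k ω ∈ {x : X | 2 * C ^ 2 * t < qnorm x}} := by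
      ext ω
      exact lt_runMax_iff (by positivity)
    have hms : MeasurableSet {z : Ω × (ℕ → E) | t < qnorm (noiseSum (fun k => H k z.1) n z.2)} :=
      measurableSet_lt measurable_const hSm
    rw [h2, Measure.prod_apply hms]
    refine h1.trans ?_
    calc 4 * ∫⁻ ω, noiseMeasure ν {v | ∃ k < n, H k ω (v k) ∈ {x : X | 2 * C ^ 2 * t < qnorm x}} ∂P
        ≤ 4 * ∫⁻ ω, 2 * noiseMeasure ν {v | t < qnorm (noiseSum (fun k => H k ω) n v)} ∂P := by
          gcongr with ω
          exact measure_exists_lt_qnorm_term_le hC hC1 (h.isOddFamily hι hodd ω) n ht.le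
      _ = 8 * ∫⁻ ω, noiseMeasure ν {v | t < qnorm (noiseSum (fun k => H k ω) n v)} ∂P := by
          rw [lintegral_const_mul' _ _ (by simp), ← mul_assoc]
          norm_num
      _ = _ := rfl
  · congr 1
    rw [mul_right_comm]; norm_num

end IsTangentRep

end Core

theorem lpQNorm_rpow {S : Type v} [MeasurableSpace S] {X : Type u} [QuasiNorm X] {p : ℝ}
    (hp : 0 < p) (μ : Measure S) (f : S → X) :
    lpQNorm p μ f ^ p = ∫⁻ s, ENNReal.ofReal (qnorm (f s)) ^ p ∂μ := by
  rw [lpQNorm, ← ENNReal.rpow_mul, one_div, inv_mul_cancel₀ hp.ne', ENNReal.rpow_one]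

theorem lpQNorm_lt_top_iff {S : Type v} [MeasurableSpace S] {X : Type u} [QuasiNorm X] {p : ℝ}
    (hp : 0 < p) (μ : Measure S) (f : S → X) :
    lpQNorm p μ f < ∞ ↔ ∫⁻ s, ENNReal.ofReal (qnorm (f s)) ^ p ∂μ < ∞ := by
  rw [lpQNorm, ENNReal.rpow_lt_top_iff_of_pos (by positivity)]

/-! ### The good-λ inequality -/

section GoodLambda

variable {X : Type u} [AddCommGroup X] [Module ℝ X] [QuasiNorm X] [QuasiBanachSpace X]
variable [mX : MeasurableSpace X] [BorelSpace X] [SecondCountableTopology X]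
variable {Ω : Type w} {mΩ : MeasurableSpace Ω}
variable {E : Type} [mE : MeasurableSpace E] {P : Measure Ω} [IsProbabilityMeasure P]
  {F : Filtration ℕ mΩ} {ν : Measure E} [IsProbabilityMeasure ν] {d : ℕ → Ω → X}
  {H : ℕ → Ω → E → X} {ι : E → E} {C : ℝ}

/-- Only the existence of some bound matters: it makes the moments of a transform with bounded terms
finite, so that decoupling applies to it. -/
theorem qnorm_sum_le_of_le (hC : ∀ x y : X, qnorm (x + y) ≤ C * (qnorm x + qnorm y))
    (hC0 : 0 ≤ C) (b : ℝ) (n : ℕ) :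
    ∃ B : ℝ, ∀ x : ℕ → X, (∀ k, qnorm (x k) ≤ b) → qnorm (∑ k ∈ Finset.range n, x k) ≤ B := by
  induction n with
  | zero => exact ⟨0, fun x _ => by simp [QuasiBanachSpace.qnorm_zero]⟩
  | succ n ih =>
    obtain ⟨B, hB⟩ := ih
    refine ⟨C * (B + b), fun x hx => ?_⟩
    rw [Finset.sum_range_succ]
    exact (hC _ _).trans (mul_le_mul_of_nonneg_left (add_le_add (hB x hx) (hx n)) hC0)

/-- The terms that are not much larger than all their predecessors. -/
noncomputable def smallPart (C : ℝ) (d : ℕ → Ω → X) (k : ℕ) (ω : Ω) : X :=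
  if qnorm (d k ω) ≤ 2 * C * runMax (fun j => qnorm (d j ω)) k then d k ω else 0

/-- The maximal function of the sum of the small parts. -/
noncomputable def smallMax (C : ℝ) (d : ℕ → Ω → X) (n : ℕ) (ω : Ω) : ℝ :=
  runMax (fun j => qnorm (∑ i ∈ Finset.range (j + 1), smallPart C d i ω)) n

namespace IsTangentRep

theorem measurable_runMax_qnorm (h : IsTangentRep P F ν d H) (k : ℕ) :
    Measurable[F k] fun ω => runMax (fun j => qnorm (d j ω)) k :=
  measurable_runMax fun j hj => QuasiBanachSpace.measurable_qnorm.comp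
    ((h.adapted j).mono (F.mono hj) le_rfl)

theorem measurable_smallPart (h : IsTangentRep P F ν d H) (k : ℕ) :
    Measurable[F (k + 1)] (smallPart C d k) := by
  refine Measurable.ite ?_ (h.adapted k) measurable_const
  exact measurableSet_le (QuasiBanachSpace.measurable_qnorm.comp (h.adapted k))
    (((h.measurable_runMax_qnorm k).mono (F.mono (Nat.le_succ k)) le_rfl).const_mul _)

theorem measurable_smallMax (h : IsTangentRep P F ν d H) (k : ℕ) :
    Measurable[F k] (smallMax C d k) := by
  refine measurable_runMax fun j hj => QuasiBanachSpace.measurable_qnorm.comp ?_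
  refine Finset.measurable_fun_sum _ fun i hi => ?_
  exact (h.measurable_smallPart i).mono
    (F.mono (by have := Finset.mem_range.1 hi; omega)) le_rfl

/-- The moment of the part of the decoupled sum that is selected by `M` and truncated at a multiple
of `a`, at a fixed `ω`. -/
theorem lintegral_masked_le {x : ℕ → E → X}
    (hC : ∀ x y : X, qnorm (x + y) ≤ C * (qnorm x + qnorm y)) (hC1 : 1 ≤ C)
    (hx : IsOddFamily ν ι x) {p p₀ κ δ lam : ℝ} (hp : 0 < p) (hp₀ : 0 < p₀) (hκ : 0 < κ)
    (hδ : 0 < δ) (hδκ : 2 * δ ≤ κ) (hlam : 0 < lam)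
    (hθ : ENNReal.ofReal ((C * (2 * C + 1) * C) ^ p₀) *
      (4 * (2 * ENNReal.ofReal ((δ / κ) ^ p))) ≤ 1 / 2)
    {M : ℕ → Prop} {a : ℕ → ℝ} (ha : ∀ k, M k → a k ≤ δ * lam)
    (hM : ∀ k, M k → ∫⁻ v, ENNReal.ofReal (qnorm (noiseSum x (k + 1) v)) ^ p ∂noiseMeasure ν ≤
      ENNReal.ofReal (δ * lam) ^ p) {n : ℕ} (hex : ∃ k < n, M k)
    {y : ℕ → E → X} (hy : ∀ k, y k = {e | M k ∧ qnorm (x k e) ≤ 2 * C * a k}.indicator (x k)) :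
    ∫⁻ v, ENNReal.ofReal (qnorm (noiseSum y n v)) ^ p₀ ∂noiseMeasure ν ≤
      2 * ENNReal.ofReal ((C * (2 * C + 1) * C) ^ p₀) * ENNReal.ofReal (C * (κ * lam)) ^ p₀ := by
  classical
  have hC0 : 0 ≤ C := zero_le_one.trans hC1
  set m : ℕ → Set E := fun k => {e | M k ∧ qnorm (x k e) ≤ 2 * C * a k} with hm
  obtain rfl : y = fun k => (m k).indicator (x k) := funext hy
  have hmm : ∀ k, MeasurableSet (m k) := by
    intro k
    by_cases hk : M k
    · simp only [hm, hk, true_and]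
      exact measurableSet_le (QuasiBanachSpace.measurable_qnorm.comp (hx.measurable k))
        measurable_const
    · simp [hm, hk]
  have hinv : ∀ k e, ι e ∈ m k ↔ e ∈ m k := fun k e => by
    simp only [hm, Set.mem_ofPred_eq, hx.odd, QuasiBanachSpace.qnorm_neg]
  have hyodd : IsOddFamily ν ι fun k => (m k).indicator (x k) := by
    refine ⟨hx.preserving, fun k => (hx.measurable k).indicator (hmm k), fun k e => ?_⟩
    by_cases he : e ∈ m k
    · rw [Set.indicator_of_mem ((hinv k e).2 he), Set.indicator_of_mem he, hx.odd]
    · rw [Set.indicator_of_notMem (fun h => he ((hinv k e).1 h)), Set.indicator_of_notMem he,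
        neg_zero]
  -- `N` is the last selected index. The masked sum stops there, and the moment bound of the sum of
  -- the first N + 1 terms is available because `N` is selected.
  obtain ⟨N, hNn, hMN, hNmax⟩ : ∃ N < n, M N ∧ ∀ k, N < k → k < n → ¬ M k := by
    have hne : ((Finset.range n).filter M).Nonempty := by
      obtain ⟨k, hk, hMk⟩ := hex
      exact ⟨k, by simp [hk, hMk]⟩
    have hmem := Finset.max'_mem _ hne
    simp only [Finset.mem_filter, Finset.mem_range] at hmem
    refine ⟨_, hmem.1, hmem.2, fun k hk hkn hMk => ?_⟩
    exact absurd (Finset.le_max' _ k (by simp [hkn, hMk])) (not_le.2 hk)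
  have hsum : ∀ v, noiseSum (fun k => (m k).indicator (x k)) n v =
      noiseSum (fun k => (m k).indicator (x k)) (N + 1) v := by
    intro v
    refine (Finset.sum_subset (Finset.range_subset_range.2 hNn) fun k hk hk' => ?_).symm
    rw [Finset.mem_range] at hk hk'
    refine Set.indicator_of_notMem (fun h => ?_) _
    exact hNmax k (by omega) hk h.1
  simp only [hsum]
  have hκl : 0 < κ * lam := mul_pos hκ hlam
  refine lintegral_qnorm_noiseSum_rpow_le hC hC1 hyodd (t := C * (κ * lam)) (n := N + 1)
    (fun k e => ?_) hp₀ hθ ?_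
  · by_cases he : e ∈ m k
    · simp only [Set.indicator_of_mem he]
      refine he.2.trans ?_
      have h1 := ha k he.1
      have h2 : 2 * C * a k ≤ 2 * C * (δ * lam) := by gcongr
      have h3 : 2 * C * (δ * lam) ≤ C * (κ * lam) := by
        have := mul_le_mul_of_nonneg_left (mul_le_mul_of_nonneg_right hδκ hlam.le) hC0
        linarith
      have h4 : C * (κ * lam) ≤ C * (C * (κ * lam)) := by
        refine mul_le_mul_of_nonneg_left ?_ hC0
        nlinarith
      linarith
    · simp only [Set.indicator_of_notMem he, QuasiBanachSpace.qnorm_zero]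
      positivity
  -- The mask costs the factor 2, and Chebyshev with the p-th moment (δ lam)^p gives (δ / κ)^p for
  -- the unmasked sum. This is where the exponent p enters a bound on a p₀-th moment.
  · refine (measure_lt_qnorm_mask_le hC hC1 hx hmm hinv (N + 1) (κ * lam)).trans ?_
    refine mul_le_mul' le_rfl ?_
    have hmeas : Measurable fun v => ENNReal.ofReal (qnorm (noiseSum x (N + 1) v)) ^ p :=
      ((measurable_qnorm_noiseSum hx.measurable (N + 1)).ennreal_ofReal).pow_const p
    have hmk := mul_meas_ge_le_lintegral (μ := noiseMeasure ν) hmeas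
      (ENNReal.ofReal (κ * lam) ^ p)
    have h1 : ENNReal.ofReal (κ * lam) ^ p *
        noiseMeasure ν {v | κ * lam < qnorm (noiseSum x (N + 1) v)} ≤
        ENNReal.ofReal (δ * lam) ^ p := by
      refine le_trans ?_ (hmk.trans (hM N hMN))
      refine mul_le_mul' le_rfl (measure_mono fun v hv => ?_)
      exact ENNReal.rpow_le_rpow (ENNReal.ofReal_le_ofReal (le_of_lt hv)) hp.le
    have h2 : ENNReal.ofReal (δ * lam) ^ p =
        ENNReal.ofReal (κ * lam) ^ p * ENNReal.ofReal ((δ / κ) ^ p) := by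
      rw [ENNReal.ofReal_rpow_of_nonneg (by positivity) hp.le,
        ENNReal.ofReal_rpow_of_nonneg (by positivity) hp.le, ← ENNReal.ofReal_mul (by positivity),
        ← Real.mul_rpow (by positivity) (by positivity)]
      congr 2
      field_simp
    rw [h2] at h1
    refine (ENNReal.mul_le_mul_iff_right ?_ ?_).1 h1
    · simp [ENNReal.rpow_eq_zero_iff, hκl]
    · exact ENNReal.rpow_ne_top_of_nonneg hp.le ENNReal.ofReal_ne_top

/-- The predictable control of the good-`λ` inequality. -/
noncomputable def control (ν : Measure E) (d : ℕ → Ω → X) (H : ℕ → Ω → E → X) (C p δ : ℝ) (n : ℕ)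
    (ω : Ω) : ℝ≥0∞ :=
  ENNReal.ofReal δ⁻¹ * max ((4 * ENNReal.ofReal (C ^ p) * condMoment ν H p n ω) ^ (1 / p))
    (ENNReal.ofReal (runMax (fun j => qnorm (d j ω)) n))

/-- The small terms are kept only while the maximal function lies between λ and βλ and the control
quantities are at most δλ. If the maximal function exceeds βλ and the control does not exceed λ, the
sum of the kept terms exceeds λ. Its p₀-th moment is bounded by decoupling, with a factor (Cκλ)^p₀
on {maximal function > λ} only, so Chebyshev leaves a small multiple of the probability of that
event. -/
theorem measure_smallMax_le (h : IsTangentRep P F ν d H) (hι : MeasurePreserving ι ν ν)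
    (hodd : ∀ k ω e, H k ω (ι e) = -H k ω e)
    (hC : ∀ x y : X, qnorm (x + y) ≤ C * (qnorm x + qnorm y)) (hC1 : 1 ≤ C)
    {p p₀ κ δ lam : ℝ} (hp : 0 < p) (hp₀ : 0 < p₀) (hκ : 0 < κ)
    (hδ : 0 < δ) (hδκ : 2 * δ ≤ κ) (hδC : 2 * C * δ ≤ 1) (hlam : 0 < lam)
    (hθ : ENNReal.ofReal ((C * (2 * C + 1) * C) ^ p₀) *
      (4 * (2 * ENNReal.ofReal ((δ / κ) ^ p))) ≤ 1 / 2)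
    {D : ℝ≥0} (hD : DecouplingWith.{u, w} X p₀ D) (hF : F 0 = ⊥) (n : ℕ) :
    P {ω | (2 * C ^ 2 + C) * lam < smallMax C d n ω} ≤
      (D : ℝ≥0∞) ^ p₀ * (2 * ENNReal.ofReal ((C * (2 * C + 1) * C) ^ p₀) *
        ENNReal.ofReal ((C * κ) ^ p₀)) * P {ω | lam < smallMax C d n ω} +
      P {ω | ENNReal.ofReal lam < control ν d H C p δ n ω} := by
  classical
  have hC0 : 0 ≤ C := zero_le_one.trans hC1
  set β := 2 * C ^ 2 + C with hβ
  set dm : ℕ → Ω → ℝ := fun k ω => runMax (fun j => qnorm (d j ω)) k with hdm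
  set M : ℕ → Ω → Prop := fun k ω => (lam < smallMax C d k ω ∧ smallMax C d k ω ≤ β * lam) ∧
    condMoment ν H p (k + 1) ω ≤ ENNReal.ofReal (δ * lam) ^ p ∧ dm k ω ≤ δ * lam with hM
  have hMm : ∀ k, MeasurableSet[F k] {ω | M k ω} := fun k =>
    ((h.measurable_smallMax k measurableSet_Ioi).inter
      (h.measurable_smallMax k measurableSet_Iic)).inter
      ((h.measurable_condMoment p k measurableSet_Iic).inter
        (h.measurable_runMax_qnorm k measurableSet_Iic))
  -- Selection, truncation and passage to the small part form one predictable transform. Its terms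
  -- are at most 2C δ lam ≤ lam.
  set Θ : ℕ → Ω → X → X := fun k ω x => if M k ω ∧ qnorm x ≤ 2 * C * dm k ω then x else 0 with hΘ
  have hΘm : ∀ k, Measurable[(F k).prod mX] (Function.uncurry (Θ k)) := by
    intro k
    have hfst : Measurable[(F k).prod mX, F k] (Prod.fst : Ω × X → Ω) :=
      @measurable_fst _ _ (F k) mX
    have hsnd : Measurable[(F k).prod mX, mX] (Prod.snd : Ω × X → X) :=
      @measurable_snd _ _ (F k) mX
    refine Measurable.ite ?_ hsnd measurable_const
    exact (hfst (hMm k)).inter (measurableSet_le (QuasiBanachSpace.measurable_qnorm.comp hsnd)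
      (((h.measurable_runMax_qnorm k).comp hfst).const_mul _))
  have hT := h.transform hΘm
  have hΘb : ∀ k ω x, qnorm (Θ k ω x) ≤ lam := by
    intro k ω x
    simp only [hΘ]
    split_ifs with hc
    · have h1 : 2 * C * dm k ω ≤ 2 * C * (δ * lam) := by
        have := hc.1.2.2
        gcongr
      have h2 : 2 * C * (δ * lam) ≤ lam := by nlinarith
      linarith [hc.2]
    · rw [QuasiBanachSpace.qnorm_zero]; exact hlam.le
  set f : ℕ → Ω → X := fun n ω => ∑ k ∈ Finset.range n, Θ k ω (d k ω) with hf
  have hfm : ∀ n, Measurable (f n) := fun n =>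
    Finset.measurable_fun_sum _ fun k _ => hT.measurable_d k
  have hfin : ∀ n, lpQNorm p₀ P (f n) < ∞ := by
    intro n
    obtain ⟨B, hB⟩ := qnorm_sum_le_of_le hC hC0 lam n
    rw [lpQNorm_lt_top_iff hp₀]
    refine lt_of_le_of_lt (lintegral_mono (g := fun _ => ENNReal.ofReal B ^ p₀) fun ω => ?_) ?_
    · exact ENNReal.rpow_le_rpow (ENNReal.ofReal_le_ofReal (hB _ fun k => hΘb k ω _)) hp₀.le
    · rw [lintegral_const, measure_univ, mul_one]
      exact ENNReal.rpow_lt_top_of_nonneg hp₀.le ENNReal.ofReal_ne_top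
  set c : ℝ≥0∞ := 2 * ENNReal.ofReal ((C * (2 * C + 1) * C) ^ p₀) with hc
  -- The decoupled sum at ω vanishes unless some index is selected at ω, and a selected index forces
  -- the maximal function above `lam`. This localizes the estimate.
  have hdec : ∫⁻ ω, ENNReal.ofReal (qnorm (f n ω)) ^ p₀ ∂P ≤ (D : ℝ≥0∞) ^ p₀ *
      (c * ENNReal.ofReal (C * (κ * lam)) ^ p₀ * P {ω | lam < smallMax C d n ω}) := by
    have h1 := ENNReal.rpow_le_rpow (hT.lpQNorm_le hD hF hfin n) hp₀.le
    rw [ENNReal.mul_rpow_of_nonneg _ _ hp₀.le, lpQNorm_rpow hp₀, lpQNorm_rpow hp₀,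
      ← hT.lintegral_condMoment] at h1
    refine h1.trans (mul_le_mul' le_rfl ?_)
    have hms : MeasurableSet {ω | lam < smallMax C d n ω} :=
      F.le n _ (h.measurable_smallMax n measurableSet_Ioi)
    rw [← setLIntegral_const, ← lintegral_indicator hms]
    refine lintegral_mono fun ω => ?_
    by_cases hex : ∃ k < n, M k ω
    · have hω : ω ∈ {ω | lam < smallMax C d n ω} := by
        obtain ⟨k, hk, hMk⟩ := hex
        exact lt_of_lt_of_le hMk.1.1 (runMax_mono _ hk.le)
      rw [Set.indicator_of_mem hω]
      exact lintegral_masked_le hC hC1 (h.isOddFamily hι hodd ω) hp hp₀ hκ hδ hδκ hlam hθ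
        (M := fun k => M k ω) (a := fun k => dm k ω) (fun k hk => hk.2.2) (fun k hk => hk.2.1)
        hex (fun k => by ext e; simp [hΘ, Set.indicator_apply])
    · have hz : ∀ v, noiseSum (fun k e => Θ k ω (H k ω e)) n v = 0 := fun v =>
        Finset.sum_eq_zero fun k hk => if_neg fun hcon =>
          hex ⟨k, Finset.mem_range.1 hk, hcon.1⟩
      simp only [condMoment, hz, QuasiBanachSpace.qnorm_zero, ENNReal.ofReal_zero,
        ENNReal.zero_rpow_of_pos hp₀, lintegral_zero]
      exact zero_le
  have htail : P {ω | lam < qnorm (f n ω)} ≤ (D : ℝ≥0∞) ^ p₀ * (c *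
      ENNReal.ofReal ((C * κ) ^ p₀)) * P {ω | lam < smallMax C d n ω} := by
    have hmeas : Measurable fun ω => ENNReal.ofReal (qnorm (f n ω)) ^ p₀ :=
      ((QuasiBanachSpace.measurable_qnorm.comp (hfm n)).ennreal_ofReal).pow_const p₀
    have hmk := mul_meas_ge_le_lintegral (μ := P) hmeas (ENNReal.ofReal lam ^ p₀)
    have h1 : ENNReal.ofReal lam ^ p₀ * P {ω | lam < qnorm (f n ω)} ≤
        ENNReal.ofReal lam ^ p₀ * ((D : ℝ≥0∞) ^ p₀ * (c *
          ENNReal.ofReal ((C * κ) ^ p₀)) * P {ω | lam < smallMax C d n ω}) := by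
      calc _ ≤ ENNReal.ofReal lam ^ p₀ * P {ω | ENNReal.ofReal lam ^ p₀ ≤
              ENNReal.ofReal (qnorm (f n ω)) ^ p₀} := by
            refine mul_le_mul' le_rfl (measure_mono fun ω hω => ?_)
            exact ENNReal.rpow_le_rpow (ENNReal.ofReal_le_ofReal (le_of_lt hω)) hp₀.le
        _ ≤ _ := hmk.trans hdec
        _ = _ := by
            have : ENNReal.ofReal (C * (κ * lam)) ^ p₀ =
                ENNReal.ofReal lam ^ p₀ * ENNReal.ofReal ((C * κ) ^ p₀) := by
              rw [← ENNReal.ofReal_rpow_of_nonneg (by positivity) hp₀.le,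
                ← ENNReal.mul_rpow_of_nonneg _ _ hp₀.le, ← ENNReal.ofReal_mul hlam.le]
              congr 2
              ring
            rw [this]; ring
    refine (ENNReal.mul_le_mul_iff_right ?_ ?_).1 h1
    · simp [ENNReal.rpow_eq_zero_iff, hlam]
    · exact ENNReal.rpow_ne_top_of_nonneg hp₀.le ENNReal.ofReal_ne_top
  have hsub : {ω | β * lam < smallMax C d n ω} ⊆ {ω | lam < qnorm (f n ω)} ∪
      {ω | ENNReal.ofReal lam < control ν d H C p δ n ω} := by
    intro ω hω
    by_cases hctl : ENNReal.ofReal lam < control ν d H C p δ n ω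
    · exact Or.inr hctl
    · refine Or.inl ?_
      rw [not_lt] at hctl
      have hcancel : ∀ y : ℝ≥0∞, ENNReal.ofReal δ⁻¹ * y ≤ ENNReal.ofReal lam →
          y ≤ ENNReal.ofReal (δ * lam) := by
        intro y hy
        calc y = ENNReal.ofReal δ * (ENNReal.ofReal δ⁻¹ * y) := by
              rw [← mul_assoc, ← ENNReal.ofReal_mul hδ.le, mul_inv_cancel₀ hδ.ne',
                ENNReal.ofReal_one, one_mul]
          _ ≤ ENNReal.ofReal δ * ENNReal.ofReal lam := by gcongr
          _ = _ := (ENNReal.ofReal_mul hδ.le).symm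
      have hmax := hcancel _ hctl
      have hcm : ∀ k < n, condMoment ν H p (k + 1) ω ≤ ENNReal.ofReal (δ * lam) ^ p := by
        intro k hk
        have h1 := lintegral_qnorm_noiseSum_le_of_le hC hC1 (h.isOddFamily hι hodd ω) hp hk
        have h2 := ENNReal.rpow_le_rpow ((le_max_left _ _).trans hmax) hp.le
        rw [← ENNReal.rpow_mul, one_div, inv_mul_cancel₀ hp.ne', ENNReal.rpow_one] at h2
        exact h1.trans h2
      have hdmk : ∀ k < n, dm k ω ≤ δ * lam := by
        intro k hk
        have h2 := (le_max_right _ _).trans hmax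
        rw [ENNReal.ofReal_le_ofReal_iff (by positivity)] at h2
        exact (runMax_mono _ hk.le).trans h2
      have hsmall : ∀ k < n, qnorm (smallPart C d k ω) ≤ lam := by
        intro k hk
        unfold smallPart
        split_ifs with hc
        · have h1 : 2 * C * dm k ω ≤ 2 * C * (δ * lam) := by
            have := hdmk k hk
            gcongr
          have h2 : 2 * C * (δ * lam) ≤ lam := by nlinarith
          exact (hc.trans h1).trans h2
        · rw [QuasiBanachSpace.qnorm_zero]; exact hlam.le
      have key := lt_qnorm_sum_upcrossing hC hC1 hlam hsmall (fun k => smallMax C d k ω) rfl hω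
      have hfe : f n ω = ∑ k ∈ Finset.range n, if lam < smallMax C d k ω ∧
          smallMax C d k ω ≤ β * lam then smallPart C d k ω else 0 := by
        refine Finset.sum_congr rfl fun k hk => ?_
        have hk' := Finset.mem_range.1 hk
        simp only [hΘ, hM, hcm k hk', hdmk k hk', and_true, smallPart]
        by_cases h1 : lam < smallMax C d k ω ∧ smallMax C d k ω ≤ β * lam <;> simp [h1, hdm]
      rw [Set.mem_ofPred_eq, hfe]
      exact key
  refine (measure_mono hsub).trans ((measure_union_le _ _).trans ?_)
  gcongr

end IsTangentRep

end GoodLambda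

/-! ### Choice of parameters and extrapolation of the exponent -/

theorem exists_goodLambda_parameters {C p p₀ : ℝ} (hC1 : 1 ≤ C) (hp : 0 < p) (hp₀ : 0 < p₀)
    (D : ℝ≥0) :
    ∃ κ δ : ℝ, 0 < κ ∧ 0 < δ ∧ 2 * δ ≤ κ ∧ 2 * C * δ ≤ 1 ∧
      ENNReal.ofReal ((C * (2 * C + 1) * C) ^ p₀) * (4 * (2 * ENNReal.ofReal ((δ / κ) ^ p))) ≤
        1 / 2 ∧
      ENNReal.ofReal ((2 * C ^ 2 + C) ^ p) * ((D : ℝ≥0∞) ^ p₀ *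
        (2 * ENNReal.ofReal ((C * (2 * C + 1) * C) ^ p₀) * ENNReal.ofReal ((C * κ) ^ p₀))) ≤
        1 / 2 := by
  have hC0 : 0 < C := one_pos.trans_le hC1
  have hDtop : (D : ℝ≥0∞) ^ p₀ ≠ ∞ := ENNReal.rpow_ne_top_of_nonneg hp₀.le ENNReal.coe_ne_top
  -- First κ, depending on `D`, makes the good-λ coefficient small enough to absorb; then the ratio
  -- η = δ / κ makes the Hoffmann-Jørgensen quantile small.
  obtain ⟨κ, hκ, -, hκM⟩ := exists_pos_rpow_mul_le (M := ENNReal.ofReal ((2 * C ^ 2 + C) ^ p) *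
    ((D : ℝ≥0∞) ^ p₀ * (2 * ENNReal.ofReal ((C * (2 * C + 1) * C) ^ p₀) *
      ENNReal.ofReal (C ^ p₀)))) (by finiteness) hp₀ one_pos
  obtain ⟨η, hη, hηc, hηM⟩ := exists_pos_rpow_mul_le
    (M := ENNReal.ofReal ((C * (2 * C + 1) * C) ^ p₀) * 8) (by finiteness) hp
    (c := min (1 / 2) (1 / (2 * C * κ))) (by positivity)
  refine ⟨κ, η * κ, hκ, by positivity, ?_, ?_, ?_, ?_⟩
  · have := hηc.trans (min_le_left _ _)
    nlinarith
  · have := hηc.trans (min_le_right _ _)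
    rw [le_div_iff₀ (by positivity)] at this
    linarith
  · rw [mul_div_cancel_right₀ _ hκ.ne']
    refine le_trans (le_of_eq ?_) hηM
    rw [← mul_assoc 4 2, mul_comm (4 * 2 : ℝ≥0∞), ← mul_assoc, mul_comm _ (ENNReal.ofReal (η ^ p)),
      mul_assoc]
    norm_num
  · refine le_trans (le_of_eq ?_) hκM
    rw [Real.mul_rpow hC0.le hκ.le, ENNReal.ofReal_mul (by positivity)]
    ring

/-- The constant in the decoupling inequality for conditionally symmetric sequences. -/
noncomputable def symmetricConst (C p δ : ℝ) : ℝ≥0∞ :=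
  ENNReal.ofReal C ^ p * (2 ^ p * (2 * ENNReal.ofReal ((2 * C ^ 2 + C) ^ p) *
    (ENNReal.ofReal δ⁻¹ ^ p * (4 * ENNReal.ofReal (C ^ p) + 16 * ENNReal.ofReal ((2 * C ^ 2) ^ p))) +
    ENNReal.ofReal (2 * C) ^ p * (16 * ENNReal.ofReal ((2 * C ^ 2) ^ p))))

/-- The constant in the decoupling inequality that is obtained by symmetrization. -/
noncomputable def extrapolationConst (C p δ : ℝ) : ℝ≥0∞ :=
  ENNReal.ofReal C ^ p * (2 ^ p *
    (symmetricConst C p δ * (ENNReal.ofReal C ^ p * (2 ^ p * 2)) + 1))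

theorem extrapolationConst_ne_top {C p δ : ℝ} (hp : 0 < p) : extrapolationConst C p δ ≠ ∞ := by
  have h1 : ∀ a : ℝ, ENNReal.ofReal a ^ p ≠ ∞ := fun a =>
    ENNReal.rpow_ne_top_of_nonneg hp.le ENNReal.ofReal_ne_top
  have h2 : (2 : ℝ≥0∞) ^ p ≠ ∞ := ENNReal.rpow_ne_top_of_nonneg hp.le (by simp)
  have h3 : symmetricConst C p δ ≠ ∞ := by
    unfold symmetricConst
    have := h1 C
    have := h1 δ⁻¹
    have := h1 (2 * C)
    finiteness
  unfold extrapolationConst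
  have := h1 C
  finiteness

section Extrapolation

variable {X : Type u} [AddCommGroup X] [Module ℝ X] [QuasiNorm X] [QuasiBanachSpace X] {C : ℝ}

theorem ofReal_qnorm_add_rpow_le (hC : ∀ x y : X, qnorm (x + y) ≤ C * (qnorm x + qnorm y))
    (hC1 : 1 ≤ C) {p : ℝ} (hp : 0 < p) (x y : X) :
    ENNReal.ofReal (qnorm (x + y)) ^ p ≤ ENNReal.ofReal C ^ p *
      (2 ^ p * (ENNReal.ofReal (qnorm x) ^ p + ENNReal.ofReal (qnorm y) ^ p)) := by
  calc ENNReal.ofReal (qnorm (x + y)) ^ p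
      ≤ (ENNReal.ofReal C * (ENNReal.ofReal (qnorm x) + ENNReal.ofReal (qnorm y))) ^ p := by
        refine ENNReal.rpow_le_rpow ?_ hp.le
        rw [← ENNReal.ofReal_add (QuasiBanachSpace.qnorm_nonneg _)
          (QuasiBanachSpace.qnorm_nonneg _), ← ENNReal.ofReal_mul (zero_le_one.trans hC1)]
        exact ENNReal.ofReal_le_ofReal (hC _ _)
    _ = ENNReal.ofReal C ^ p * (ENNReal.ofReal (qnorm x) + ENNReal.ofReal (qnorm y)) ^ p :=
        ENNReal.mul_rpow_of_nonneg _ _ hp.le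
    _ ≤ _ := by gcongr; exact ENNReal.add_rpow_le_two_rpow_mul hp _ _

variable [mX : MeasurableSpace X] [BorelSpace X] [SecondCountableTopology X]
variable {Ω : Type w} {mΩ : MeasurableSpace Ω}
variable {E : Type} [mE : MeasurableSpace E] {P : Measure Ω} [IsProbabilityMeasure P]
  {F : Filtration ℕ mΩ} {ν : Measure E} [IsProbabilityMeasure ν] {d : ℕ → Ω → X}
  {H : ℕ → Ω → E → X} {ι : E → E}

/-- Davis' decomposition: small terms are handled by the good-λ inequality, and the sum of large
ones is dominated by the largest term. -/
theorem qnorm_sum_le_smallMax_add (hC : ∀ x y : X, qnorm (x + y) ≤ C * (qnorm x + qnorm y))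
    (hC1 : 1 ≤ C) (d : ℕ → Ω → X) (n : ℕ) (ω : Ω) :
    qnorm (∑ k ∈ Finset.range n, d k ω) ≤
      C * (smallMax C d n ω + 2 * C * runMax (fun j => qnorm (d j ω)) n) := by
  have hsplit : ∑ k ∈ Finset.range n, d k ω = ∑ k ∈ Finset.range n, smallPart C d k ω +
      ∑ k ∈ Finset.range n,
        if qnorm (d k ω) ≤ 2 * C * runMax (fun j => qnorm (d j ω)) k then 0 else d k ω := by
    rw [← Finset.sum_add_distrib]
    refine Finset.sum_congr rfl fun k _ => ?_
    unfold smallPart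
    split_ifs <;> simp
  have h1 : qnorm (∑ k ∈ Finset.range n, smallPart C d k ω) ≤ smallMax C d n ω := by
    cases n with
    | zero => simp [QuasiBanachSpace.qnorm_zero, smallMax, runMax]
    | succ n =>
      exact le_runMax (fun j => qnorm (∑ i ∈ Finset.range (j + 1), smallPart C d i ω))
        n.lt_succ_self
  rw [hsplit]
  refine (hC _ _).trans (mul_le_mul_of_nonneg_left (add_le_add h1 ?_) (zero_le_one.trans hC1))
  exact qnorm_sum_large_le hC hC1 (fun k => d k ω) n

namespace IsTangentRep

theorem lintegral_le_of_symmetric (h : IsTangentRep P F ν d H) (hι : MeasurePreserving ι ν ν)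
    (hodd : ∀ k ω e, H k ω (ι e) = -H k ω e)
    (hC : ∀ x y : X, qnorm (x + y) ≤ C * (qnorm x + qnorm y)) (hC1 : 1 ≤ C)
    {p p₀ κ δ : ℝ} (hp : 0 < p) (hp₀ : 0 < p₀) (hκ : 0 < κ)
    (hδ : 0 < δ) (hδκ : 2 * δ ≤ κ) (hδC : 2 * C * δ ≤ 1) {D : ℝ≥0}
    (hθ : ENNReal.ofReal ((C * (2 * C + 1) * C) ^ p₀) *
      (4 * (2 * ENNReal.ofReal ((δ / κ) ^ p))) ≤ 1 / 2)
    (hε : ENNReal.ofReal ((2 * C ^ 2 + C) ^ p) * ((D : ℝ≥0∞) ^ p₀ *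
      (2 * ENNReal.ofReal ((C * (2 * C + 1) * C) ^ p₀) * ENNReal.ofReal ((C * κ) ^ p₀))) ≤ 1 / 2)
    (hD : DecouplingWith.{u, w} X p₀ D) (hF : F 0 = ⊥) (n : ℕ) :
    ∫⁻ ω, ENNReal.ofReal (qnorm (∑ k ∈ Finset.range n, d k ω)) ^ p ∂P ≤
      symmetricConst C p δ * ∫⁻ ω, condMoment ν H p n ω ∂P := by
  set I := ∫⁻ ω, condMoment ν H p n ω ∂P with hI
  set dm : Ω → ℝ := fun ω => runMax (fun j => qnorm (d j ω)) n with hdm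
  have hC0 : 0 ≤ C := zero_le_one.trans hC1
  have hdmm : Measurable dm := (h.measurable_runMax_qnorm n).mono (F.le n) le_rfl
  have hsmm : Measurable (smallMax C d n) := (h.measurable_smallMax n).mono (F.le n) le_rfl
  have hcmm : Measurable (condMoment ν H p n) := by
    have hm : Measurable fun z : Ω × (ℕ → E) =>
        ENNReal.ofReal (qnorm (noiseSum (fun j => H j z.1) n z.2)) ^ p :=
      ((QuasiBanachSpace.measurable_qnorm.comp (h.measurable_noiseSum n)).ennreal_ofReal).pow_const p
    exact hm.lintegral_prod_right'
  have hctm : Measurable (control ν d H C p δ n) :=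
    (((hcmm.const_mul _).pow_const _).max hdmm.ennreal_ofReal).const_mul _
  have hdI : ∫⁻ ω, ENNReal.ofReal (dm ω) ^ p ∂P ≤ 16 * ENNReal.ofReal ((2 * C ^ 2) ^ p) * I :=
    h.lintegral_runMax_rpow_le hι hodd hC hC1 hp n
  have hctl : ∫⁻ ω, control ν d H C p δ n ω ^ p ∂P ≤ ENNReal.ofReal δ⁻¹ ^ p *
      ((4 * ENNReal.ofReal (C ^ p) + 16 * ENNReal.ofReal ((2 * C ^ 2) ^ p)) * I) := by
    calc ∫⁻ ω, control ν d H C p δ n ω ^ p ∂P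
        ≤ ∫⁻ ω, ENNReal.ofReal δ⁻¹ ^ p * (4 * ENNReal.ofReal (C ^ p) * condMoment ν H p n ω +
            ENNReal.ofReal (dm ω) ^ p) ∂P := by
          refine lintegral_mono fun ω => ?_
          rw [control, ENNReal.mul_rpow_of_nonneg _ _ hp.le]
          gcongr
          rcases le_total ((4 * ENNReal.ofReal (C ^ p) * condMoment ν H p n ω) ^ (1 / p))
            (ENNReal.ofReal (dm ω)) with hle | hle
          · rw [max_eq_right hle]; exact le_add_self
          · rw [max_eq_left hle, ← ENNReal.rpow_mul, one_div, inv_mul_cancel₀ hp.ne',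
              ENNReal.rpow_one]
            exact le_self_add
      _ = ENNReal.ofReal δ⁻¹ ^ p * (4 * ENNReal.ofReal (C ^ p) * I +
            ∫⁻ ω, ENNReal.ofReal (dm ω) ^ p ∂P) := by
          rw [lintegral_const_mul' _ _ (ENNReal.rpow_ne_top_of_nonneg hp.le ENNReal.ofReal_ne_top),
            lintegral_add_left (hcmm.const_mul _), lintegral_const_mul _ hcmm]
      _ ≤ _ := by
          rw [add_mul]
          gcongr
  have hβ : 1 ≤ 2 * C ^ 2 + C := by nlinarith
  have hsm := lintegral_rpow_le_of_tail (μ := P) (ν := P) (Z := smallMax C d n)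
    (W := control ν d H C p δ n) (fun ω => runMax_nonneg _ _) hsmm hctm hp hβ hε one_ne_zero
    fun t ht => by
      rw [one_mul]
      exact h.measure_smallMax_le hι hodd hC hC1 hp hp₀ hκ hδ hδκ hδC ht hθ hD hF n
  rw [mul_one] at hsm
  calc ∫⁻ ω, ENNReal.ofReal (qnorm (∑ k ∈ Finset.range n, d k ω)) ^ p ∂P
      ≤ ∫⁻ ω, ENNReal.ofReal C ^ p * (2 ^ p * (ENNReal.ofReal (smallMax C d n ω) ^ p +
          ENNReal.ofReal (2 * C) ^ p * ENNReal.ofReal (dm ω) ^ p)) ∂P := by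
        refine lintegral_mono fun ω => ?_
        have h1 := ENNReal.ofReal_le_ofReal (qnorm_sum_le_smallMax_add hC hC1 d n ω)
        have h0 : 0 ≤ smallMax C d n ω := runMax_nonneg _ _
        have h0' : 0 ≤ dm ω := runMax_nonneg _ _
        rw [ENNReal.ofReal_mul hC0, ENNReal.ofReal_add h0 (by positivity),
          ENNReal.ofReal_mul (by positivity)] at h1
        refine (ENNReal.rpow_le_rpow h1 hp.le).trans ?_
        rw [ENNReal.mul_rpow_of_nonneg _ _ hp.le, 
          ← ENNReal.mul_rpow_of_nonneg (ENNReal.ofReal (2 * C)) _ hp.le]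
        gcongr
        exact ENNReal.add_rpow_le_two_rpow_mul hp _ _
    _ = ENNReal.ofReal C ^ p * (2 ^ p * (∫⁻ ω, ENNReal.ofReal (smallMax C d n ω) ^ p ∂P +
          ENNReal.ofReal (2 * C) ^ p * ∫⁻ ω, ENNReal.ofReal (dm ω) ^ p ∂P)) := by
        have m1 := hsmm.ennreal_ofReal.pow_const p
        have m2 := hdmm.ennreal_ofReal.pow_const p
        rw [lintegral_const_mul' _ _ (ENNReal.rpow_ne_top_of_nonneg hp.le ENNReal.ofReal_ne_top),
          lintegral_const_mul' _ _ (ENNReal.rpow_ne_top_of_nonneg hp.le (by simp)), lintegral_add_left m1,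
          lintegral_const_mul _ m2]
    _ ≤ ENNReal.ofReal C ^ p * (2 ^ p * (2 * ENNReal.ofReal ((2 * C ^ 2 + C) ^ p) *
          (ENNReal.ofReal δ⁻¹ ^ p *
            ((4 * ENNReal.ofReal (C ^ p) + 16 * ENNReal.ofReal ((2 * C ^ 2) ^ p)) * I)) +
          ENNReal.ofReal (2 * C) ^ p * (16 * ENNReal.ofReal ((2 * C ^ 2) ^ p) * I))) := by
        gcongr
        exact hsm.trans (mul_le_mul' le_rfl hctl)
    _ = _ := by
        rw [symmetricConst]; ring

/-- Write d as (d - H(v)) + H(v). The first sequence is symmetric under swapping the two noise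
copies, and its decoupled moments are bounded by those of each copy; the second is the decoupled
sequence itself. -/
theorem lintegral_le (h : IsTangentRep P F ν d H)
    (hC : ∀ x y : X, qnorm (x + y) ≤ C * (qnorm x + qnorm y)) (hC1 : 1 ≤ C)
    {p p₀ κ δ : ℝ} (hp : 0 < p) (hp₀ : 0 < p₀) (hκ : 0 < κ)
    (hδ : 0 < δ) (hδκ : 2 * δ ≤ κ) (hδC : 2 * C * δ ≤ 1) {D : ℝ≥0}
    (hθ : ENNReal.ofReal ((C * (2 * C + 1) * C) ^ p₀) *
      (4 * (2 * ENNReal.ofReal ((δ / κ) ^ p))) ≤ 1 / 2)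
    (hε : ENNReal.ofReal ((2 * C ^ 2 + C) ^ p) * ((D : ℝ≥0∞) ^ p₀ *
      (2 * ENNReal.ofReal ((C * (2 * C + 1) * C) ^ p₀) * ENNReal.ofReal ((C * κ) ^ p₀))) ≤ 1 / 2)
    (hD : DecouplingWith.{u, w} X p₀ D) (hF : F 0 = ⊥) (n : ℕ) :
    ∫⁻ ω, ENNReal.ofReal (qnorm (∑ k ∈ Finset.range n, d k ω)) ^ p ∂P ≤
      extrapolationConst C p δ * ∫⁻ ω, condMoment ν H p n ω ∂P := by
  set I := ∫⁻ ω, condMoment ν H p n ω ∂P with hI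
  have hsym := h.symmetrize
  have key := hsym.lintegral_le_of_symmetric (ι := Prod.swap) Measure.measurePreserving_swap
    (fun k z a => by simp) hC hC1 hp hp₀ hκ hδ hδκ hδC hθ hε hD (noiseFiltration_zero hF E) n
  have hfst : MeasurePreserving (fun (a : ℕ → E × E) k => (a k).1) (noiseMeasure (ν.prod ν))
      (noiseMeasure ν) := by
    refine ⟨by fun_prop, ?_⟩
    rw [Measure.infinitePi_map_pi _ fun _ => measurable_fst]
    simp [noiseMeasure]
  have hsnd : MeasurePreserving (fun (a : ℕ → E × E) k => (a k).2) (noiseMeasure (ν.prod ν))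
      (noiseMeasure ν) := by
    refine ⟨by fun_prop, ?_⟩
    rw [Measure.infinitePi_map_pi _ fun _ => measurable_snd]
    simp [noiseMeasure]
  have hcond : ∀ z : Ω × (ℕ → E), condMoment (ν.prod ν)
      (fun k (z : Ω × (ℕ → E)) (a : E × E) => H k z.1 a.1 - H k z.1 a.2) p n z ≤
      ENNReal.ofReal C ^ p * (2 ^ p * 2) * condMoment ν H p n z.1 := by
    intro z
    have hS : Measurable fun v => ENNReal.ofReal (qnorm (noiseSum (fun k => H k z.1) n v)) ^ p :=
      ((measurable_qnorm_noiseSum (fun k => h.measurable_H_left k z.1) n).ennreal_ofReal).pow_const p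
    calc condMoment (ν.prod ν)
          (fun k (z : Ω × (ℕ → E)) (a : E × E) => H k z.1 a.1 - H k z.1 a.2) p n z
        ≤ ∫⁻ a, ENNReal.ofReal C ^ p * (2 ^ p *
            (ENNReal.ofReal (qnorm (noiseSum (fun k => H k z.1) n fun k => (a k).1)) ^ p +
             ENNReal.ofReal (qnorm (noiseSum (fun k => H k z.1) n fun k => (a k).2)) ^ p))
            ∂noiseMeasure (ν.prod ν) := by
          refine lintegral_mono fun a => ?_
          have h1 : noiseSum (fun k (a : E × E) => H k z.1 a.1 - H k z.1 a.2) n a =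
              noiseSum (fun k => H k z.1) n (fun k => (a k).1) +
              -noiseSum (fun k => H k z.1) n (fun k => (a k).2) := by
            simp only [noiseSum, Finset.sum_sub_distrib]
            exact sub_eq_add_neg _ _
          have h2 := ofReal_qnorm_add_rpow_le hC hC1 hp
            (noiseSum (fun k => H k z.1) n (fun k => (a k).1))
            (-noiseSum (fun k => H k z.1) n (fun k => (a k).2))
          rw [← h1, QuasiBanachSpace.qnorm_neg] at h2
          exact h2
      _ = _ := by
          have m1 : Measurable fun a : ℕ → E × E => ENNReal.ofReal (qnorm (noiseSum (fun k => H k z.1)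
              n fun k => (a k).1)) ^ p := hS.comp hfst.measurable
          have e1 := hfst.lintegral_comp hS
          have e2 := hsnd.lintegral_comp hS
          rw [lintegral_const_mul' _ _ (ENNReal.rpow_ne_top_of_nonneg hp.le ENNReal.ofReal_ne_top),
            lintegral_const_mul' _ _ (ENNReal.rpow_ne_top_of_nonneg hp.le (by simp)), lintegral_add_left m1, e1, e2, condMoment]
          ring
  have hdm : Measurable fun ω => ENNReal.ofReal (qnorm (∑ k ∈ Finset.range n, d k ω)) ^ p :=
    ((QuasiBanachSpace.measurable_qnorm.comp (Finset.measurable_fun_sum _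
      fun k _ => h.measurable_d k)).ennreal_ofReal).pow_const p
  have hgm : Measurable fun z : Ω × (ℕ → E) =>
      ENNReal.ofReal (qnorm (noiseSum (fun k => H k z.1) n z.2)) ^ p :=
    ((QuasiBanachSpace.measurable_qnorm.comp (h.measurable_noiseSum n)).ennreal_ofReal).pow_const p
  have hcmm : Measurable (condMoment ν H p n) := hgm.lintegral_prod_right'
  have hkey : ∫⁻ z : Ω × (ℕ → E), ENNReal.ofReal (qnorm (∑ k ∈ Finset.range n,
      (d k z.1 - H k z.1 (z.2 k)))) ^ p ∂P.prod (noiseMeasure ν) ≤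
      symmetricConst C p δ * (ENNReal.ofReal C ^ p * (2 ^ p * 2) * I) := by
    refine key.trans (mul_le_mul' le_rfl ?_)
    calc _ ≤ ∫⁻ z : Ω × (ℕ → E), ENNReal.ofReal C ^ p * (2 ^ p * 2) * condMoment ν H p n z.1
            ∂P.prod (noiseMeasure ν) := lintegral_mono hcond
      _ = _ := by
          rw [measurePreserving_fst.lintegral_comp (hcmm.const_mul _), lintegral_const_mul _ hcmm]
  calc ∫⁻ ω, ENNReal.ofReal (qnorm (∑ k ∈ Finset.range n, d k ω)) ^ p ∂P
      = ∫⁻ z : Ω × (ℕ → E), ENNReal.ofReal (qnorm (∑ k ∈ Finset.range n, d k z.1)) ^ p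
          ∂P.prod (noiseMeasure ν) :=
        (measurePreserving_fst.lintegral_comp hdm).symm
    _ ≤ ∫⁻ z : Ω × (ℕ → E), ENNReal.ofReal C ^ p * (2 ^ p *
          (ENNReal.ofReal (qnorm (∑ k ∈ Finset.range n, (d k z.1 - H k z.1 (z.2 k)))) ^ p +
           ENNReal.ofReal (qnorm (noiseSum (fun k => H k z.1) n z.2)) ^ p))
          ∂P.prod (noiseMeasure ν) := by
        refine lintegral_mono fun z => ?_
        have h1 := ofReal_qnorm_add_rpow_le hC hC1 hp
          (∑ k ∈ Finset.range n, (d k z.1 - H k z.1 (z.2 k)))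
          (noiseSum (fun k => H k z.1) n z.2)
        rw [noiseSum, ← Finset.sum_add_distrib] at h1
        simp only [sub_add_cancel] at h1
        exact h1
    _ = ENNReal.ofReal C ^ p * (2 ^ p * (∫⁻ z : Ω × (ℕ → E), ENNReal.ofReal (qnorm
          (∑ k ∈ Finset.range n, (d k z.1 - H k z.1 (z.2 k)))) ^ p ∂P.prod (noiseMeasure ν) + I)) := by
        rw [lintegral_const_mul' _ _ (ENNReal.rpow_ne_top_of_nonneg hp.le ENNReal.ofReal_ne_top),
          lintegral_const_mul' _ _ (ENNReal.rpow_ne_top_of_nonneg hp.le (by simp)),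
          lintegral_add_right _ hgm, hI, h.lintegral_condMoment]
    _ ≤ ENNReal.ofReal C ^ p * (2 ^ p *
          (symmetricConst C p δ * (ENNReal.ofReal C ^ p * (2 ^ p * 2) * I) + I)) := by gcongr
    _ = _ := by
        rw [extrapolationConst]; ring

end IsTangentRep

end Extrapolation

section Extrapolation

variable {X : Type u} [AddCommGroup X] [Module ℝ X] [QuasiNorm X] [QuasiBanachSpace X]

theorem DecouplingWith.extrapolate_of_secondCountable [SecondCountableTopology X] {C : ℝ}
    (hC : ∀ x y : X, qnorm (x + y) ≤ C * (qnorm x + qnorm y)) (hC1 : 1 ≤ C)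
    {p p₀ κ δ : ℝ} (hp : 0 < p) (hp₀ : 0 < p₀) (hκ : 0 < κ)
    (hδ : 0 < δ) (hδκ : 2 * δ ≤ κ) (hδC : 2 * C * δ ≤ 1) {D : ℝ≥0}
    (hθ : ENNReal.ofReal ((C * (2 * C + 1) * C) ^ p₀) *
      (4 * (2 * ENNReal.ofReal ((δ / κ) ^ p))) ≤ 1 / 2)
    (hε : ENNReal.ofReal ((2 * C ^ 2 + C) ^ p) * ((D : ℝ≥0∞) ^ p₀ *
      (2 * ENNReal.ofReal ((C * (2 * C + 1) * C) ^ p₀) * ENNReal.ofReal ((C * κ) ^ p₀))) ≤ 1 / 2)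
    (hD : DecouplingWith.{u, w} X p₀ D) :
    DecouplingWith.{u, w} X p (extrapolationConst C p δ ^ (1 / p)).toNNReal := by
  intro Ω mΩ P hP _ F hF f g hf0 hg0 hf _ hfg n
  let : MeasurableSpace X := borel X
  have : BorelSpace X := ⟨rfl⟩
  set d : ℕ → Ω → X := fun k ω => f (k + 1) ω - f k ω with hd
  have hdm : ∀ k, Measurable[F (k + 1)] (d k) := fun k =>
    Measurable.sub (hf (k + 1)).1 ((hf k).1.mono (F.mono k.le_succ) le_rfl)
  obtain ⟨H, hH⟩ := exists_isTangentRep P F hdm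
  have hfs : f n = fun ω => ∑ k ∈ Finset.range n, d k ω := by
    funext ω
    rw [Finset.sum_range_sub (fun k => f k ω), hf0, Pi.zero_apply, sub_zero]
  have hgs : g n = fun ω => ∑ k ∈ Finset.range n, (g (k + 1) ω - g k ω) := by
    funext ω
    rw [Finset.sum_range_sub (fun k => g k ω), hg0, Pi.zero_apply, sub_zero]
  have key := hH.lintegral_le hC hC1 hp hp₀ hκ hδ hδκ hδC hθ hε hD hF n
  rw [hH.lintegral_condMoment] at key
  have htop : extrapolationConst C p δ ^ (1 / p) ≠ ∞ :=
    ENNReal.rpow_ne_top_of_nonneg (by positivity) (extrapolationConst_ne_top hp)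
  rw [hgs, hH.lpQNorm_decoupled_eq hfg, hfs, ENNReal.coe_toNNReal htop, lpQNorm, lpQNorm,
    ← ENNReal.mul_rpow_of_nonneg _ _ (by positivity)]
  exact ENNReal.rpow_le_rpow key (by positivity)

theorem DecouplingFor.extrapolate {p p₀ : ℝ} (hp₀ : 0 < p₀) (hp : 0 < p)
    (h : DecouplingFor.{u, w} X p₀) : DecouplingFor.{u, w} X p := by
  obtain ⟨D, hD⟩ := h
  obtain ⟨C, hC1, hC⟩ := QuasiBanachSpace.exists_modulus X
  obtain ⟨κ, δ, hκ, hδ, hδκ, hδC, hθ, hε⟩ := exists_goodLambda_parameters hC1 hp hp₀ D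
  -- The parameters come from the modulus of the whole space, so the constant is the same for all
  -- its subspaces.
  refine ⟨(extrapolationConst C p δ ^ (1 / p)).toNNReal,
    decouplingWith_of_separable_subspace fun K hK hs => ?_⟩
  have := QuasiSubspace.quasiBanachSpace hK
  have := QuasiSubspace.separableSpace hK hs
  have := QuasiBanachSpace.secondCountableTopology_of_separable (X := QuasiSubspace K)
  exact (hD.of_isometry (QuasiSubspace.incl K) fun _ => rfl).extrapolate_of_secondCountable
    (fun x y => hC (QuasiSubspace.incl K x) (QuasiSubspace.incl K y)) hC1 hp hp₀ hκ hδ hδκ hδC hθ hε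

end Extrapolation

/-! ### L^q(S;Y) is a quasi-Banach space -/

section LqSpace

variable {Y : Type u} [AddCommGroup Y] [Module ℝ Y] [QuasiNorm Y] [QuasiBanachSpace Y]
variable {S : Type v} [MeasurableSpace S] {μ : Measure S} {q : ℝ}

theorem QuasiBanachSpace.tendsto_zero_of_ofReal_qnorm_rpow {ι : Type*} {l : Filter ι} (hq : 0 < q)
    {y : ι → Y} (h : Tendsto (fun i => ENNReal.ofReal (qnorm (y i)) ^ q) l (𝓝 0)) :
    Tendsto y l (𝓝 0) := by
  rw [QuasiBanachSpace.tendsto_iff_qnorm_sub]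
  have h1 := (ENNReal.continuous_rpow_const (y := 1 / q)).tendsto 0 |>.comp h
  rw [ENNReal.zero_rpow_of_pos (by positivity)] at h1
  have h2 := (ENNReal.tendsto_toReal ENNReal.zero_ne_top).comp h1
  refine h2.congr fun i => ?_
  simp only [Function.comp, ← ENNReal.rpow_mul, mul_one_div_cancel hq.ne', ENNReal.rpow_one,
    sub_zero, ENNReal.toReal_ofReal (QuasiBanachSpace.qnorm_nonneg _)]

theorem aemeasurable_ofReal_qnorm_rpow {u : S → Y} (hu : AEStronglyMeasurable u μ) (q : ℝ) :
    AEMeasurable (fun s => ENNReal.ofReal (qnorm (u s)) ^ q) μ :=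
  (QuasiBanachSpace.continuous_qnorm.comp_aestronglyMeasurable hu).aemeasurable.ennreal_ofReal
    |>.pow_const q

theorem ae_tendsto_zero_of_tsum_lintegral_ne_top (hq : 0 < q) {u : ℕ → S → Y}
    (hu : ∀ n, AEStronglyMeasurable (u n) μ)
    (h : ∑' n, ∫⁻ s, ENNReal.ofReal (qnorm (u n s)) ^ q ∂μ ≠ ∞) :
    ∀ᵐ s ∂μ, Tendsto (fun n => u n s) atTop (𝓝 0) := by
  have hm := fun n => aemeasurable_ofReal_qnorm_rpow (hu n) q
  rw [← lintegral_tsum hm] at h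
  filter_upwards [ae_lt_top' (AEMeasurable.tsum hm) h] with s hs
  exact QuasiBanachSpace.tendsto_zero_of_ofReal_qnorm_rpow hq
    (ENNReal.tendsto_atTop_zero_of_tsum_ne_top hs.ne)

/-- Increments must decay at the rate (2C)^(-k) to beat the modulus. The bound 2C (2C)^(-m)
reproduces itself, because C (2C (2C)^(-m-1) + (2C)^(-m)) = 2C (2C)^(-m). -/
theorem qnorm_sub_le_of_geometric {C : ℝ} (hC1 : 1 ≤ C)
    (hC : ∀ x y : Y, qnorm (x + y) ≤ C * (qnorm x + qnorm y)) {y : ℕ → Y} {K : ℕ}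
    (h : ∀ k ≥ K, (2 * C) ^ k * qnorm (y (k + 1) - y k) ≤ 1) (j : ℕ) :
    ∀ m ≥ K, (2 * C) ^ m * qnorm (y (m + j) - y m) ≤ 2 * C := by
  induction j with
  | zero => intro m _; simp only [add_zero, sub_self, QuasiBanachSpace.qnorm_zero]; linarith
  | succ j ih =>
    intro m hm
    have h1 := ih (m + 1) (by omega)
    have h2 := h m hm
    have h3 := hC (y (m + 1 + j) - y (m + 1)) (y (m + 1) - y m)
    rw [sub_add_sub_cancel] at h3
    rw [show m + (j + 1) = m + 1 + j by ring]
    set a := qnorm (y (m + 1 + j) - y (m + 1))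
    set b := qnorm (y (m + 1) - y m)
    have hC0 : 0 < C := by linarith
    have hpos : 0 < (2 * C) ^ m := by positivity
    have h4 : (2 * C) ^ m * a ≤ 1 := by
      have : 2 * C * ((2 * C) ^ m * a) ≤ 2 * C * 1 := by rw [pow_succ] at h1; linarith
      exact le_of_mul_le_mul_left this (by linarith)
    calc _ ≤ (2 * C) ^ m * (C * (a + b)) := mul_le_mul_of_nonneg_left h3 hpos.le
      _ = C * ((2 * C) ^ m * a + (2 * C) ^ m * b) := by ring
      _ ≤ C * (1 + 1) := mul_le_mul_of_nonneg_left (add_le_add h4 h2) hC0.le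
      _ = 2 * C := by ring

theorem exists_tendsto_of_geometric {C : ℝ} (hC1 : 1 ≤ C)
    (hC : ∀ x y : Y, qnorm (x + y) ≤ C * (qnorm x + qnorm y)) {y : ℕ → Y}
    (h : ∀ᶠ k in atTop, (2 * C) ^ k * qnorm (y (k + 1) - y k) ≤ 1) :
    ∃ a, Tendsto y atTop (𝓝 a) := by
  obtain ⟨K, hK⟩ := eventually_atTop.1 h
  have hC0 : 0 < C := by linarith
  obtain ⟨a, ha⟩ := QuasiBanachSpace.complete y fun ε hε => by
    have hlim : Tendsto (fun m : ℕ => 2 * C * (2 * C * ((2 * C)⁻¹) ^ m)) atTop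
        (𝓝 (2 * C * (2 * C * 0))) :=
      ((tendsto_pow_atTop_nhds_zero_of_lt_one (by positivity)
        (inv_lt_one_of_one_lt₀ (by linarith))).const_mul _).const_mul _
    rw [mul_zero, mul_zero] at hlim
    obtain ⟨N, hNK, hN⟩ := ((eventually_ge_atTop K).and (hlim.eventually_lt_const hε)).exists
    have hb : ∀ m ≥ N, qnorm (y m - y N) ≤ 2 * C * ((2 * C)⁻¹) ^ N := by
      intro m hm
      obtain ⟨j, rfl⟩ := Nat.exists_eq_add_of_le hm
      have := qnorm_sub_le_of_geometric hC1 hC hK j N hNK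
      rw [inv_pow, ← div_eq_mul_inv, le_div_iff₀ (by positivity)]
      linarith
    refine ⟨N, fun m hm n hn => lt_of_le_of_lt ?_ hN⟩
    have h1 := hC (y m - y N) (y N - y n)
    rw [sub_add_sub_cancel, QuasiBanachSpace.qnorm_sub_comm (y N)] at h1
    have h2 := hb m hm
    have h3 := hb n hn
    nlinarith
  exact ⟨a, QuasiBanachSpace.tendsto_iff_qnorm_sub.2 ha⟩

namespace LqSpace

variable {hq : 0 < q}

theorem lintegral_lt_top (f : LqSpace Y q hq μ) :
    ∫⁻ s, ENNReal.ofReal (qnorm (f.1 s)) ^ q ∂μ < ∞ :=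
  (lpQNorm_lt_top_iff hq μ _).1 f.2

theorem ofReal_qnorm_rpow (f : LqSpace Y q hq μ) :
    ENNReal.ofReal (qnorm f) ^ q = ∫⁻ s, ENNReal.ofReal (qnorm (f.1 s)) ^ q ∂μ := by
  rw [← lpQNorm_rpow hq]
  exact congrArg (· ^ q) (ENNReal.ofReal_toReal (ne_of_lt f.2))

theorem coeFn_add (f g : LqSpace Y q hq μ) : (f + g).1 =ᵐ[μ] f.1 + g.1 :=
  AEEqFun.coeFn_add f.1 g.1

theorem coeFn_sub (f g : LqSpace Y q hq μ) : (f - g).1 =ᵐ[μ] f.1 - g.1 :=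
  AEEqFun.coeFn_sub f.1 g.1

theorem coeFn_smul (a : ℝ) (f : LqSpace Y q hq μ) : (a • f).1 =ᵐ[μ] a • f.1 :=
  AEEqFun.coeFn_smul a f.1

theorem lintegral_sub_eq (f g : LqSpace Y q hq μ) :
    ENNReal.ofReal (qnorm (f - g)) ^ q = ∫⁻ s, ENNReal.ofReal (qnorm (f.1 s - g.1 s)) ^ q ∂μ := by
  rw [ofReal_qnorm_rpow]
  refine lintegral_congr_ae ?_
  filter_upwards [coeFn_sub f g] with s hs
  rw [hs, Pi.sub_apply]

theorem qnorm_add_le {C : ℝ} (hC1 : 1 ≤ C)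
    (hC : ∀ x y : Y, qnorm (x + y) ≤ C * (qnorm x + qnorm y)) (f g : LqSpace Y q hq μ) :
    qnorm (f + g) ≤ 2 * C * 2 ^ (1 / q) * (qnorm f + qnorm g) := by
  have hC0 : 0 ≤ C := by linarith
  have hn : ∀ f : LqSpace Y q hq μ, 0 ≤ qnorm f := fun f => ENNReal.toReal_nonneg
  have h1 : ENNReal.ofReal (qnorm (f + g)) ^ q ≤ ENNReal.ofReal C ^ q * (2 ^ q *
      (ENNReal.ofReal (qnorm f) ^ q + ENNReal.ofReal (qnorm g) ^ q)) := by
    rw [ofReal_qnorm_rpow f, ofReal_qnorm_rpow g, ofReal_qnorm_rpow,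
      ← lintegral_add_left' (aemeasurable_ofReal_qnorm_rpow f.1.aestronglyMeasurable q),
      ← lintegral_const_mul' _ _ (ENNReal.rpow_ne_top_of_nonneg hq.le (by simp)),
      ← lintegral_const_mul' _ _ (ENNReal.rpow_ne_top_of_nonneg hq.le ENNReal.ofReal_ne_top)]
    refine lintegral_mono_ae ?_
    filter_upwards [coeFn_add f g] with s hs
    rw [hs]
    exact ofReal_qnorm_add_rpow_le hC hC1 hq _ _
  have h2 : ENNReal.ofReal (qnorm (f + g)) ≤ ENNReal.ofReal C * (2 * (2 ^ (1 / q) *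
      (ENNReal.ofReal (qnorm f) + ENNReal.ofReal (qnorm g)))) := by
    have hr : ∀ a : ℝ≥0∞, (a ^ q) ^ (1 / q) = a := fun a => by
      rw [← ENNReal.rpow_mul, mul_one_div_cancel hq.ne', ENNReal.rpow_one]
    have hq' : 0 ≤ 1 / q := by positivity
    have h3 := ENNReal.rpow_le_rpow h1 hq'
    rw [ENNReal.mul_rpow_of_nonneg _ _ hq', ENNReal.mul_rpow_of_nonneg _ _ hq', hr, hr, hr] at h3
    refine h3.trans ?_
    gcongr
    refine (ENNReal.add_rpow_le_two_rpow_mul (by positivity) _ _).trans_eq ?_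
    rw [hr, hr]
  have h3 : (2 : ℝ≥0∞) ^ (1 / q) = ENNReal.ofReal (2 ^ (1 / q)) := by
    rw [← ENNReal.ofReal_rpow_of_pos two_pos]; simp
  rw [← ENNReal.ofReal_add (hn _) (hn _), h3, ← ENNReal.ofReal_mul (by positivity),
    show (2 : ℝ≥0∞) = ENNReal.ofReal 2 by simp, ← ENNReal.ofReal_mul (by positivity),
    ← ENNReal.ofReal_mul hC0, ENNReal.ofReal_le_ofReal_iff (by have := hn f; have := hn g; positivity)]
    at h2
  linarith

/-- A quasi-norm has no reverse triangle inequality, so continuity is obtained by dominated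
convergence. Summability gives both almost everywhere convergence and, through the sum of all |g n -
f|^q, an integrable majorant. -/
theorem tendsto_qnorm_of_tsum_ne_top {f : LqSpace Y q hq μ} {g : ℕ → LqSpace Y q hq μ}
    (h : ∑' n, ENNReal.ofReal (qnorm (g n - f)) ^ q ≠ ∞) :
    Tendsto (fun n => qnorm (g n)) atTop (𝓝 (qnorm f)) := by
  obtain ⟨C, hC1, hC⟩ := QuasiBanachSpace.exists_modulus Y
  simp only [lintegral_sub_eq] at h
  have hms : ∀ n, AEStronglyMeasurable (fun s => (g n).1 s - f.1 s) μ := fun n =>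
    (g n).1.aestronglyMeasurable.sub f.1.aestronglyMeasurable
  have hm := fun n => aemeasurable_ofReal_qnorm_rpow (hms n) q
  have hae := ae_tendsto_zero_of_tsum_lintegral_ne_top hq hms h
  rw [← lintegral_tsum hm] at h
  have hlim : Tendsto (fun n => ∫⁻ s, ENNReal.ofReal (qnorm ((g n).1 s)) ^ q ∂μ) atTop
      (𝓝 (∫⁻ s, ENNReal.ofReal (qnorm (f.1 s)) ^ q ∂μ)) := by
    refine tendsto_lintegral_of_dominated_convergence'
      (fun s => ENNReal.ofReal C ^ q * (2 ^ q *
        ((∑' n, ENNReal.ofReal (qnorm ((g n).1 s - f.1 s)) ^ q) +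
          ENNReal.ofReal (qnorm (f.1 s)) ^ q)))
      (fun n => aemeasurable_ofReal_qnorm_rpow (g n).1.aestronglyMeasurable q)
      (fun n => Eventually.of_forall fun s => ?_) ?_ ?_
    · have h1 := ofReal_qnorm_add_rpow_le hC hC1 hq ((g n).1 s - f.1 s) (f.1 s)
      rw [sub_add_cancel] at h1
      exact h1.trans (mul_le_mul' le_rfl (mul_le_mul' le_rfl (add_le_add
        (ENNReal.le_tsum (f := fun n => ENNReal.ofReal (qnorm ((g n).1 s - f.1 s)) ^ q) n) le_rfl)))
    · rw [lintegral_const_mul' _ _ (ENNReal.rpow_ne_top_of_nonneg hq.le ENNReal.ofReal_ne_top),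
        lintegral_const_mul' _ _ (ENNReal.rpow_ne_top_of_nonneg hq.le (by simp)),
        lintegral_add_left' (AEMeasurable.tsum hm)]
      exact ENNReal.mul_ne_top (ENNReal.rpow_ne_top_of_nonneg hq.le ENNReal.ofReal_ne_top)
        (ENNReal.mul_ne_top (ENNReal.rpow_ne_top_of_nonneg hq.le (by simp))
          (ENNReal.add_ne_top.2 ⟨h, f.lintegral_lt_top.ne⟩))
    · filter_upwards [hae] with s hs
      have h1 : Tendsto (fun n => (g n).1 s) atTop (𝓝 (f.1 s)) := by
        simpa using hs.add_const (f.1 s)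
      exact (ENNReal.continuous_rpow_const.tendsto _).comp
        ((ENNReal.continuous_ofReal.tendsto _).comp
          ((QuasiBanachSpace.continuous_qnorm.tendsto _).comp h1))
  refine (ENNReal.tendsto_toReal (ne_of_lt f.2)).comp ?_
  exact ((ENNReal.continuous_rpow_const (y := 1 / q)).tendsto _).comp hlim

theorem continuous_qnorm : Continuous (qnorm : LqSpace Y q hq μ → ℝ) := by
  have hn : ∀ f : LqSpace Y q hq μ, 0 ≤ qnorm f := fun f => ENNReal.toReal_nonneg
  refine ⟨fun V hV f hf => ?_⟩
  by_contra! hcon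
  choose g hg hgV using fun n : ℕ => hcon (((1 / 2 : ℝ) ^ n) ^ (1 / q)) (by positivity)
  have hlim : Tendsto (fun n => qnorm (g n)) atTop (𝓝 (qnorm f)) := by
    refine tendsto_qnorm_of_tsum_ne_top (ne_top_of_le_ne_top (b := ∑' n : ℕ, (2⁻¹ : ℝ≥0∞) ^ n)
      ?_ (ENNReal.tsum_le_tsum fun n => ?_))
    · rw [ENNReal.tsum_geometric]; simp
    · calc ENNReal.ofReal (qnorm (g n - f)) ^ q
          ≤ ENNReal.ofReal (((1 / 2 : ℝ) ^ n) ^ (1 / q)) ^ q := by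
            gcongr; exact (hg n).le
        _ = 2⁻¹ ^ n := by
            rw [ENNReal.ofReal_rpow_of_pos (by positivity), ← Real.rpow_mul (by positivity),
              one_div_mul_cancel hq.ne', Real.rpow_one, ENNReal.ofReal_pow (by positivity)]
            simp
  obtain ⟨n, hn⟩ := (hlim.eventually (hV.mem_nhds hf)).exists
  exact hgV n hn

theorem complete (x : ℕ → LqSpace Y q hq μ)
    (hx : ∀ ε : ℝ, 0 < ε → ∃ N, ∀ m ≥ N, ∀ n ≥ N, qnorm (x m - x n) < ε) :
    ∃ a : LqSpace Y q hq μ, Tendsto (fun n => qnorm (x n - a)) atTop (𝓝 0) := by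
  obtain ⟨C, hC1, hC⟩ := QuasiBanachSpace.exists_modulus Y
  have hC0 : 0 < C := by linarith
  have hn : ∀ f : LqSpace Y q hq μ, 0 ≤ qnorm f := fun f => ENNReal.toReal_nonneg
  -- The factor (2C)^(-k) serves the pointwise criterion for convergence, and 2^(-k/q) makes the
  -- q-th powers of the weighted increments summable.
  choose N hN using fun k : ℕ =>
    hx (((2 * C) ^ k)⁻¹ * ((1 / 2 : ℝ) ^ k) ^ (1 / q)) (by positivity)
  set φ : ℕ → ℕ := fun k => k + ∑ i ∈ Finset.range (k + 1), N i with hφ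
  have hφN : ∀ k, N k ≤ φ k := fun k =>
    (Finset.single_le_sum (f := N) (fun i _ => Nat.zero_le _)
      (Finset.self_mem_range_succ k)).trans (Nat.le_add_left _ _)
  have hφmono : ∀ k, φ k ≤ φ (k + 1) := fun k => by
    simp only [hφ, Finset.sum_range_succ _ (k + 1)]; omega
  have hφtop : Tendsto φ atTop atTop :=
    tendsto_atTop_mono (fun k => Nat.le_add_right _ _) tendsto_id
  have hstep : ∀ k, (2 * C) ^ k * qnorm (x (φ (k + 1)) - x (φ k)) ≤ ((1 / 2 : ℝ) ^ k) ^ (1 / q) := by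
    intro k
    have h1 := (hN k _ ((hφN k).trans (hφmono k)) _ (hφN k)).le
    rwa [inv_mul_eq_div, le_div_iff₀ (by positivity), mul_comm] at h1
  have hae : ∀ᵐ s ∂μ, ∃ a, Tendsto (fun k => (x (φ k)).1 s) atTop (𝓝 a) := by
    have h1 := ae_tendsto_zero_of_tsum_lintegral_ne_top (μ := μ) hq
      (u := fun k s => (2 * C) ^ k • ((x (φ (k + 1))).1 s - (x (φ k)).1 s))
      (fun k => ((x _).1.aestronglyMeasurable.sub (x _).1.aestronglyMeasurable).const_smul _) ?_
    · filter_upwards [h1] with s hs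
      refine exists_tendsto_of_geometric hC1 hC ?_
      have h2 := (QuasiBanachSpace.continuous_qnorm.tendsto (0 : Y)).comp hs
      rw [QuasiBanachSpace.qnorm_zero] at h2
      filter_upwards [h2.eventually_le_const one_pos] with k hk
      simpa [QuasiBanachSpace.qnorm_smul, abs_of_pos hC0] using hk
    · refine ne_top_of_le_ne_top (b := ∑' n : ℕ, (2⁻¹ : ℝ≥0∞) ^ n) ?_
        (ENNReal.tsum_le_tsum fun k => ?_)
      · rw [ENNReal.tsum_geometric]; simp
      · calc ∫⁻ s, ENNReal.ofReal (qnorm ((2 * C) ^ k • ((x (φ (k + 1))).1 s - (x (φ k)).1 s))) ^ q ∂μ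
            = ENNReal.ofReal ((2 * C) ^ k) ^ q *
                ENNReal.ofReal (qnorm (x (φ (k + 1)) - x (φ k))) ^ q := by
              rw [lintegral_sub_eq, ← lintegral_const_mul' _ _
                (ENNReal.rpow_ne_top_of_nonneg hq.le ENNReal.ofReal_ne_top)]
              refine lintegral_congr fun s => ?_
              rw [QuasiBanachSpace.qnorm_smul, abs_of_pos (by positivity),
                ENNReal.ofReal_mul (by positivity), ENNReal.mul_rpow_of_nonneg _ _ hq.le]
          _ = ENNReal.ofReal ((2 * C) ^ k * qnorm (x (φ (k + 1)) - x (φ k))) ^ q := by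
              rw [ENNReal.ofReal_mul (by positivity), ENNReal.mul_rpow_of_nonneg _ _ hq.le]
          _ ≤ ENNReal.ofReal (((1 / 2 : ℝ) ^ k) ^ (1 / q)) ^ q := by
              gcongr; exact hstep k
          _ = 2⁻¹ ^ k := by
              rw [ENNReal.ofReal_rpow_of_pos (by positivity), ← Real.rpow_mul (by positivity),
                one_div_mul_cancel hq.ne', Real.rpow_one, ENNReal.ofReal_pow (by positivity)]
              simp
  obtain ⟨a, ham, ha⟩ := exists_stronglyMeasurable_limit_of_tendsto_ae
    (fun k => (x (φ k)).1.aestronglyMeasurable) hae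
  have hfatou : ∀ ε : ℝ, 0 < ε → ∃ M, ∀ m ≥ M,
      ∫⁻ s, ENNReal.ofReal (qnorm ((x m).1 s - a s)) ^ q ∂μ ≤ ENNReal.ofReal ε ^ q := by
    intro ε hε
    obtain ⟨M, hM⟩ := hx ε hε
    refine ⟨M, fun m hm => ?_⟩
    calc ∫⁻ s, ENNReal.ofReal (qnorm ((x m).1 s - a s)) ^ q ∂μ
        = ∫⁻ s, liminf (fun k => ENNReal.ofReal (qnorm ((x m).1 s - (x (φ k)).1 s)) ^ q) atTop ∂μ := by
          refine lintegral_congr_ae ?_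
          filter_upwards [ha] with s hs
          refine (Tendsto.liminf_eq ?_).symm
          exact (ENNReal.continuous_rpow_const.tendsto _).comp
            ((ENNReal.continuous_ofReal.tendsto _).comp
              ((QuasiBanachSpace.continuous_qnorm.tendsto _).comp (hs.const_sub _)))
      _ ≤ liminf (fun k => ∫⁻ s, ENNReal.ofReal (qnorm ((x m).1 s - (x (φ k)).1 s)) ^ q ∂μ) atTop :=
          lintegral_liminf_le' fun k => aemeasurable_ofReal_qnorm_rpow
            ((x m).1.aestronglyMeasurable.sub (x (φ k)).1.aestronglyMeasurable) q
      _ ≤ ENNReal.ofReal ε ^ q := by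
          refine liminf_le_of_frequently_le' (Eventually.frequently ?_)
          filter_upwards [hφtop.eventually_ge_atTop M] with k hk
          rw [← lintegral_sub_eq]
          gcongr
          exact (hM m hm _ hk).le
  -- The pointwise limit a is not yet known to lie in L^q, but x M - a does by Fatou, so the limit
  -- is recovered as x M minus that element.
  obtain ⟨M, hM⟩ := hfatou 1 one_pos
  have hbm : AEStronglyMeasurable (fun s => (x M).1 s - a s) μ :=
    (x M).1.aestronglyMeasurable.sub ham.aestronglyMeasurable
  have hb : AEEqFun.mk _ hbm ∈ lqSubmodule Y q hq μ := by
    refine (lpQNorm_lt_top_iff hq μ _).2 ?_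
    rw [lintegral_congr_ae (g := fun s => ENNReal.ofReal (qnorm ((x M).1 s - a s)) ^ q)]
    · exact (hM M le_rfl).trans_lt (by simp)
    · filter_upwards [AEEqFun.coeFn_mk _ hbm] with s hs
      rw [hs]
  let b : LqSpace Y q hq μ := ⟨_, hb⟩
  have hba : (x M - b).1 =ᵐ[μ] a := by
    filter_upwards [coeFn_sub (x M) b, AEEqFun.coeFn_mk _ hbm] with s h1 h2
    rw [h1, Pi.sub_apply, h2, sub_sub_cancel]
  refine ⟨x M - b, ?_⟩
  rw [Metric.tendsto_atTop]
  intro ε hε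
  obtain ⟨M', hM'⟩ := hfatou (ε / 2) (by positivity)
  refine ⟨M', fun m hm => ?_⟩
  have h1 := hM' m hm
  rw [← lintegral_congr_ae (f := fun s => ENNReal.ofReal (qnorm ((x m).1 s - (x M - b).1 s)) ^ q)
    (by filter_upwards [hba] with s hs; rw [hs]), ← lintegral_sub_eq,
    ENNReal.rpow_le_rpow_iff hq, ENNReal.ofReal_le_ofReal_iff (by positivity)] at h1
  rw [Real.dist_eq, sub_zero, abs_of_nonneg (hn _)]
  linarith

instance : QuasiBanachSpace (LqSpace Y q hq μ) where
  qnorm_nonneg f := ENNReal.toReal_nonneg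
  qnorm_eq_zero_iff f := by
    have h0 : qnorm f = 0 ↔ ENNReal.ofReal (qnorm f) ^ q = 0 := by
      rw [ENNReal.rpow_eq_zero_iff_of_pos hq, ENNReal.ofReal_eq_zero]
      exact ⟨le_of_eq, fun h => le_antisymm h ENNReal.toReal_nonneg⟩
    rw [h0, ofReal_qnorm_rpow,
      lintegral_eq_zero_iff' (aemeasurable_ofReal_qnorm_rpow f.1.aestronglyMeasurable q)]
    have h1 : f = 0 ↔ f.1 = 0 := Submodule.coe_eq_zero (p := lqSubmodule Y q hq μ).symm
    rw [h1, AEEqFun.ext_iff]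
    have h2 := AEEqFun.coeFn_zero (α := S) (β := Y) (μ := μ)
    constructor
    · intro h
      filter_upwards [h, h2] with s hs hs2
      rw [hs2]
      simpa [hq, hq.not_gt, ENNReal.ofReal_eq_zero,
        (QuasiBanachSpace.qnorm_nonneg (f.1 s)).ge_iff_eq', QuasiBanachSpace.qnorm_eq_zero_iff] using hs
    · intro h
      filter_upwards [h, h2] with s hs hs2
      rw [hs, hs2]
      simp [QuasiBanachSpace.qnorm_zero, hq]
  qnorm_smul a f := by
    have h : ENNReal.ofReal (qnorm (a • f)) ^ q = ENNReal.ofReal (|a| * qnorm f) ^ q := by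
      rw [ENNReal.ofReal_mul (abs_nonneg a), ENNReal.mul_rpow_of_nonneg _ _ hq.le,
        ofReal_qnorm_rpow, ofReal_qnorm_rpow, ← lintegral_const_mul' _ _
          (ENNReal.rpow_ne_top_of_nonneg hq.le ENNReal.ofReal_ne_top)]
      refine lintegral_congr_ae ?_
      filter_upwards [coeFn_smul a f] with s hs
      rw [hs, Pi.smul_apply, QuasiBanachSpace.qnorm_smul, ENNReal.ofReal_mul (abs_nonneg a),
        ENNReal.mul_rpow_of_nonneg _ _ hq.le]
    have h2 := ENNReal.rpow_left_injective hq.ne' h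
    exact (ENNReal.ofReal_eq_ofReal_iff ENNReal.toReal_nonneg
      (mul_nonneg (abs_nonneg _) ENNReal.toReal_nonneg)).1 h2
  exists_qnorm_add_le := by
    obtain ⟨C, hC1, hC⟩ := QuasiBanachSpace.exists_modulus Y
    exact ⟨_, qnorm_add_le hC1 hC⟩
  complete := complete
  continuous_qnorm := continuous_qnorm

end LqSpace

end LqSpace

/-! ### Transfer to function spaces by Fubini -/

section Fubini

variable {Y : Type u} [AddCommGroup Y] [Module ℝ Y] [QuasiNorm Y] [QuasiBanachSpace Y]
variable {S : Type v} [MeasurableSpace S] {μ : Measure S} {p : ℝ}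
variable {X : Type*} [AddCommGroup X] [Module ℝ X] [QuasiNorm X] [QuasiBanachSpace X]

theorem ae_eval_sum {ev : X → S → Y} (hadd : ∀ x y, ev (x + y) =ᵐ[μ] ev x + ev y)
    (x : ℕ → X) (n : ℕ) :
    ∀ᵐ s ∂μ, ev (∑ k ∈ Finset.range n, x k) s = ∑ k ∈ Finset.range n, ev (x k) s := by
  induction n with
  | zero =>
    -- Additivity at (0, 0) forces `ev 0` to vanish almost everywhere.
    filter_upwards [hadd 0 0] with s hs
    simpa using hs
  | succ n ih =>
    filter_upwards [ih, hadd (∑ k ∈ Finset.range n, x k) (x n)] with s h1 h2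
    rw [Finset.sum_range_succ, h2, Pi.add_apply, h1, Finset.sum_range_succ]

variable [MeasurableSpace X] [BorelSpace X] [SecondCountableTopology X]

theorem lintegral_qnorm_sum_eq_lintegral_eval [SFinite μ] {ev : X → S → Y}
    (hev : StronglyMeasurable (Function.uncurry ev))
    (hadd : ∀ x y, ev (x + y) =ᵐ[μ] ev x + ev y)
    (hnorm : ∀ x, ENNReal.ofReal (qnorm x) ^ p = ∫⁻ s, ENNReal.ofReal (qnorm (ev x s)) ^ p ∂μ)
    {Ω : Type w} {mΩ : MeasurableSpace Ω} (P : Measure Ω) [SFinite P] {ξ : ℕ → Ω → X}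
    (hξ : ∀ k, Measurable (ξ k)) (n : ℕ) :
    Measurable (fun s => ∫⁻ ω, ENNReal.ofReal (qnorm (∑ k ∈ Finset.range n, ev (ξ k ω) s)) ^ p ∂P) ∧
    ∫⁻ ω, ENNReal.ofReal (qnorm (∑ k ∈ Finset.range n, ξ k ω)) ^ p ∂P =
      ∫⁻ s, ∫⁻ ω, ENNReal.ofReal (qnorm (∑ k ∈ Finset.range n, ev (ξ k ω) s)) ^ p ∂P ∂μ := by
  have hm : Measurable fun z : Ω × S =>
      ENNReal.ofReal (qnorm (∑ k ∈ Finset.range n, ev (ξ k z.1) z.2)) ^ p := by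
    have h1 : StronglyMeasurable fun z : Ω × S => ∑ k ∈ Finset.range n, ev (ξ k z.1) z.2 :=
      Finset.stronglyMeasurable_fun_sum _ fun k _ =>
        hev.comp_measurable (((hξ k).comp measurable_fst).prodMk measurable_snd)
    exact (QuasiBanachSpace.continuous_qnorm.comp_stronglyMeasurable h1).measurable.ennreal_ofReal
      |>.pow_const p
  refine ⟨hm.lintegral_prod_left', ?_⟩
  rw [← lintegral_lintegral_swap hm.aemeasurable]
  refine lintegral_congr fun ω => ?_
  rw [hnorm]
  refine lintegral_congr_ae ?_
  filter_upwards [ae_eval_sum hadd (fun k => ξ k ω) n] with s hs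
  rw [hs]

/-- For fixed s the evaluation is Borel, so it carries tangency and conditional independence of the
increments to Y. It need not be additive at that s; the sequences in Y are therefore built from
evaluated increments, and additivity enters only under the integral over S. -/
theorem DecouplingWith.of_evaluation [SFinite μ] (hp : 0 < p) {ev : X → S → Y}
    (hev : StronglyMeasurable (Function.uncurry ev))
    (hadd : ∀ x y, ev (x + y) =ᵐ[μ] ev x + ev y)
    (hnorm : ∀ x, ENNReal.ofReal (qnorm x) ^ p = ∫⁻ s, ENNReal.ofReal (qnorm (ev x s)) ^ p ∂μ)
    {D : ℝ≥0} (h : DecouplingWith.{u, w} Y p D) : DecouplingWith.{_, w} X p D := by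
  intro Ω mΩ P hP hc F hF f g hf0 hg0 hf hfp hfg n
  have hbX : borel X = ‹MeasurableSpace X› := (BorelSpace.measurable_eq (α := X)).symm
  set d : ℕ → Ω → X := fun k ω => f (k + 1) ω - f k ω with hd
  set e : ℕ → Ω → X := fun k ω => g (k + 1) ω - g k ω with he
  have hfm : ∀ n, Measurable[F n] (f n) := fun n => by
    have := (hf n).1
    rwa [hbX] at this
  have hdm : ∀ k, Measurable[F (k + 1)] (d k) := fun k =>
    Measurable.sub (hfm (k + 1)) ((hfm k).mono (F.mono k.le_succ) le_rfl)
  have hem : ∀ k, Measurable (e k) := fun k => by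
    have := (hfg.randomVariable k).1
    rwa [hbX] at this
  have hfs : ∀ n, f n = fun ω => ∑ k ∈ Finset.range n, d k ω := fun n => by
    funext ω
    rw [Finset.sum_range_sub (fun k => f k ω), hf0, Pi.zero_apply, sub_zero]
  have hgs : g n = fun ω => ∑ k ∈ Finset.range n, e k ω := by
    funext ω
    rw [Finset.sum_range_sub (fun k => g k ω), hg0, Pi.zero_apply, sub_zero]
  have hevs : ∀ s, StronglyMeasurable fun x => ev x s := fun s =>
    hev.comp_measurable (measurable_id.prodMk measurable_const)
  have hevm : ∀ s, ∀ B : Set Y, MeasurableSet[borel Y] B →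
      MeasurableSet[borel X] ((fun x => ev x s) ⁻¹' B) := by
    intro s B hB
    borelize Y
    rw [hbX]
    exact (hevs s).measurable hB
  have hdF := fun n => lintegral_qnorm_sum_eq_lintegral_eval hev hadd hnorm P
    (fun k => (hdm k).mono (F.le _) le_rfl) n
  have heF := lintegral_qnorm_sum_eq_lintegral_eval hev hadd hnorm P hem n
  have hfin : ∀ᵐ s ∂μ, ∀ n,
      ∫⁻ ω, ENNReal.ofReal (qnorm (∑ k ∈ Finset.range n, ev (d k ω) s)) ^ p ∂P < ∞ := by
    refine ae_all_iff.2 fun n => ae_lt_top (hdF n).1 ?_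
    rw [← (hdF n).2]
    have := (lpQNorm_lt_top_iff hp P _).1 (hfp n)
    rw [hfs n] at this
    exact this.ne
  have key : ∀ᵐ s ∂μ, ∫⁻ ω, ENNReal.ofReal (qnorm (∑ k ∈ Finset.range n, ev (d k ω) s)) ^ p ∂P ≤
      (D : ℝ≥0∞) ^ p *
        ∫⁻ ω, ENNReal.ofReal (qnorm (∑ k ∈ Finset.range n, ev (e k ω) s)) ^ p ∂P := by
    filter_upwards [hfin] with s hs
    have h1 := h Ω mΩ P hP hc F hF (fun n ω => ∑ k ∈ Finset.range n, ev (d k ω) s)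
      (fun n ω => ∑ k ∈ Finset.range n, ev (e k ω) s) (by ext; simp) (by ext; simp)
      (fun n => ?_) (fun n => (lpQNorm_lt_top_iff hp P _).2 (hs n)) ?_ n
    · have h2 := ENNReal.rpow_le_rpow h1 hp.le
      rwa [ENNReal.mul_rpow_of_nonneg _ _ hp.le, lpQNorm_rpow hp, lpQNorm_rpow hp] at h2
    · rw [isRandomVariable_iff_stronglyMeasurable]
      exact Finset.stronglyMeasurable_fun_sum _ fun k hk => (hevs s).comp_measurable
        ((hdm k).mono (F.mono (Finset.mem_range.1 hk)) le_rfl)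
    · simp only [IsDecoupledSum, Finset.sum_range_succ_sub_sum]
      refine ⟨fun k => ?_, fun k B hB => ?_, fun m B hB => ?_⟩
      · rw [isRandomVariable_iff_stronglyMeasurable]
        exact (hevs s).comp_measurable (hem k)
      · exact hfg.tangent k _ (hevm s B hB)
      · exact hfg.condIndep m (fun k => (fun x => ev x s) ⁻¹' B k) fun k => hevm s _ (hB k)
  rw [← ENNReal.rpow_le_rpow_iff hp, ENNReal.mul_rpow_of_nonneg _ _ hp.le, lpQNorm_rpow hp,
    lpQNorm_rpow hp, hfs n, hgs, (hdF n).2, heF.2, ← lintegral_const_mul _ heF.1]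
  exact lintegral_mono_ae key

end Fubini

/-! ### Jointly measurable evaluation on separable subspaces -/

section Evaluation

variable {Y : Type u} [AddCommGroup Y] [Module ℝ Y] [QuasiNorm Y] [QuasiBanachSpace Y]
variable {S : Type v} [MeasurableSpace S] {μ : Measure S} {p : ℝ} {hp : 0 < p}

theorem LqSpace.measure_lt_qnorm_lt_top (f : LqSpace Y p hp μ) {t : ℝ} (ht : 0 < t) :
    μ {s | t < qnorm (f.1 s)} < ∞ := by
  have h0 : ENNReal.ofReal t ^ p ≠ 0 := by
    simp [ENNReal.rpow_eq_zero_iff_of_pos hp, ht]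
  have h1 : μ {s | ENNReal.ofReal t ^ p ≤ ENNReal.ofReal (qnorm (f.1 s)) ^ p} < ∞ :=
    (meas_ge_le_lintegral_div (aemeasurable_ofReal_qnorm_rpow f.1.aestronglyMeasurable p) h0
      (ENNReal.rpow_ne_top_of_nonneg hp.le ENNReal.ofReal_ne_top)).trans_lt
      (ENNReal.div_lt_top f.lintegral_lt_top.ne h0)
  refine (measure_mono fun s hs => ?_).trans_lt h1
  exact ENNReal.rpow_le_rpow (ENNReal.ofReal_le_ofReal (le_of_lt hs)) hp.le

theorem LqSpace.measurableSet_exists_ne_zero (f : ℕ → LqSpace Y p hp μ) :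
    MeasurableSet {s | ∃ j, (f j).1 s ≠ 0} := by
  have h : {s | ∃ j, (f j).1 s ≠ 0} = ⋃ j, {s | 0 < qnorm ((f j).1 s)} := by
    ext s
    simp only [Set.mem_ofPred_eq, Set.mem_iUnion]
    refine exists_congr fun j => ?_
    rw [(QuasiBanachSpace.qnorm_nonneg _).lt_iff_ne', ne_eq, ne_eq,
      QuasiBanachSpace.qnorm_eq_zero_iff]
  rw [h]
  exact MeasurableSet.iUnion fun j => measurableSet_lt measurable_const
    (QuasiBanachSpace.continuous_qnorm.comp_stronglyMeasurable
      (f j).1.stronglyMeasurable).measurable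

/-- The sets where some |f j| exceeds 1/(m+1) have finite measure and exhaust the support. This
makes Fubini available for an arbitrary μ. -/
theorem LqSpace.sigmaFinite_restrict_support (f : ℕ → LqSpace Y p hp μ) :
    SigmaFinite (μ.restrict {s | ∃ j, (f j).1 s ≠ 0}) := by
  set T := {s | ∃ j, (f j).1 s ≠ 0} with hT
  have hTm : MeasurableSet T := LqSpace.measurableSet_exists_ne_zero f
  refine Measure.sigmaFinite_of_countable
    (S := Set.range fun z : ℕ × ℕ => {s | 1 / ((z.2 : ℝ) + 1) < qnorm ((f z.1).1 s)} ∪ Tᶜ)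
    (Set.countable_range _) ?_ ?_
  · rintro _ ⟨z, rfl⟩
    refine (measure_union_le _ _).trans_lt (ENNReal.add_lt_top.2 ⟨?_, ?_⟩)
    · exact (Measure.restrict_apply_le _ _).trans_lt ((f z.1).measure_lt_qnorm_lt_top (by positivity))
    · rw [Measure.restrict_apply hTm.compl]; simp
  · refine Set.eq_univ_of_forall fun s => ?_
    by_cases hs : s ∈ T
    · obtain ⟨j, hj⟩ := hs
      have h0 : 0 < qnorm ((f j).1 s) := lt_of_le_of_ne (QuasiBanachSpace.qnorm_nonneg _)
        fun h => hj ((QuasiBanachSpace.qnorm_eq_zero_iff _).1 h.symm)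
      obtain ⟨m, hm⟩ := exists_nat_one_div_lt h0
      exact ⟨_, ⟨(j, m), rfl⟩, Or.inl hm⟩
    · exact ⟨_, ⟨(0, 0), rfl⟩, Or.inr hs⟩

variable {X : Type*} [AddCommGroup X] [Module ℝ X] [QuasiNorm X] [QuasiBanachSpace X]
variable [MeasurableSpace X] [BorelSpace X] [SecondCountableTopology X]

/-- Arbitrary representatives of classes need not be jointly measurable in the class and the point.
Instead, fix representatives on a dense sequence, approximate y by its first member within 2^(-k/p),
and take the pointwise limit in k, which exists almost everywhere by summability. -/
theorem LqSpace.exists_evaluation (J : X →+ LqSpace Y p hp μ) (hJ : ∀ x, qnorm (J x) = qnorm x) :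
    ∃ (T : Set S) (ev : X → S → Y), SigmaFinite (μ.restrict T) ∧
      StronglyMeasurable (Function.uncurry ev) ∧ (∀ x, ev x =ᵐ[μ] (J x).1) ∧
      ∀ x, ∫⁻ s in T, ENNReal.ofReal (qnorm ((J x).1 s)) ^ p ∂μ =
        ∫⁻ s, ENNReal.ofReal (qnorm ((J x).1 s)) ^ p ∂μ := by
  set x : ℕ → X := TopologicalSpace.denseSeq X with hx
  have hex : ∀ (k : ℕ) (y : X), ∃ j, qnorm (x j - y) < ((1 / 2 : ℝ) ^ k) ^ (1 / p) := by
    intro k y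
    have hU := (QuasiBanachSpace.nhds_hasBasis y).mem_of_mem
      (i := ((1 / 2 : ℝ) ^ k) ^ (1 / p)) (by positivity)
    obtain ⟨_, ⟨j, rfl⟩, h⟩ := (TopologicalSpace.denseRange_denseSeq X).inter_nhds_nonempty hU
    exact ⟨j, h⟩
  classical
  set φ : ℕ → X → ℕ := fun k y => Nat.find (hex k y) with hφdef
  have hφ : ∀ k y, qnorm (x (φ k y) - y) < ((1 / 2 : ℝ) ^ k) ^ (1 / p) := fun k y =>
    Nat.find_spec (hex k y)
  have hφm : ∀ k, Measurable (φ k) := fun k => measurable_find (hex k) fun j =>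
    measurableSet_lt (QuasiBanachSpace.measurable_qnorm.comp (measurable_const.sub measurable_id))
      measurable_const
  set r : ℕ → S → Y := fun j => (J (x j)).1 with hr
  have hrm : ∀ j, StronglyMeasurable (r j) := fun j => (J (x j)).1.stronglyMeasurable
  have hevk : ∀ k, StronglyMeasurable fun z : X × S => r (φ k z.1) z.2 := by
    intro k
    borelize Y
    refine stronglyMeasurable_iff_measurable_separable.2 ⟨?_, ?_⟩
    · have h1 : Measurable fun z : ℕ × S => r z.1 z.2 :=
        measurable_from_prod_countable_right fun j => (hrm j).measurable
      exact h1.comp (((hφm k).comp measurable_fst).prodMk measurable_snd)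
    · refine (TopologicalSpace.IsSeparable.iUnion fun j => (hrm j).isSeparable_range).mono ?_
      rintro _ ⟨z, rfl⟩
      exact Set.mem_iUnion.2 ⟨φ k z.1, z.2, rfl⟩
  have hlim : ∀ y, ∀ᵐ s ∂μ, Tendsto (fun k => r (φ k y) s) atTop (𝓝 ((J y).1 s)) := by
    intro y
    have h1 := ae_tendsto_zero_of_tsum_lintegral_ne_top (μ := μ) hp
      (u := fun k s => r (φ k y) s - (J y).1 s)
      (fun k => (hrm _).aestronglyMeasurable.sub (J y).1.aestronglyMeasurable) ?_
    · filter_upwards [h1] with s hs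
      simpa using hs.add_const ((J y).1 s)
    · refine ne_top_of_le_ne_top (b := ∑' n : ℕ, (2⁻¹ : ℝ≥0∞) ^ n) ?_
        (ENNReal.tsum_le_tsum fun k => ?_)
      · rw [ENNReal.tsum_geometric]; simp
      · rw [hr, ← LqSpace.lintegral_sub_eq, ← map_sub, hJ]
        calc ENNReal.ofReal (qnorm (x (φ k y) - y)) ^ p
            ≤ ENNReal.ofReal (((1 / 2 : ℝ) ^ k) ^ (1 / p)) ^ p := by
              gcongr; exact (hφ k y).le
          _ = 2⁻¹ ^ k := by
              rw [ENNReal.ofReal_rpow_of_pos (by positivity), ← Real.rpow_mul (by positivity),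
                one_div_mul_cancel hp.ne', Real.rpow_one, ENNReal.ofReal_pow (by positivity)]
              simp
  refine ⟨{s | ∃ j, r j s ≠ 0}, fun y s => limUnder atTop fun k => r (φ k y) s,
    LqSpace.sigmaFinite_restrict_support fun j => J (x j),
    StronglyMeasurable.limUnder hevk, fun y => ?_, fun y => ?_⟩
  · filter_upwards [hlim y] with s hs
    exact hs.limUnder_eq
  · rw [← lintegral_indicator (LqSpace.measurableSet_exists_ne_zero fun j => J (x j))]
    refine lintegral_congr_ae ?_
    filter_upwards [hlim y] with s hs
    by_cases hT : s ∈ {s | ∃ j, r j s ≠ 0}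
    · exact Set.indicator_of_mem hT _
    · have h0 : ∀ j, r j s = 0 := fun j => by_contra fun hj => hT ⟨j, hj⟩
      simp only [h0] at hs
      rw [← tendsto_nhds_unique tendsto_const_nhds hs, QuasiBanachSpace.qnorm_zero]
      refine (Set.indicator_of_notMem hT _).trans ?_
      simp [hp]

theorem DecouplingWith.lqSpace {D : ℝ≥0} (h : DecouplingWith.{u, w} Y p D) :
    DecouplingWith.{max u v, w} (LqSpace Y p hp μ) p D := by
  refine decouplingWith_of_separable_subspace fun K hK hs => ?_
  have := QuasiSubspace.quasiBanachSpace hK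
  have := QuasiSubspace.separableSpace hK hs
  have := QuasiBanachSpace.secondCountableTopology_of_separable (X := QuasiSubspace K)
  borelize (QuasiSubspace K)
  obtain ⟨T, ev, hT, hev, hae, hint⟩ :=
    LqSpace.exists_evaluation (QuasiSubspace.incl K) (QuasiSubspace.qnorm_incl K)
  refine h.of_evaluation (μ := μ.restrict T) hp hev (fun x y => ae_restrict_of_ae ?_) fun x => ?_
  · filter_upwards [hae x, hae y, hae (x + y),
      LqSpace.coeFn_add (QuasiSubspace.incl K x) (QuasiSubspace.incl K y)] with s h1 h2 h3 h4
    rw [h3, map_add, h4, Pi.add_apply, Pi.add_apply, h1, h2]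
  · rw [← QuasiSubspace.qnorm_incl, LqSpace.ofReal_qnorm_rpow, ← hint]
    refine lintegral_congr_ae (ae_restrict_of_ae ?_)
    filter_upwards [hae x] with s hs
    rw [hs]

end Evaluation

/-! ### Embedding of Y and conclusion -/

section Embedding

variable {Y : Type u} [AddCommGroup Y] [Module ℝ Y] [QuasiNorm Y] [QuasiBanachSpace Y]
variable {S : Type v} [MeasurableSpace S] {μ : Measure S} {p : ℝ} {hp : 0 < p} {A : Set S}

theorem stronglyMeasurable_indicator_const (hA : MeasurableSet A) (y : Y) :
    StronglyMeasurable (A.indicator fun _ => y) :=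
  stronglyMeasurable_const.indicator hA

theorem lintegral_indicator_const_rpow (hp : 0 < p) (hA : MeasurableSet A) (y : Y) :
    ∫⁻ s, ENNReal.ofReal (qnorm (AEEqFun.mk _
      (stronglyMeasurable_indicator_const hA y).aestronglyMeasurable (μ := μ) s)) ^ p ∂μ =
      ENNReal.ofReal (qnorm y) ^ p * μ A := by
  rw [← lintegral_indicator_const hA]
  refine lintegral_congr_ae ?_
  filter_upwards [AEEqFun.coeFn_mk _
    (stronglyMeasurable_indicator_const hA y).aestronglyMeasurable (μ := μ)] with s hs
  rw [hs]
  by_cases h : s ∈ A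
  · simp [h]
  · simp [h, QuasiBanachSpace.qnorm_zero, hp]

theorem LqSpace.exists_isometry (hp : 0 < p) (hA : MeasurableSet A) (h0 : 0 < μ A)
    (htop : μ A < ∞) :
    ∃ J : Y →+ LqSpace Y p hp μ, ∀ y, qnorm (J y) = qnorm y := by
  set c : ℝ := ((μ A).toReal ^ (1 / p))⁻¹ with hc
  have hpos : 0 < (μ A).toReal := ENNReal.toReal_pos h0.ne' htop.ne
  have hc0 : 0 < c := by positivity
  have hcA : ENNReal.ofReal c ^ p * μ A = 1 := by
    rw [ENNReal.ofReal_rpow_of_pos hc0, hc, Real.inv_rpow (by positivity),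
      ← Real.rpow_mul hpos.le, one_div_mul_cancel hp.ne', Real.rpow_one]
    nth_rewrite 2 [← ENNReal.ofReal_toReal htop.ne]
    rw [← ENNReal.ofReal_mul (by positivity), inv_mul_cancel₀ hpos.ne', ENNReal.ofReal_one]
  have hmem : ∀ y : Y, AEEqFun.mk _
      (stronglyMeasurable_indicator_const hA y).aestronglyMeasurable ∈ lqSubmodule Y p hp μ := by
    intro y
    refine (lpQNorm_lt_top_iff hp μ _).2 ?_
    rw [lintegral_indicator_const_rpow hp hA]
    exact ENNReal.mul_lt_top (ENNReal.rpow_lt_top_of_nonneg hp.le ENNReal.ofReal_ne_top) htop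
  let J : Y →+ LqSpace Y p hp μ := AddMonoidHom.mk' (fun y => ⟨_, hmem (c • y)⟩) fun y z => by
    refine Subtype.ext ?_
    refine Eq.trans ?_ (AEEqFun.mk_add_mk _ _
      (stronglyMeasurable_indicator_const hA (c • y)).aestronglyMeasurable
      (stronglyMeasurable_indicator_const hA (c • z)).aestronglyMeasurable).symm
    refine AEEqFun.mk_eq_mk.2 (Eventually.of_forall fun s => ?_)
    simp only [smul_add, Pi.add_apply]
    by_cases h : s ∈ A <;> simp [h]
  refine ⟨J, fun y => ?_⟩
  have h : ENNReal.ofReal (qnorm (J y)) ^ p = ENNReal.ofReal (qnorm y) ^ p := by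
    rw [LqSpace.ofReal_qnorm_rpow]
    refine (lintegral_indicator_const_rpow hp hA (c • y)).trans ?_
    rw [QuasiBanachSpace.qnorm_smul, abs_of_pos hc0, ENNReal.ofReal_mul hc0.le,
      ENNReal.mul_rpow_of_nonneg _ _ hp.le, mul_right_comm, hcA, one_mul]
  exact (ENNReal.ofReal_eq_ofReal_iff (QuasiBanachSpace.qnorm_nonneg _)
    (QuasiBanachSpace.qnorm_nonneg _)).1 (ENNReal.rpow_left_injective hp.ne' h)

end Embedding

theorem corollary4p5 {Y : Type u} [AddCommGroup Y] [Module ℝ Y] [QuasiNorm Y] [QuasiBanachSpace Y]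
    (hY : Decoupling.{u, w} Y) {S : Type v} [MeasurableSpace S] (μ : Measure S) :
    (∀ (q : ℝ) (hq : 0 < q) (p : ℝ), 0 < p → DecouplingFor.{max u v, w} (LqSpace Y q hq μ) p) ∧
    ((∃ A : Set S, MeasurableSet A ∧ 0 < μ A ∧ μ A < ∞) →
      ∀ (p : ℝ) (hp : 0 < p),
        decouplingConst.{max u v, w} (LqSpace Y p hp μ) p = decouplingConst.{u, w} Y p) := by
  refine ⟨fun q hq p hp => ?_, ?_⟩
  · obtain ⟨p₀, hp₀, h⟩ := hY
    -- Fubini needs the exponent of the space, so the exponent is first moved to q in Y, and then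
    -- from q to p within L^q(S;Y).
    obtain ⟨D, hD⟩ := h.extrapolate hp₀ hq
    exact DecouplingFor.extrapolate hq hp ⟨D, hD.lqSpace⟩
  · rintro ⟨A, hA, h0, htop⟩ p hp
    obtain ⟨J, hJ⟩ := LqSpace.exists_isometry (Y := Y) hp hA h0 htop
    have h : ∀ D, DecouplingWith.{max u v, w} (LqSpace Y p hp μ) p D ↔
        DecouplingWith.{u, w} Y p D := fun D => ⟨fun h => h.of_isometry J hJ, fun h => h.lqSpace⟩
    simp only [decouplingConst, h]
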